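/- Let $V$ be a $3$-dimensional complex vector space with a Hermitian form $\langle-,-\rangle$ of signature $++-$ (linear in the first variable), let $\mathrm{SU}(2,1)$ be the group of its isometries of determinant $1$, let $\omega=e^{2\pi i/3}$ and $\Omega=\{1,\omega,\omega^2\}$. For $p\in\mathbb PV$ let $\sigma p\in\{-1,0,1\}$ be the sign of $\langle p,p\rangle$; $p$ is nonisotropic if $\sigma p\neq0$. A parameter is a complex number $\alpha$ with $|\alpha|=1$, $\alpha\notin\Omega$. For a nonisotropic $p$ and a parameter $\alpha$, let $R^p_\alpha$ be the special elliptic isometry $$R^p_\alpha x=(\alpha^{-2}-\alpha)\frac{\langle x,p\rangle}{\langle p,p\rangle}p+\alpha x .$$ Let $\mathrm L(p,q)$ be the complex line through $p\ne q$; a line $\mathbb PW$ is Euclidean if the form is degenerate on $W$, and the lines $\mathbb PW_1,\mathbb PW_2$ are orthogonal if $W_1^\perp\subset W_2$. Call a product $R^{p_2}_{\alpha_2}R^{p_1}_{\alpha_1}$ generic if $\alpha_1,\alpha_2$ are parameters, $p_1,p_2$ are nonisotropic, distinct and nonorthogonal, and $\mathrm L(p_1,p_2)$ is noneuclidean. Put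 $$\mathrm{ta}(p,q)=\frac{\langle p,q\rangle\langle q,p\rangle}{\langle p,p\rangle\langle q,q\rangle},\qquad \tau_{\alpha_1,\alpha_2}(t)=\alpha_1\alpha_2+\alpha_1^{-2}\alpha_2+\alpha_1\alpha_2^{-2}+(\alpha_1^{-2}-\alpha_1)(\alpha_2^{-2}-\alpha_2)t,$$ and $f(z)=|z|^4-8\,\mathrm{Re}(z^3)+18|z|^2-27$ (so that $f<0$ is the interior of Goldman's deltoid). Write $\alpha\sim\beta$ if the parameters $\alpha,\beta$ lie in a same one of the arcs $\omega^j\{e^{i\theta}:0<\theta<2\pi/3\}$, $j=0,1,2$. The primitive of a parameter $\alpha$ is the unique $a=e^{i\theta}$ with $0<\theta<\pi/3$ and $a^6=\alpha^3$. An isometry is regular elliptic if it has a negative fixed point in $\mathbb PV$ and pairwise distinct eigenvalues. For distinct nonorthogonal $p,q$, the geodesic through them is the projectivization of $\mathbb Rp+\mathbb R\langle p,q\rangle q$; if $\sigma p=\sigma q\neq0$ and $\mathrm L(p,q)$ is noneuclidean, the segment $\mathrm G[p,q]$ is the arc of this geodesic that joins $p$ and $q$ and has no point orthogonal to $p$ (and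 $\mathrm G[p,p]=\{p\}$). Angles between geodesics in a complex line are counterclockwise oriented. The geodesics associated to a generic product $R^{p_2}_{\alpha_2}R^{p_1}_{\alpha_1}$ are the geodesic $G$ through $p_1,p_2$ and the geodesics $G_1\ni p_1$, $G_2\ni p_2$ in $\mathrm L(p_1,p_2)$ such that the angle from $G_1$ to $G$ at $p_1$ is $\mathrm{Arg}(a_1^3)$ and the angle from $G$ to $G_2$ at $p_2$ is $\mathrm{Arg}(a_2^3)$, where $a_i$ is the primitive of $\alpha_i$. A basic relation is a true equality $R^{p_2}_{\alpha_2}R^{p_1}_{\alpha_1}=R^{q_2}_{\beta_2}R^{q_1}_{\beta_1}$ in $\mathrm{SU}(2,1)$ between generic products, with common value $R$, of one of the following seven kinds. 1. Bending: $\beta_i=\alpha_i$ and $q_i=Cp_i$, $i=1,2$, for some $C\in\mathrm{SU}(2,1)$ commuting with $R$. 2. $f$-bending: $q_i\in G_i$, $\sigma q_i=\sigma p_i$, $\langle p_i,q_i\rangle\ne0$, $\alpha_i\sim\beta_i$, $i=1,2$; $\alpha_1\alpha_2=\beta_1\beta_2$; and neither $\mathrm G[p_1,q_1]$ nor $\mathrm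 G[p_2,q_2]$ contains a fixed point of $R$. 3. Change of orientation: $R^{p_2}_{\alpha_2}R^{p_1}_{\alpha_1}=R^{p_1'}_{\alpha_1}R^{p_2}_{\alpha_2}$ with $p_1'=R^{p_2}_{\alpha_2}p_1$. 4. Change of components: $R^{p_2}_{\alpha_2}R^{p_1}_{\alpha_1}=R^{p_2}_{\omega\alpha_2}R^{p_1}_{\omega^{-1}\alpha_1}$ or $R^{p_2}_{\alpha_2}R^{p_1}_{\alpha_1}=R^{p_2}_{\omega^{-1}\alpha_2}R^{p_1}_{\omega\alpha_1}$. 5. Simultaneous change of signs: $\beta_i=\alpha_i$, $\sigma p_i=-\sigma q_i$, $i=1,2$, $\mathrm{ta}(p_1,p_2)=\mathrm{ta}(q_1,q_2)$, and $R$ is not regular elliptic. 6. Single change of sign: $\alpha_1\alpha_2=\beta_1\beta_2$; there is no $\delta\in\Omega$ with $\delta\alpha_1\sim\beta_1$ and $\delta^{-1}\alpha_2\sim\beta_2$; $t_0=\mathrm{ta}(p_1,p_2)>1$, $s_0=\mathrm{ta}(q_1,q_2)<0$, and $z=\tau_{\alpha_1,\alpha_2}(t_0)=\tau_{\beta_1,\beta_2}(s_0)$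 satisfies $f(z)\geq0$. 7. Orthogonal relation: $\alpha_1\alpha_2\ne\beta_1\beta_2$, the lines $\mathrm L(p_1,p_2)$ and $\mathrm L(q_1,q_2)$ are orthogonal, $\tau_{\alpha_1,\alpha_2}(\mathrm{ta}(p_1,p_2))=\tau_{\beta_1,\beta_2}(\mathrm{ta}(q_1,q_2))$, and $R$ is regular elliptic. **Theorem.** Let $p_1,p_2$ and $q_1,q_2$ be pairs of distinct nonisotropic nonorthogonal points such that $\mathrm L(p_1,p_2)$ and $\mathrm L(q_1,q_2)$ are noneuclidean, let $\alpha_1,\alpha_2,\beta_1,\beta_2$ be parameters, and let $\delta\in\Omega$. If $$R^{p_2}_{\alpha_2}R^{p_1}_{\alpha_1}=\delta R^{q_2}_{\beta_2}R^{q_1}_{\beta_1},$$ then this relation follows from the basic ones: writing $\delta R^{q_2}_{\beta_2}=R^{q_2}_{\delta\beta_2}$, there is a finite chain of generic products that starts at $R^{p_2}_{\alpha_2}R^{p_1}_{\alpha_1}$, ends at $R^{q_2}_{\delta\beta_2}R^{q_1}_{\beta_1}$, and in which any two consecutive products are the two sides (in one order or the other) of a basic relation. -/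

import Mathlib

open scoped LinearAlgebra.Projectivization

noncomputable section

namespace SpecialElliptic

/-! ### Complex hyperbolic geometry -/

variable {V : Type*} [AddCommGroup V] [Module ℂ V]

/-- `h` is a Hermitian form of signature `++-` on the three-dimensional complex space `V`
(linear in the first variable): some basis of `V` is `h`-orthogonal with squares `1, 1, -1`. -/
def IsSignature21 (h : V →ₗ[ℂ] V →ₗ⋆[ℂ] ℂ) : Prop :=
  ∃ b : Module.Basis (Fin 3) ℂ V, ∀ i j : Fin 3,
    h (b i) (b j) = if i = j then (![1, 1, -1] : Fin 3 → ℂ) i else 0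

/-- The signature `σ p ∈ {-1, 0, 1}` of a point of `ℙV`. -/
def signature (h : V →ₗ[ℂ] V →ₗ⋆[ℂ] ℂ) (p : ℙ ℂ V) : SignType :=
  SignType.sign (h p.rep p.rep).re

/-- The point `p` is nonisotropic. -/
def IsNonisotropic (h : V →ₗ[ℂ] V →ₗ⋆[ℂ] ℂ) (p : ℙ ℂ V) : Prop :=
  h p.rep p.rep ≠ 0

/-- The points `p` and `q` are orthogonal. -/
def IsOrthogonal (h : V →ₗ[ℂ] V →ₗ⋆[ℂ] ℂ) (p q : ℙ ℂ V) : Prop :=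
  h p.rep q.rep = 0

/-- The tance `⟨p,q⟩⟨q,p⟩ / (⟨p,p⟩⟨q,q⟩)`, a real number. -/
def tance (h : V →ₗ[ℂ] V →ₗ⋆[ℂ] ℂ) (p q : ℙ ℂ V) : ℝ :=
  Complex.normSq (h p.rep q.rep) / ((h p.rep p.rep).re * (h q.rep q.rep).re)

/-- The subspace whose projectivization is the complex line `L(p,q)` spanned by `p ≠ q`. -/
def line (p q : ℙ ℂ V) : Submodule ℂ V := p.submodule ⊔ q.submodule

/-- The orthogonal complement of `W`; when `ℙW` is a complex line, it is the polar point of `ℙW`. -/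
def polar (h : V →ₗ[ℂ] V →ₗ⋆[ℂ] ℂ) (W : Submodule ℂ V) : Submodule ℂ V where
  carrier := {c | ∀ w ∈ W, h c w = 0}
  add_mem' := by
    intro a b ha hb w hw
    simp [ha w hw, hb w hw]
  zero_mem' := by
    intro w _
    simp
  smul_mem' := by
    intro c a ha w hw
    simp [ha w hw]

/-- The line `ℙW` is Euclidean: the form is degenerate on `W`. -/
def IsEuclidean (h : V →ₗ[ℂ] V →ₗ⋆[ℂ] ℂ) (W : Submodule ℂ V) : Prop :=
  ∃ v ∈ W, v ≠ 0 ∧ ∀ w ∈ W, h v w = 0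

/-- Two complex lines are orthogonal: the polar point of the first belongs to the second. -/
def AreOrthogonalLines (h : V →ₗ[ℂ] V →ₗ⋆[ℂ] ℂ) (W₁ W₂ : Submodule ℂ V) : Prop :=
  polar h W₁ ≤ W₂

/-- `A` belongs to `SU(2,1)`. -/
def IsSU (h : V →ₗ[ℂ] V →ₗ⋆[ℂ] ℂ) (A : Module.End ℂ V) : Prop :=
  (∀ x y : V, h (A x) (A y) = h x y) ∧ LinearMap.det A = 1

/-- The linear map `A` sends the point `p` of `ℙV` to the point `q`. -/
def Sends (A : Module.End ℂ V) (p q : ℙ ℂ V) : Prop :=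
  p.submodule.map A = q.submodule

/-- The point `x` of `ℙV` is fixed by `A`. -/
def IsFixedPoint (A : Module.End ℂ V) (x : ℙ ℂ V) : Prop := Sends A x x

/-- The special elliptic isometry
`R_α^p : x ↦ (α⁻² - α) (⟨x,p⟩ / ⟨p,p⟩) p + α x`. -/
def specialElliptic (h : V →ₗ[ℂ] V →ₗ⋆[ℂ] ℂ) (p : ℙ ℂ V) (α : ℂ) : Module.End ℂ V where
  toFun x := ((α ^ (-2 : ℤ) - α) * (h x p.rep / h p.rep p.rep)) • p.rep + α • x
  map_add' := by
    intro x y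
    simp only [map_add, LinearMap.add_apply, add_div, mul_add, add_smul, smul_add]
    abel
  map_smul' := by
    intro c x
    simp only [map_smul, LinearMap.smul_apply, smul_eq_mul, RingHom.id_apply, smul_add, smul_smul]
    congr 2 <;> ring

/-- An isometry is regular elliptic: it has a negative fixed point and pairwise distinct
eigenvalues. -/
def IsRegularElliptic (h : V →ₗ[ℂ] V →ₗ⋆[ℂ] ℂ) (A : Module.End ℂ V) : Prop :=
  (∃ x : ℙ ℂ V, signature h x = -1 ∧ IsFixedPoint A x) ∧
    ∃ μ : Fin 3 → ℂ, Function.Injective μ ∧ ∀ i, A.HasEigenvalue (μ i)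

/-! ### Parameters and their components -/

/-- The primitive cube root of unity `ω = e^{2πi/3}`. -/
def omega : ℂ := Complex.exp (2 * Real.pi * Complex.I / 3)

/-- `δ ∈ Ω`, the set of cube roots of unity. -/
def IsCubeRoot (δ : ℂ) : Prop := δ ^ 3 = 1

/-- `α` is a parameter: a unit complex number which is not a cube root of unity. -/
def IsParameter (α : ℂ) : Prop := ‖α‖ = 1 ∧ ¬ IsCubeRoot α

/-- The open arc `I_j = ω^j {e^{iθ} | 0 < θ < 2π/3}` of the unit circle. -/
def arc (j : Fin 3) : Set ℂ :=
  {z | ∃ θ : ℝ, 0 < θ ∧ θ < 2 * Real.pi / 3 ∧ z = omega ^ (j : ℕ) * Complex.exp (θ * Complex.I)}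

/-- `α ∼ β`: the parameters are in a same component. -/
def SameComponent (α β : ℂ) : Prop := ∃ j : Fin 3, α ∈ arc j ∧ β ∈ arc j

/-- `a` is the primitive of `α`: it belongs to the open arc `J` from `1` to `-ω² = e^{iπ/3}`
and `(a²)³ = α³`. -/
def IsPrimitive (a α : ℂ) : Prop :=
  (∃ θ : ℝ, 0 < θ ∧ θ < Real.pi / 3 ∧ a = Complex.exp (θ * Complex.I)) ∧ (a ^ 2) ^ 3 = α ^ 3

/-- `τ_{α₁,α₂}(t)`; it is the trace of `R_{α₂}^{p₂} R_{α₁}^{p₁}` when `t = ta(p₁,p₂)`. -/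
def traceLine (α₁ α₂ : ℂ) (t : ℝ) : ℂ :=
  α₁ * α₂ + α₁ ^ (-2 : ℤ) * α₂ + α₁ * α₂ ^ (-2 : ℤ)
    + (α₁ ^ (-2 : ℤ) - α₁) * (α₂ ^ (-2 : ℤ) - α₂) * t

/-- The polynomial `|z|⁴ - 8 Re z³ + 18 |z|² - 27`. Goldman's deltoid is its zero set; the interior
of the deltoid is the set where it is negative. -/
def deltoid (z : ℂ) : ℝ := ‖z‖ ^ 4 - 8 * (z ^ 3).re + 18 * ‖z‖ ^ 2 - 27

/-! ### Geodesics -/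

/-- The (extended) geodesic through the nonisotropic point `p` in the direction of the nonzero
vector `v` orthogonal to `p`, i.e. the complex projectivization of `ℝp + ℝv`. Here, `v` stands for
the tangent vector at `p` which, as a linear map from `ℂp` to the orthogonal complement of `p`,
sends the representative `p.rep` to `v`; so, rotating a direction counterclockwise by the
angle `θ` means multiplying `v` by `e^{iθ}`. -/
def geodesic (p : ℙ ℂ V) (v : V) : Set (ℙ ℂ V) :=
  {x | ∃ s t : ℝ, (s : ℂ) • p.rep + (t : ℂ) • v ≠ 0 ∧ (s : ℂ) • p.rep + (t : ℂ) • v ∈ x.submodule}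

/-- The direction at `p` of the geodesic joining `p` to `q`, where `p, q` are distinct and
nonorthogonal: the component of `⟨p,q⟩ q` orthogonal to `p`. Thus `geodesic p (direction h p q)` is
the projectivization of `ℝp + ℝ⟨p,q⟩q`. -/
def direction (h : V →ₗ[ℂ] V →ₗ⋆[ℂ] ℂ) (p q : ℙ ℂ V) : V :=
  h p.rep q.rep • (q.rep - (h q.rep p.rep / h p.rep p.rep) • p.rep)

/-- The geodesic segment `G[p,q]`, for nonorthogonal points `p, q` of the same signature: the
arc from `p` to `q` of the geodesic `ℙ(ℝp + ℝ⟨p,q⟩q)` on which no point is orthogonal to `p`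
(it is the single point `p` when `p = q`). -/
def segment (h : V →ₗ[ℂ] V →ₗ⋆[ℂ] ℂ) (p q : ℙ ℂ V) : Set (ℙ ℂ V) :=
  {x | ∃ s t : ℝ, 0 ≤ s ∧ 0 ≤ t ∧
    (s : ℂ) • p.rep + ((t : ℂ) * (h p.rep q.rep / h p.rep p.rep)) • q.rep ≠ 0 ∧
    (s : ℂ) • p.rep + ((t : ℂ) * (h p.rep q.rep / h p.rep p.rep)) • q.rep ∈ x.submodule}

/-! ### Products of two special elliptic isometries -/

/-- Two centres `p₁, p₂` and two parameters `α₁, α₂`: the data of a product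
`R_{α₂}^{p₂} R_{α₁}^{p₁}`. -/
structure Config (V : Type*) [AddCommGroup V] [Module ℂ V] where
  p₁ : ℙ ℂ V
  p₂ : ℙ ℂ V
  α₁ : ℂ
  α₂ : ℂ

/-- The isometry `R_{α₂}^{p₂} R_{α₁}^{p₁}`. -/
def Config.product (h : V →ₗ[ℂ] V →ₗ⋆[ℂ] ℂ) (X : Config V) : Module.End ℂ V :=
  specialElliptic h X.p₂ X.α₂ * specialElliptic h X.p₁ X.α₁

/-- `p₁, p₂` are distinct nonisotropic nonorthogonal points and the line they span is
noneuclidean. -/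
def IsGenericPair (h : V →ₗ[ℂ] V →ₗ⋆[ℂ] ℂ) (p₁ p₂ : ℙ ℂ V) : Prop :=
  IsNonisotropic h p₁ ∧ IsNonisotropic h p₂ ∧ p₁ ≠ p₂ ∧ ¬ IsOrthogonal h p₁ p₂ ∧
    ¬ IsEuclidean h (line p₁ p₂)

/-- The centres form a generic pair and `α₁, α₂` are parameters. -/
def Config.IsGeneric (h : V →ₗ[ℂ] V →ₗ⋆[ℂ] ℂ) (X : Config V) : Prop :=
  IsGenericPair h X.p₁ X.p₂ ∧ IsParameter X.α₁ ∧ IsParameter X.α₂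

/-- The geodesic `G₁` associated to `R_{α₂}^{p₂} R_{α₁}^{p₁}`, `a₁` being the primitive of `α₁`: it
passes through `p₁`, and the counterclockwise oriented angle at `p₁` from `G₁` to the geodesic
joining `p₁` and `p₂` is `Arg (a₁³)`. -/
def Config.geodesic₁ (h : V →ₗ[ℂ] V →ₗ⋆[ℂ] ℂ) (X : Config V) (a₁ : ℂ) : Set (ℙ ℂ V) :=
  geodesic X.p₁ ((a₁ ^ 3)⁻¹ • direction h X.p₁ X.p₂)

/-- The geodesic `G₂` associated to `R_{α₂}^{p₂} R_{α₁}^{p₁}`, `a₂` being the primitive of `α₂`: it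
passes through `p₂`, and the counterclockwise oriented angle at `p₂` from the geodesic
joining `p₁` and `p₂` to `G₂` is `Arg (a₂³)`. -/
def Config.geodesic₂ (h : V →ₗ[ℂ] V →ₗ⋆[ℂ] ℂ) (X : Config V) (a₂ : ℂ) : Set (ℙ ℂ V) :=
  geodesic X.p₂ (a₂ ^ 3 • direction h X.p₂ X.p₁)

/-! ### The seven kinds of basic relations

In each of the following definitions, `X` is the left-hand side `R_{α₂}^{p₂} R_{α₁}^{p₁}`
and `Y` is the right-hand side `R_{β₂}^{q₂} R_{β₁}^{q₁}` of a relation between generic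
products; that the two products are equal is required in `BasicRelation`. -/

/-- Bending: an isometry commuting with the product is applied to the centres. -/
def IsBending (h : V →ₗ[ℂ] V →ₗ⋆[ℂ] ℂ) (X Y : Config V) : Prop :=
  ∃ C : Module.End ℂ V, IsSU h C ∧ C * X.product h = X.product h * C ∧
    Sends C X.p₁ Y.p₁ ∧ Sends C X.p₂ Y.p₂ ∧ Y.α₁ = X.α₁ ∧ Y.α₂ = X.α₂

/-- `f`-bending. -/
def IsFBending (h : V →ₗ[ℂ] V →ₗ⋆[ℂ] ℂ) (X Y : Config V) : Prop :=
  (∃ a₁ a₂ : ℂ, IsPrimitive a₁ X.α₁ ∧ IsPrimitive a₂ X.α₂ ∧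
    Y.p₁ ∈ X.geodesic₁ h a₁ ∧ Y.p₂ ∈ X.geodesic₂ h a₂) ∧
  (signature h Y.p₁ = signature h X.p₁ ∧ signature h Y.p₂ = signature h X.p₂ ∧
    ¬ IsOrthogonal h X.p₁ Y.p₁ ∧ ¬ IsOrthogonal h X.p₂ Y.p₂) ∧
  (X.α₁ * X.α₂ = Y.α₁ * Y.α₂ ∧ SameComponent X.α₁ Y.α₁ ∧ SameComponent X.α₂ Y.α₂) ∧
  ∀ x : ℙ ℂ V, IsFixedPoint (X.product h) x →
    x ∉ segment h X.p₁ Y.p₁ ∧ x ∉ segment h X.p₂ Y.p₂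

/-- Change of orientation: `R_{α₂}^{p₂} R_{α₁}^{p₁} = R_{α₁}^{R p₁} R_{α₂}^{p₂}`
with `R = R_{α₂}^{p₂}`. -/
def IsChangeOfOrientation (h : V →ₗ[ℂ] V →ₗ⋆[ℂ] ℂ) (X Y : Config V) : Prop :=
  Y.p₁ = X.p₂ ∧ Y.α₁ = X.α₂ ∧
    Sends (specialElliptic h X.p₂ X.α₂) X.p₁ Y.p₂ ∧ Y.α₂ = X.α₁

/-- Change of components: `R_{α₂}^{p₂} R_{α₁}^{p₁} = R_{ωα₂}^{p₂} R_{ω⁻¹α₁}^{p₁}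
= R_{ω⁻¹α₂}^{p₂} R_{ωα₁}^{p₁}`. -/
def IsChangeOfComponents (X Y : Config V) : Prop :=
  Y.p₁ = X.p₁ ∧ Y.p₂ = X.p₂ ∧
    ((Y.α₁ = omega⁻¹ * X.α₁ ∧ Y.α₂ = omega * X.α₂) ∨
      (Y.α₁ = omega * X.α₁ ∧ Y.α₂ = omega⁻¹ * X.α₂))

/-- Simultaneous change of signs. -/
def IsSimultaneousChangeOfSigns (h : V →ₗ[ℂ] V →ₗ⋆[ℂ] ℂ) (X Y : Config V) : Prop :=
  Y.α₁ = X.α₁ ∧ Y.α₂ = X.α₂ ∧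
    signature h X.p₁ = -signature h Y.p₁ ∧ signature h X.p₂ = -signature h Y.p₂ ∧
    tance h X.p₁ X.p₂ = tance h Y.p₁ Y.p₂ ∧ ¬ IsRegularElliptic h (X.product h)

/-- Single change of sign. -/
def IsSingleChangeOfSign (h : V →ₗ[ℂ] V →ₗ⋆[ℂ] ℂ) (X Y : Config V) : Prop :=
  X.α₁ * X.α₂ = Y.α₁ * Y.α₂ ∧
    (¬ ∃ δ : ℂ, IsCubeRoot δ ∧ SameComponent (δ * X.α₁) Y.α₁ ∧ SameComponent (δ⁻¹ * X.α₂) Y.α₂) ∧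
    1 < tance h X.p₁ X.p₂ ∧ tance h Y.p₁ Y.p₂ < 0 ∧
    traceLine X.α₁ X.α₂ (tance h X.p₁ X.p₂) = traceLine Y.α₁ Y.α₂ (tance h Y.p₁ Y.p₂) ∧
    0 ≤ deltoid (traceLine X.α₁ X.α₂ (tance h X.p₁ X.p₂))

/-- Orthogonal relation (of length 4): the parameters have distinct products, the lines spanned by
the two pairs of centres are orthogonal, and the traces given by the two tances agree, being
the trace of a regular elliptic isometry. -/
def IsOrthogonalRelation (h : V →ₗ[ℂ] V →ₗ⋆[ℂ] ℂ) (X Y : Config V) : Prop :=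
  X.α₁ * X.α₂ ≠ Y.α₁ * Y.α₂ ∧ AreOrthogonalLines h (line X.p₁ X.p₂) (line Y.p₁ Y.p₂) ∧
    traceLine X.α₁ X.α₂ (tance h X.p₁ X.p₂) = traceLine Y.α₁ Y.α₂ (tance h Y.p₁ Y.p₂) ∧
    IsRegularElliptic h (X.product h)

/-- The equality `R_{α₂}^{p₂} R_{α₁}^{p₁} = R_{β₂}^{q₂} R_{β₁}^{q₁}` holds, both sides are generic,
and it is a relation of one of the seven basic kinds. -/
structure BasicRelation (h : V →ₗ[ℂ] V →ₗ⋆[ℂ] ℂ) (X Y : Config V) : Prop where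
  generic_left : X.IsGeneric h
  generic_right : Y.IsGeneric h
  product_eq : X.product h = Y.product h
  kind : IsBending h X Y ∨ IsFBending h X Y ∨ IsChangeOfOrientation h X Y ∨
    IsChangeOfComponents X Y ∨ IsSimultaneousChangeOfSigns h X Y ∨
    IsSingleChangeOfSign h X Y ∨ IsOrthogonalRelation h X Y

/-- The relation `R_{α₂}^{p₂} R_{α₁}^{p₁} = R_{β₂}^{q₂} R_{β₁}^{q₁}` follows from the basic ones: its
two sides are joined by a finite chain of basic relations, each read in either direction. -/
def FollowsFromBasic (h : V →ₗ[ℂ] V →ₗ⋆[ℂ] ℂ) : Config V → Config V → Prop :=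
  Relation.EqvGen (BasicRelation h)

end SpecialElliptic

end

/-! Let R be the common product. The polar vector of the line of centres is an eigenvector of R with
eigenvalue α₁α₂, and that eigenspace is one-dimensional (`Config.IsGeneric.eigen_iff`). Hence R and
the number α₁α₂ determine the line. Absorb δ into β₂. If α₁α₂ ≠ β₁β₂, the two polar vectors are
orthogonal eigenvectors, a vector orthogonal to both is an eigenvector with a third eigenvalue, and
the relation itself is an orthogonal one (`basicRelation_of_mul_ne`).

If α₁α₂ = β₁β₂, both pairs of centres span the same plane W. Write each parameter as ω^j e^{2iθ/3}
with 0 < θ < π. On W, up to a unit scalar, the isometry with centre p and angle θ is cos θ - i sin θ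
A, where A is the reflection in p; the product is H - iN with H real, N self-adjoint and N² = 1 -
H². Each reflection A₁, A₂ anticommutes with N up to a scalar, so the real combinations xA + yN of
square 1 are again candidates for reflections, and their centres run along the geodesics G₁, G₂.
Solving for x and y yields prescribed new angles with the same sum (`exists_shifted_centres`,
`exists_fBending`). Once the parameters agree, the two products differ by a bending or by a
simultaneous change of signs (`basicRelation_of_parameters_eq`).

The argument that the segments avoid the fixed points of R breaks down when H² < 1 and the line is
hyperbolic. This case needs no f-bending: R is then regular elliptic and has another decomposition,
with centres orthogonal to its negative eigenvector and with another polar eigenvalue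
(`Config.IsGeneric.exists_mul_ne`). Two orthogonal relations through that decomposition join the two
sides.

In the remaining cases, α₁α₂ = β₁β₂ forces the two sums of angles to agree or to differ by π. If
they agree, changes of components align the arcs and a single f-bending reaches the parameters of
the other side; the only obstruction is a sign when H = 1, removed by a change of orientation
(`followsFromBasic_of_sum_eq'`). If they differ by π, H changes sign, which forces a hyperbolic line
with one tance above 1 and the other negative: a single change of sign. -/

noncomputable section

namespace SpecialElliptic

open ComplexConjugate

/-! ### Hermitian forms -/

section Hermitian

variable {V : Type*} [AddCommGroup V] [Module ℂ V]

/-- The form `h` is Hermitian. -/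
def Herm (h : V →ₗ[ℂ] V →ₗ⋆[ℂ] ℂ) : Prop := ∀ x y : V, h y x = conj (h x y)

/-- The real number `⟨v,v⟩`. -/
def nrm (h : V →ₗ[ℂ] V →ₗ⋆[ℂ] ℂ) (v : V) : ℝ := (h v v).re

variable {h : V →ₗ[ℂ] V →ₗ⋆[ℂ] ℂ}

theorem Herm.self_eq (hH : Herm h) (v : V) : h v v = (nrm h v : ℂ) := by
  have := hH v v
  exact (Complex.conj_eq_iff_re.mp this.symm).symm

theorem Herm.eq_zero_comm (hH : Herm h) {x y : V} (hxy : h x y = 0) : h y x = 0 := by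
  rw [hH x y, hxy, map_zero]

theorem Herm.self_ne_zero (hH : Herm h) {v : V} : h v v ≠ 0 ↔ nrm h v ≠ 0 := by
  rw [hH.self_eq v]
  exact_mod_cast Iff.rfl

theorem ne_zero_of_self {v : V} (hv : h v v ≠ 0) : v ≠ 0 := by
  rintro rfl
  simp at hv

theorem nrm_smul (hH : Herm h) (a : ℂ) (v : V) : nrm h (a • v) = Complex.normSq a * nrm h v := by
  have : h (a • v) (a • v) = ((Complex.normSq a * nrm h v : ℝ) : ℂ) := by
    simp only [map_smul, LinearMap.smul_apply, LinearMap.map_smulₛₗ, hH.self_eq v, smul_eq_mul]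
    push_cast
    rw [Complex.normSq_eq_conj_mul_self]
    ring
  rw [nrm, this, Complex.ofReal_re]

theorem normSq_eq_mul (hH : Herm h) (x y : V) : (Complex.normSq (h x y) : ℂ) = h x y * h y x := by
  rw [hH x y, Complex.mul_conj]

/-- Coordinates in a basis which is orthonormal for the form. -/
theorem IsSignature21.exists_coord (hh : IsSignature21 h) :
    ∃ b : Module.Basis (Fin 3) ℂ V, ∀ x y : V, h x y =
      b.repr x 0 * conj (b.repr y 0) + b.repr x 1 * conj (b.repr y 1)
        - b.repr x 2 * conj (b.repr y 2) := by
  obtain ⟨b, hb⟩ := hh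
  refine ⟨b, fun x y => ?_⟩
  conv_lhs => rw [← b.sum_repr x, ← b.sum_repr y]
  simp only [Fin.sum_univ_three, map_add, map_smul, LinearMap.add_apply, LinearMap.smul_apply,
    LinearMap.map_smulₛₗ, hb, smul_eq_mul]
  simp
  ring

theorem IsSignature21.herm (hh : IsSignature21 h) : Herm h := by
  obtain ⟨b, hb⟩ := hh.exists_coord
  intro x y
  rw [hb, hb]
  simp only [map_add, map_sub, map_mul, Complex.conj_conj]
  ring

theorem IsSignature21.finrank (hh : IsSignature21 h) : Module.finrank ℂ V = 3 := by
  obtain ⟨b, -⟩ := hh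
  simpa using Module.finrank_eq_card_basis b

theorem IsSignature21.finite (hh : IsSignature21 h) : Module.Finite ℂ V := by
  obtain ⟨b, -⟩ := hh
  exact Module.Finite.of_basis b

theorem IsSignature21.exists_neg (hh : IsSignature21 h) : ∃ v, nrm h v < 0 := by
  obtain ⟨b, hb⟩ := hh
  refine ⟨b 2, ?_⟩
  simp [nrm, hb]

theorem IsSignature21.nondegenerate (hh : IsSignature21 h) {x : V} (hx : ∀ y, h x y = 0) :
    x = 0 := by
  obtain ⟨b, hb⟩ := hh.exists_coord
  apply b.repr.injective
  ext i
  have h0 := hx (b 0)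
  have h1 := hx (b 1)
  have h2 := hx (b 2)
  rw [hb] at h0 h1 h2
  simp at h0 h1 h2
  fin_cases i <;> simp [h0, h1, h2]

/-- Reversed Cauchy–Schwarz: if v were not positive, orthogonality to u would make the positive
parts of the coordinates too small to balance the negative ones. -/
theorem IsSignature21.pos_of_orthogonal (hh : IsSignature21 h) {u v : V} (huv : h u v = 0)
    (hu : nrm h u < 0) (hv : v ≠ 0) : 0 < nrm h v := by
  obtain ⟨b, hb⟩ := hh.exists_coord
  have key : ∀ x, nrm h x = Complex.normSq (b.repr x 0) + Complex.normSq (b.repr x 1)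
      - Complex.normSq (b.repr x 2) := by
    intro x
    rw [nrm, hb]
    simp [Complex.mul_conj]
  have hv0 : ¬ (b.repr v 0 = 0 ∧ b.repr v 1 = 0 ∧ b.repr v 2 = 0) := by
    rintro ⟨h0, h1, h2⟩
    apply hv
    apply b.repr.injective
    ext i
    fin_cases i <;> simp [h0, h1, h2]
  rw [key] at hu ⊢
  rw [hb] at huv
  generalize b.repr u 0 = u0 at *
  generalize b.repr u 1 = u1 at *
  generalize b.repr u 2 = u2 at *
  generalize b.repr v 0 = v0 at *
  generalize b.repr v 1 = v1 at *
  generalize b.repr v 2 = v2 at *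
  have e1 : u2 * conj v2 = u0 * conj v0 + u1 * conj v1 := by linear_combination -huv
  -- Lagrange's identity for the positive coordinates; the orthogonality `e1` replaces their pairing
  -- by the negative one.
  have e2 : Complex.normSq u2 * Complex.normSq v2 + Complex.normSq (u0 * v1 - u1 * v0)
      = (Complex.normSq u0 + Complex.normSq u1) * (Complex.normSq v0 + Complex.normSq v1) := by
    have e3 : Complex.normSq u2 * Complex.normSq v2
        = Complex.normSq (u0 * conj v0 + u1 * conj v1) := by
      rw [← e1, Complex.normSq_mul, Complex.normSq_conj]
    rw [e3]
    simp only [Complex.normSq_apply, Complex.add_re, Complex.add_im, Complex.mul_re,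
      Complex.mul_im, Complex.conj_re, Complex.conj_im, Complex.sub_re, Complex.sub_im]
    ring
  have n0 := Complex.normSq_nonneg u0
  have n1 := Complex.normSq_nonneg u1
  have m0 := Complex.normSq_nonneg v0
  have m1 := Complex.normSq_nonneg v1
  have m2 := Complex.normSq_nonneg v2
  have mm := Complex.normSq_nonneg (u0 * v1 - u1 * v0)
  have hu2 : 0 < Complex.normSq u2 := by linarith
  by_contra hcon
  push Not at hcon
  have hle : Complex.normSq v0 + Complex.normSq v1 ≤ Complex.normSq v2 := by linarith
  have h1 : Complex.normSq u2 * Complex.normSq v2 ≤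
      (Complex.normSq u0 + Complex.normSq u1) * Complex.normSq v2 :=
    le_trans (by linarith) (mul_le_mul_of_nonneg_left hle (by linarith))
  have h2 : Complex.normSq v2 = 0 := by
    by_contra hne
    have : 0 < Complex.normSq v2 := lt_of_le_of_ne m2 (Ne.symm hne)
    have := mul_lt_mul_of_pos_right (show Complex.normSq u0 + Complex.normSq u1
      < Complex.normSq u2 by linarith) this
    linarith
  apply hv0
  refine ⟨?_, ?_, Complex.normSq_eq_zero.mp h2⟩ <;> apply Complex.normSq_eq_zero.mp <;> linarith

end Hermitian

/-! ### Special elliptic isometries centred at vectors -/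

section Operators

variable {V : Type*} [AddCommGroup V] [Module ℂ V]

/-- The orthogonal projection onto the line spanned by `v`. -/
def proj (h : V →ₗ[ℂ] V →ₗ⋆[ℂ] ℂ) (v : V) : Module.End ℂ V :=
  ((h v v)⁻¹ • h.flip v).smulRight v

/-- The reflection in the line spanned by `v`. -/
def refl (h : V →ₗ[ℂ] V →ₗ⋆[ℂ] ℂ) (v : V) : Module.End ℂ V := (2 : ℂ) • proj h v - 1

/-- The special elliptic isometry whose centre is the class of the vector `v`. -/
def ell (h : V →ₗ[ℂ] V →ₗ⋆[ℂ] ℂ) (v : V) (α : ℂ) : Module.End ℂ V :=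
  (α ^ (-2 : ℤ) - α) • proj h v + α • 1

/-- The tance of the classes of two vectors. -/
def vtance (h : V →ₗ[ℂ] V →ₗ⋆[ℂ] ℂ) (v w : V) : ℝ :=
  Complex.normSq (h v w) / (nrm h v * nrm h w)

variable {h : V →ₗ[ℂ] V →ₗ⋆[ℂ] ℂ}

theorem proj_apply (v x : V) : proj h v x = (h x v / h v v) • v := by
  simp [proj, div_eq_inv_mul]

theorem refl_apply (v x : V) : refl h v x = (2 * (h x v / h v v)) • v - x := by
  simp [refl, proj_apply, smul_smul]

theorem ell_apply (v x : V) (α : ℂ) :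
    ell h v α x = ((α ^ (-2 : ℤ) - α) * (h x v / h v v)) • v + α • x := by
  simp [ell, proj_apply, smul_smul]

theorem specialElliptic_eq (p : ℙ ℂ V) (α : ℂ) : specialElliptic h p α = ell h p.rep α := by
  ext x
  rw [ell_apply]
  rfl

theorem proj_smul {a : ℂ} (ha : a ≠ 0) (v : V) : proj h (a • v) = proj h v := by
  ext x
  simp only [proj_apply, map_smul, LinearMap.smul_apply, LinearMap.map_smulₛₗ, smul_smul,
    smul_eq_mul]
  congr 1
  have : conj a ≠ 0 := by simpa using ha
  by_cases hv : h v v = 0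
  · simp [hv]
  · field_simp

theorem ell_smul {a : ℂ} (ha : a ≠ 0) (v : V) (α : ℂ) : ell h (a • v) α = ell h v α := by
  rw [ell, ell, proj_smul ha]

theorem proj_self {v : V} (hv : h v v ≠ 0) : proj h v v = v := by
  rw [proj_apply, div_self hv, one_smul]

theorem proj_proj {v : V} (hv : h v v ≠ 0) (x : V) : proj h v (proj h v x) = proj h v x := by
  conv_lhs => rw [proj_apply v x, map_smul, proj_self hv, ← proj_apply]

theorem proj_adjoint (hH : Herm h) (v x y : V) : h (proj h v x) y = h x (proj h v y) := by
  simp only [proj_apply, map_smul, LinearMap.smul_apply, LinearMap.map_smulₛₗ, map_div₀,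
    smul_eq_mul]
  rw [← hH, ← hH]
  ring

theorem refl_self {v : V} (hv : h v v ≠ 0) : refl h v v = v := by
  rw [refl_apply, div_self hv, mul_one, two_smul, add_sub_cancel_right]

theorem refl_refl {v : V} (hv : h v v ≠ 0) (x : V) : refl h v (refl h v x) = x := by
  simp only [refl, LinearMap.sub_apply, LinearMap.smul_apply, Module.End.one_apply, map_sub,
    map_smul, proj_proj hv]
  module

theorem refl_adjoint (hH : Herm h) (v x y : V) : h (refl h v x) y = h x (refl h v y) := by
  simp only [refl, LinearMap.sub_apply, LinearMap.smul_apply, Module.End.one_apply, map_sub,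
    map_smul, proj_adjoint hH, LinearMap.map_smulₛₗ, Complex.conj_ofNat]

theorem ell_self {v : V} (hv : h v v ≠ 0) (α : ℂ) : ell h v α v = α ^ (-2 : ℤ) • v := by
  rw [ell_apply, div_self hv]
  module

theorem ell_orthogonal {v x : V} (hx : h x v = 0) (α : ℂ) : ell h v α x = α • x := by
  rw [ell_apply, hx]
  simp

theorem ell_isometry (hH : Herm h) {v : V} (hv : h v v ≠ 0) {α : ℂ} (hα : ‖α‖ = 1) (x y : V) :
    h (ell h v α x) (ell h v α y) = h x y := by
  have h1 : α * conj α = 1 := by rw [Complex.mul_conj, Complex.normSq_eq_norm_sq, hα]; simp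
  have h2 : α ^ (-2 : ℤ) = (conj α) ^ 2 := by
    rw [zpow_neg, zpow_ofNat, ← inv_pow, inv_eq_of_mul_eq_one_right h1]
  have h3 : h (proj h v x) (proj h v y) = h x (proj h v y) := by
    rw [proj_adjoint hH, proj_proj hv]
  have h4 : h (proj h v x) y = h x (proj h v y) := proj_adjoint hH v x y
  simp only [ell, LinearMap.add_apply, LinearMap.smul_apply, Module.End.one_apply, map_add,
    map_smul, LinearMap.map_smulₛₗ, h3, h4, smul_eq_mul, h2, map_sub, map_pow, Complex.conj_conj]
  linear_combination (h x y - h x (proj h v y)) * h1 +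
    (h x (proj h v y)) * (α * conj α + 1) * h1

theorem map_ell {C : Module.End ℂ V} (hC : ∀ x y, h (C x) (C y) = h x y) (v x : V) (α : ℂ) :
    C (ell h v α x) = ell h (C v) α (C x) := by
  rw [ell_apply, ell_apply, hC, hC, map_add, map_smul, map_smul]

theorem trace_proj [Module.Finite ℂ V] {v : V} (hv : h v v ≠ 0) :
    LinearMap.trace ℂ V (proj h v) = 1 := by
  rw [proj, LinearMap.trace_smulRight]
  simp [hv]

theorem trace_proj_mul_proj [Module.Finite ℂ V] (hH : Herm h) (v w : V) :
    LinearMap.trace ℂ V (proj h w * proj h v) = vtance h v w := by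
  have : proj h w * proj h v =
      (((h v v)⁻¹ • h.flip v).smulRight (proj h w v) : Module.End ℂ V) := by
    ext x
    simp [proj]
  rw [this, LinearMap.trace_smulRight, vtance]
  push_cast
  rw [normSq_eq_mul hH, ← hH.self_eq, ← hH.self_eq]
  simp [proj_apply]
  ring

/-- Expanding leaves the traces of two rank one projections and of their product, and the last trace
is the tance. For fixed parameters the product thus determines the tance. -/
theorem trace_ell_mul_ell [Module.Finite ℂ V] (hH : Herm h) (h3 : Module.finrank ℂ V = 3)
    {v w : V} (hv : h v v ≠ 0) (hw : h w w ≠ 0) (α β : ℂ) :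
    LinearMap.trace ℂ V (ell h w β * ell h v α) = traceLine α β (vtance h v w) := by
  simp only [ell, mul_add, add_mul, smul_mul_assoc, mul_smul_comm, one_mul, mul_one, map_add,
    map_smul, trace_proj hv, trace_proj hw, trace_proj_mul_proj hH, LinearMap.trace_one, h3,
    smul_eq_mul, traceLine]
  push_cast
  ring

end Operators

/-! ### Generic pairs -/

section Pairs

variable {V : Type*} [AddCommGroup V] [Module ℂ V]

/-- The vectors `v, w` are nonisotropic, nonorthogonal and have a nonzero Gram determinant. -/
def GenPair (h : V →ₗ[ℂ] V →ₗ⋆[ℂ] ℂ) (v w : V) : Prop :=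
  h v v ≠ 0 ∧ h w w ≠ 0 ∧ h v w ≠ 0 ∧ h v v * h w w ≠ h v w * h w v

variable {h : V →ₗ[ℂ] V →ₗ⋆[ℂ] ℂ}

theorem GenPair.smul_iff {a b : ℂ} (ha : a ≠ 0) (hb : b ≠ 0) (v w : V) :
    GenPair h (a • v) (b • w) ↔ GenPair h v w := by
  have ha' : conj a ≠ 0 := by simpa using ha
  have hb' : conj b ≠ 0 := by simpa using hb
  have e : h (a • v) (a • v) * h (b • w) (b • w) - h (a • v) (b • w) * h (b • w) (a • v)
      = (a * conj a * b * conj b) * (h v v * h w w - h v w * h w v) := by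
    simp only [map_smul, LinearMap.smul_apply, LinearMap.map_smulₛₗ, smul_eq_mul]
    ring
  have e' : h (a • v) (a • v) * h (b • w) (b • w) ≠ h (a • v) (b • w) * h (b • w) (a • v) ↔
      h v v * h w w ≠ h v w * h w v := by
    rw [← sub_ne_zero, e, ← sub_ne_zero (a := h v v * h w w)]
    simp [ha, hb]
  rw [GenPair, GenPair, e']
  simp [ha, hb]

theorem mem_line {p q : ℙ ℂ V} {x : V} :
    x ∈ line p q ↔ ∃ a b : ℂ, x = a • p.rep + b • q.rep := by
  rw [line, Submodule.mem_sup]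
  simp only [p.submodule_eq, q.submodule_eq, Submodule.mem_span_singleton]
  constructor
  · rintro ⟨_, ⟨a, rfl⟩, _, ⟨b, rfl⟩, rfl⟩
    exact ⟨a, b, rfl⟩
  · rintro ⟨a, b, rfl⟩
    exact ⟨_, ⟨a, rfl⟩, _, ⟨b, rfl⟩, rfl⟩

theorem GenPair.eq_zero {v w : V} (hg : GenPair h v w) {a b : ℂ}
    (h1 : h (a • v + b • w) v = 0) (h2 : h (a • v + b • w) w = 0) : a = 0 ∧ b = 0 := by
  obtain ⟨-, -, -, hd⟩ := hg
  simp only [map_add, map_smul, LinearMap.add_apply, LinearMap.smul_apply, smul_eq_mul] at h1 h2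
  have hd' := sub_ne_zero.mpr hd
  constructor
  · apply (mul_eq_zero.mp _).resolve_right hd'
    linear_combination h w w * h1 - h w v * h2
  · apply (mul_eq_zero.mp _).resolve_right hd'
    linear_combination h v v * h2 - h v w * h1

theorem GenPair.eq_zero' {v w : V} (hg : GenPair h v w) {a b : ℂ}
    (h0 : a • v + b • w = 0) : a = 0 ∧ b = 0 :=
  hg.eq_zero (by simp [h0]) (by simp [h0])

theorem isGenericPair_iff (p q : ℙ ℂ V) :
    IsGenericPair h p q ↔ GenPair h p.rep q.rep := by
  constructor
  · rintro ⟨hp, hq, hpq, hort, heu⟩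
    refine ⟨hp, hq, hort, fun hd => heu ?_⟩
    -- When the Gram determinant vanishes, the component of q orthogonal to p is orthogonal to q as
    -- well, so it spans the kernel of the form on the line.
    refine ⟨q.rep - (h q.rep p.rep / h p.rep p.rep) • p.rep, ?_, ?_, ?_⟩
    · exact mem_line.mpr ⟨-(h q.rep p.rep / h p.rep p.rep), 1, by module⟩
    · intro h0
      apply hpq
      rw [← p.mk_rep, ← q.mk_rep, Projectivization.mk_eq_mk_iff']
      generalize h q.rep p.rep / h p.rep p.rep = k at h0
      have hne : k ≠ 0 := by
        rintro rfl
        rw [zero_smul, sub_zero] at h0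
        exact q.rep_nonzero h0
      refine ⟨k⁻¹, ?_⟩
      rw [sub_eq_zero.mp h0, smul_smul, inv_mul_cancel₀ hne, one_smul]
    · intro w hw
      obtain ⟨a, b, rfl⟩ := mem_line.mp hw
      have hp' : h p.rep p.rep ≠ 0 := hp
      simp only [map_add, map_smul, map_sub, LinearMap.sub_apply, LinearMap.smul_apply,
        LinearMap.map_smulₛₗ, smul_eq_mul]
      field_simp
      linear_combination conj b * hd
  · intro hg
    refine ⟨hg.1, hg.2.1, ?_, hg.2.2.1, ?_⟩
    · rintro rfl
      exact hg.2.2.2 rfl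
    · rintro ⟨u, hu, hu0, hort⟩
      obtain ⟨a, b, rfl⟩ := mem_line.mp hu
      obtain ⟨rfl, rfl⟩ := hg.eq_zero (hort _ (mem_line.mpr ⟨1, 0, by simp⟩))
        (hort _ (mem_line.mpr ⟨0, 1, by simp⟩))
      simp at hu0

/-- Three pairwise orthogonal nonzero vectors, the first two nonisotropic, span `V`. -/
theorem IsSignature21.exists_coeff (hh : IsSignature21 h) {x y z : V} (hx : h x x ≠ 0)
    (hy : h y y ≠ 0) (hz : z ≠ 0) (hxy : h x y = 0) (hxz : h x z = 0) (hyz : h y z = 0) (u : V) :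
    ∃ a b c : ℂ, u = a • x + b • y + c • z := by
  have hH := hh.herm
  have hli : LinearIndependent ℂ ![x, y, z] := by
    rw [Fintype.linearIndependent_iff]
    intro g hg
    simp [Fin.sum_univ_three] at hg
    have h1 := congrArg (fun u => h u x) hg
    have h2 := congrArg (fun u => h u y) hg
    simp [hH.eq_zero_comm hxy, hH.eq_zero_comm hxz, hx] at h1
    simp [hxy, hH.eq_zero_comm hyz, hy] at h2
    simp [h1, h2, hz] at hg
    intro i
    fin_cases i <;> assumption
  have := hh.finite
  have hsp := hli.span_eq_top_of_card_eq_finrank' (by simp [hh.finrank])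
  have hu : u ∈ Submodule.span ℂ (Set.range ![x, y, z]) := by rw [hsp]; trivial
  rw [Submodule.mem_span_range_iff_exists_fun] at hu
  obtain ⟨c, hc⟩ := hu
  exact ⟨c 0, c 1, c 2, by rw [← hc]; simp [Fin.sum_univ_three]⟩

theorem IsSignature21.self_ne_zero_of_orthogonal (hh : IsSignature21 h) {x y z : V}
    (hx : h x x ≠ 0) (hy : h y y ≠ 0) (hz : z ≠ 0) (hxy : h x y = 0) (hxz : h x z = 0)
    (hyz : h y z = 0) : h z z ≠ 0 := by
  intro h0
  apply hz
  apply hh.nondegenerate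
  intro u
  obtain ⟨a, b, c, rfl⟩ := hh.exists_coeff hx hy hz hxy hxz hyz u
  simp [hh.herm.eq_zero_comm hxz, hh.herm.eq_zero_comm hyz, h0]

/-- In an orthogonal triple, one of the vectors is negative. -/
theorem IsSignature21.exists_neg_of_orthogonal (hh : IsSignature21 h) {x y z : V} (hx : h x x ≠ 0)
    (hy : h y y ≠ 0) (hz : z ≠ 0) (hxy : h x y = 0) (hxz : h x z = 0) (hyz : h y z = 0) :
    nrm h x < 0 ∨ nrm h y < 0 ∨ nrm h z < 0 := by
  by_contra! hcon
  obtain ⟨u, hu⟩ := hh.exists_neg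
  obtain ⟨a, b, c, rfl⟩ := hh.exists_coeff hx hy hz hxy hxz hyz u
  have hH := hh.herm
  have : h (a • x + b • y + c • z) (a • x + b • y + c • z) =
      ((Complex.normSq a * nrm h x + Complex.normSq b * nrm h y + Complex.normSq c * nrm h z : ℝ)
        : ℂ) := by
    simp only [map_add, map_smul, LinearMap.add_apply, LinearMap.smul_apply,
        LinearMap.map_smulₛₗ, smul_eq_mul, hxy, hxz, hyz, hH.eq_zero_comm hxy, hH.eq_zero_comm hxz,
        hH.eq_zero_comm hyz, hH.self_eq]
    push_cast [← Complex.mul_conj]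
    ring
  rw [nrm, this, Complex.ofReal_re] at hu
  have h1 := mul_nonneg (Complex.normSq_nonneg a) hcon.1
  have h2 := mul_nonneg (Complex.normSq_nonneg b) hcon.2.1
  have h3 := mul_nonneg (Complex.normSq_nonneg c) hcon.2.2
  linarith

/-- The component of `w` orthogonal to `v`. -/
def perp (h : V →ₗ[ℂ] V →ₗ⋆[ℂ] ℂ) (v w : V) : V := w - (h w v / h v v) • v

theorem perp_orthogonal {v : V} (hv : h v v ≠ 0) (w : V) : h (perp h v w) v = 0 := by
  simp [perp, hv]

theorem nrm_perp (hH : Herm h) {v w : V} (hv : h v v ≠ 0) (hw : h w w ≠ 0) :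
    nrm h (perp h v w) = nrm h w * (1 - vtance h v w) := by
  have hv' := hv
  have hw' := hw
  have key : h (perp h v w) (perp h v w) = ((nrm h w * (1 - vtance h v w) : ℝ) : ℂ) := by
    rw [vtance]
    push_cast
    rw [normSq_eq_mul hH]
    rw [← hH.self_eq, ← hH.self_eq]
    have : h (perp h v w) (perp h v w) = h (perp h v w) w := by
      conv_lhs => rw [perp.eq_1 h v w, map_sub, LinearMap.map_smulₛₗ, ← perp.eq_1 h v w,
        perp_orthogonal hv, smul_zero, sub_zero]
    rw [this, perp]
    simp only [map_sub, map_smul, LinearMap.sub_apply, LinearMap.smul_apply, smul_eq_mul]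
    field_simp
  rw [nrm, key, Complex.ofReal_re]

theorem GenPair.vtance_ne_one {v w : V} (hH : Herm h) (hg : GenPair h v w) :
    vtance h v w ≠ 1 := by
  obtain ⟨h1, h2, -, hd⟩ := hg
  intro ht
  apply hd
  rw [vtance, div_eq_one_iff_eq (mul_ne_zero (hH.self_ne_zero.mp h1) (hH.self_ne_zero.mp h2))] at ht
  rw [← normSq_eq_mul hH, hH.self_eq, hH.self_eq, ht]
  push_cast
  rfl

theorem GenPair.vtance_ne_zero {v w : V} (hH : Herm h) (hg : GenPair h v w) :
    vtance h v w ≠ 0 := by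
  obtain ⟨h1, h2, h3, -⟩ := hg
  exact div_ne_zero (by simpa using h3)
    (mul_ne_zero (hH.self_ne_zero.mp h1) (hH.self_ne_zero.mp h2))

theorem GenPair.of_vtance {v w : V} (hH : Herm h) (h1 : h v v ≠ 0) (h2 : h w w ≠ 0)
    (h0 : vtance h v w ≠ 0) (ht : vtance h v w ≠ 1) : GenPair h v w := by
  refine ⟨h1, h2, fun h3 => h0 (by simp [vtance, h3]), fun hd => ht ?_⟩
  rw [vtance, div_eq_one_iff_eq (mul_ne_zero (hH.self_ne_zero.mp h1) (hH.self_ne_zero.mp h2))]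
  have : ((Complex.normSq (h v w) : ℝ) : ℂ) = ((nrm h v * nrm h w : ℝ) : ℂ) := by
    rw [normSq_eq_mul hH, ← hd, hH.self_eq, hH.self_eq]
    push_cast
    rfl
  exact_mod_cast this

/-- A polar vector of a generic pair. -/
structure IsPolar (h : V →ₗ[ℂ] V →ₗ⋆[ℂ] ℂ) (v w c : V) : Prop where
  self_ne : h c c ≠ 0
  left : h c v = 0
  right : h c w = 0
  span : ∀ u, ∃ a b γ : ℂ, u = a • v + b • w + γ • c
  sign : 0 < nrm h c ↔ vtance h v w * (1 - vtance h v w) < 0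
  pos : nrm h c < 0 → 0 < nrm h v ∧ 0 < nrm h w

/-- In the orthogonal frame v, `perp h v w`, c exactly one square is negative. Since t(1 - t) has
the sign of ⟨v,v⟩ times the square of `perp h v w`, the sign of c tells a hyperbolic line (t(1 - t)
< 0, c positive) from a definite one (c negative, both centres positive). -/
theorem GenPair.exists_polar {v w : V} (hh : IsSignature21 h) (hg : GenPair h v w) :
    ∃ c, IsPolar h v w c := by
  have hH := hh.herm
  have hfin := hh.finite
  have hg' := hg
  obtain ⟨h1, h2, h3, hd⟩ := hg'
  have ht1 := hg.vtance_ne_one hH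
  have ht0 := hg.vtance_ne_zero hH
  set t := vtance h v w with ht
  have hn1 := hH.self_ne_zero.mp h1
  have hn2 := hH.self_ne_zero.mp h2
  have hne : nrm h (perp h v w) = nrm h w * (1 - t) := nrm_perp hH h1 h2
  have he0 : h (perp h v w) (perp h v w) ≠ 0 := by
    rw [hH.self_ne_zero, hne]
    exact mul_ne_zero hn2 (sub_ne_zero.mpr ht1.symm)
  have hev := perp_orthogonal h1 w
  obtain ⟨c, hc, hc0⟩ : ∃ c ∈ LinearMap.ker ((h.flip v).prod (h.flip w)), c ≠ 0 := by
    apply Submodule.exists_mem_ne_zero_of_ne_bot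
    apply LinearMap.ker_ne_bot_of_finrank_lt
    rw [hh.finrank, Module.finrank_prod]
    simp
  have hcv : h c v = 0 := by simpa using congrArg Prod.fst (LinearMap.mem_ker.mp hc)
  have hcw : h c w = 0 := by simpa using congrArg Prod.snd (LinearMap.mem_ker.mp hc)
  have hce : h c (perp h v w) = 0 := by
    simp [perp, hcv, hcw]
  have hcc := hh.self_ne_zero_of_orthogonal h1 he0 hc0 (hH.eq_zero_comm hev)
    (hH.eq_zero_comm hcv) (hH.eq_zero_comm hce)
  have hexist := hh.exists_neg_of_orthogonal h1 he0 hc0 (hH.eq_zero_comm hev)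
    (hH.eq_zero_comm hcv) (hH.eq_zero_comm hce)
  have hpos : nrm h c < 0 → 0 < nrm h v ∧ 0 < nrm h w := fun hneg =>
    ⟨hh.pos_of_orthogonal hcv hneg (ne_zero_of_self h1),
      hh.pos_of_orthogonal hcw hneg (ne_zero_of_self h2)⟩
  have htt : t * nrm h v * nrm h w = Complex.normSq (h v w) := by
    rw [ht, vtance]
    field_simp
  have hz : 0 < Complex.normSq (h v w) := Complex.normSq_pos.mpr h3
  have hsq : t * (1 - t) * (nrm h w) ^ 2 * nrm h v ^ 2 =
      Complex.normSq (h v w) * (nrm h v * nrm h (perp h v w)) := by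
    rw [hne, ← htt]
    ring
  have hpp : 0 < (nrm h w) ^ 2 * nrm h v ^ 2 := by positivity
  refine ⟨c, hcc, hcv, hcw, ?_, ?_, hpos⟩
  · intro u
    obtain ⟨a, b, γ, rfl⟩ := hh.exists_coeff h1 he0 hc0 (hH.eq_zero_comm hev)
      (hH.eq_zero_comm hcv) (hH.eq_zero_comm hce) u
    refine ⟨a - b * (h w v / h v v), b, γ, ?_⟩
    rw [perp]
    module
  · constructor
    · intro hc
      have hneg : nrm h v * nrm h (perp h v w) < 0 := by
        rcases lt_or_gt_of_ne hn1 with hlt | hgt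
        · exact mul_neg_of_neg_of_pos hlt
            (hh.pos_of_orthogonal (hH.eq_zero_comm hev) hlt (ne_zero_of_self he0))
        · apply mul_neg_of_pos_of_neg hgt
          rcases hexist with h' | h' | h'
          · linarith
          · exact h'
          · linarith
      by_contra! hcon
      have := mul_neg_of_pos_of_neg hz hneg
      rw [← hsq] at this
      have := mul_nonneg hcon hpp.le
      linarith
    · intro hlt
      by_contra! hcon
      have hc : nrm h c < 0 := lt_of_le_of_ne hcon (hH.self_ne_zero.mp hcc)
      have h5 := hh.pos_of_orthogonal hce hc (ne_zero_of_self he0)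
      have := mul_pos hz (mul_pos (hpos hc).1 h5)
      rw [← hsq] at this
      have := mul_neg_of_neg_of_pos hlt hpp
      linarith

end Pairs

/-! ### Products of two rotations of a hermitian plane -/

section Rotations

variable {U : Type*} [AddCommGroup U] [Module ℂ U]

/-- The rotation `c - i s A`, where `A` is a reflection, `c` and `s` are a cosine and a sine. -/
def rot (A : Module.End ℂ U) (c s : ℝ) : Module.End ℂ U :=
  (c : ℂ) • 1 - (Complex.I * s) • A

theorem rot_apply (A : Module.End ℂ U) (c s : ℝ) (w : U) :
    rot A c s w = (c : ℂ) • w - (Complex.I * s) • A w := by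
  simp [rot]

/-- The traceless part `N` of the product `c₁c₂ - s₁s₂d - iN` of two rotations. -/
def axis (A₁ A₂ : Module.End ℂ U) (c₁ s₁ c₂ s₂ d : ℝ) : Module.End ℂ U :=
  (Complex.I * s₁ * s₂ * d) • 1 - (Complex.I * s₁ * s₂) • (A₂ * A₁) + ((s₁ * c₂ : ℝ) : ℂ) • A₁
    + ((c₁ * s₂ : ℝ) : ℂ) • A₂

variable {A₁ A₂ : Module.End ℂ U} {c₁ s₁ c₂ s₂ d : ℝ}

theorem axis_apply (w : U) : axis A₁ A₂ c₁ s₁ c₂ s₂ d w =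
    (Complex.I * s₁ * s₂ * d) • w - (Complex.I * s₁ * s₂) • A₂ (A₁ w) + (s₁ * c₂ : ℂ) • A₁ w
    + (c₁ * s₂ : ℂ) • A₂ w := by
  simp [axis]

/-- Normal form H - iN of a product of rotations: A₂A₁ is split into its scalar part d and the rest,
and everything nonscalar is collected in N. -/
theorem rot_rot (w : U) : rot A₂ c₂ s₂ (rot A₁ c₁ s₁ w) =
    ((c₁ * c₂ - s₁ * s₂ * d : ℝ) : ℂ) • w - Complex.I • axis A₁ A₂ c₁ s₁ c₂ s₂ d w := by
  simp only [rot_apply, axis_apply, map_sub, map_smul]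
  match_scalars
  · linear_combination (s₁ * s₂ * d : ℂ) * Complex.I_sq
  · ring
  · ring
  · ring

/-- The anticommutation data of two reflections. -/
structure ReflPair (A₁ A₂ : Module.End ℂ U) (d : ℝ) : Prop where
  sq_left : ∀ w, A₁ (A₁ w) = w
  sq_right : ∀ w, A₂ (A₂ w) = w
  anti : ∀ w, A₁ (A₂ w) + A₂ (A₁ w) = (2 * d : ℂ) • w

/-- Since A₁A₂ + A₂A₁ is scalar, N anticommutes with A₁ up to a scalar. The square of a real
combination of A₁ and N is therefore scalar, which is what allows such combinations to be new
reflections. -/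
theorem ReflPair.anti_left (hA : ReflPair A₁ A₂ d) (w : U) :
    A₁ (axis A₁ A₂ c₁ s₁ c₂ s₂ d w) + axis A₁ A₂ c₁ s₁ c₂ s₂ d (A₁ w)
      = (2 * (s₁ * c₂ + c₁ * s₂ * d) : ℂ) • w := by
  have e1 := hA.anti (A₁ w)
  rw [hA.sq_left] at e1
  simp only [axis_apply, map_add, map_sub, map_smul, hA.sq_left]
  linear_combination (norm := module) (-(Complex.I * s₁ * s₂)) • e1 + (c₁ * s₂ : ℂ) • hA.anti w

theorem ReflPair.anti_right (hA : ReflPair A₁ A₂ d) (w : U) :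
    A₂ (axis A₁ A₂ c₁ s₁ c₂ s₂ d w) + axis A₁ A₂ c₁ s₁ c₂ s₂ d (A₂ w)
      = (2 * (s₂ * c₁ + c₂ * s₁ * d) : ℂ) • w := by
  have e1 := congrArg A₂ (hA.anti w)
  simp only [map_add, map_smul, hA.sq_right] at e1
  simp only [axis_apply, map_add, map_sub, map_smul, hA.sq_right]
  linear_combination (norm := module) (-(Complex.I * s₁ * s₂)) • e1 + (s₁ * c₂ : ℂ) • hA.anti w

/-- The inverse of H - iN, that is, the product of the inverse rotations in the opposite order, is H
+ iN; so H² + N² = 1. -/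
theorem ReflPair.axis_axis (hA : ReflPair A₁ A₂ d) (h₁ : c₁ ^ 2 + s₁ ^ 2 = 1)
    (h₂ : c₂ ^ 2 + s₂ ^ 2 = 1) (w : U) :
    axis A₁ A₂ c₁ s₁ c₂ s₂ d (axis A₁ A₂ c₁ s₁ c₂ s₂ d w)
      = ((1 - (c₁ * c₂ - s₁ * s₂ * d) ^ 2 : ℝ) : ℂ) • w := by
  have e0 : ∀ w, A₁ (A₂ w) = (2 * d : ℂ) • w - A₂ (A₁ w) := fun w =>
    eq_sub_of_add_eq (hA.anti w)
  have h₁' : (c₁ ^ 2 + s₁ ^ 2 : ℂ) = 1 := by exact_mod_cast h₁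
  have h₂' : (c₂ ^ 2 + s₂ ^ 2 : ℂ) = 1 := by exact_mod_cast h₂
  simp only [axis_apply, map_add, map_sub, map_smul, e0, hA.sq_left, hA.sq_right]
  match_scalars
  · ring_nf
    simp only [Complex.I_sq]
    linear_combination (c₂ ^ 2 + s₂ ^ 2 : ℂ) * h₁' + h₂'
  all_goals ring

end Rotations

/-! ### Moving one centre along its geodesic -/

section Shift

variable {U : Type*} [AddCommGroup U] [Module ℂ U] {h : U →ₗ[ℂ] U →ₗ⋆[ℂ] ℂ}

theorem refl_smul {a : ℂ} (ha : a ≠ 0) (v : U) : refl h (a • v) = refl h v := by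
  rw [refl, refl, proj_smul ha]

/-- The quadratic inequality behind the moves along a geodesic. -/
theorem shift_pos {k m x y : ℝ} (hx : 0 < x) (hxy : x ^ 2 + 2 * x * y * k + y ^ 2 * m = 1)
    (hm : m ≤ 0 ∨ k ^ 2 < m) : y ^ 2 * m < (1 + x) ^ 2 := by
  by_contra! hcon
  rcases hm with hm | hm
  · nlinarith [mul_nonneg (sq_nonneg y) (neg_nonneg.mpr hm), sq_nonneg (1 + x)]
  · have hy : y ≠ 0 := by
      rintro rfl
      nlinarith
    have h1 : 0 < x ^ 2 * y ^ 2 := by positivity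
    have h2 := mul_lt_mul_of_pos_left hm h1
    have h3 : 2 * x * y * k = 1 - x ^ 2 - y ^ 2 * m := by linarith
    have h4 : 4 * (x ^ 2 * y ^ 2 * k ^ 2) = (1 - x ^ 2 - y ^ 2 * m) ^ 2 := by
      rw [← h3]
      ring
    have h5 : 0 ≤ (y ^ 2 * m - (1 + x) ^ 2) * (y ^ 2 * m - (1 - x) ^ 2) :=
      mul_nonneg (by linarith) (by nlinarith)
    nlinarith

/-- The operator A' = xA + yN is an involution by the quadratic relation on x and y, and q = p + A'p
is twice the projection of p to its fixed line, so A' is the reflection in q. The inequality y²m <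
(1 + x)² does the rest: it keeps the sign of the square, keeps p and q nonorthogonal, and keeps
eigenvectors of N off the segment from p to q. -/
theorem shift {p : U} {N : Module.End ℂ U} {k m x y : ℝ} (hH : Herm h) (hp : h p p ≠ 0)
    (hadj : ∀ u w, h (N u) w = h u (N w)) (hNN : ∀ w, N (N w) = (m : ℂ) • w)
    (hAN : ∀ w, refl h p (N w) + N (refl h p w) = (2 * k : ℂ) • w)
    (hspan : ∀ u, ∃ a b : ℂ, u = a • p + b • N p) (hli : ∀ η : ℂ, N p ≠ η • p) (hx : 0 < x)
    (hxy : x ^ 2 + 2 * x * y * k + y ^ 2 * m = 1) (hm : m ≤ 0 ∨ k ^ 2 < m) {q : U}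
    (hq : q = (1 + x : ℂ) • p + (y : ℂ) • N p) :
    0 < 1 + x + y * k ∧ nrm h q = 2 * (1 + x + y * k) * nrm h p ∧
    h p q = ((1 + x + y * k : ℝ) : ℂ) * h p p ∧
    (∀ w, refl h q w = (x : ℂ) • refl h p w + (y : ℂ) • N w) ∧
    ∀ r s : ℝ, 0 ≤ r → 0 ≤ s → ∀ η : ℂ, (r : ℂ) • p + (s : ℂ) • q ≠ 0 →
      N ((r : ℂ) • p + (s : ℂ) • q) ≠ η • ((r : ℂ) • p + (s : ℂ) • q) := by
  have hlt := shift_pos hx hxy hm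
  have hpos : 0 < 1 + x + y * k := by
    have : 2 * x * (1 + x + y * k) = (1 + x) ^ 2 - y ^ 2 * m := by linear_combination hxy
    have h2 : 0 < 2 * x * (1 + x + y * k) := by linarith
    exact (mul_pos_iff_of_pos_left (by positivity)).mp h2
  have hNp : h (N p) p = k * h p p := by
    have h1 := congrArg (fun u => h u p) (hAN p)
    simp only [map_add, map_smul, LinearMap.add_apply, LinearMap.smul_apply, refl_adjoint hH,
      refl_self hp, smul_eq_mul] at h1
    linear_combination h1 / 2
  have hpN : h p (N p) = k * h p p := by rw [← hadj, hNp]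
  have hpq : h p q = ((1 + x + y * k : ℝ) : ℂ) * h p p := by
    rw [hq]
    simp only [map_add, LinearMap.map_smulₛₗ, hpN, smul_eq_mul, map_one, Complex.conj_ofReal]
    push_cast
    ring
  have hxy' : (x ^ 2 + 2 * x * y * k + y ^ 2 * m : ℂ) = 1 := by exact_mod_cast hxy
  have hqq : h q q = ((2 * (1 + x + y * k) : ℝ) : ℂ) * h p p := by
    have h2 : h (N p) (N p) = m * h p p := by
      rw [hadj, hNN, LinearMap.map_smulₛₗ, Complex.conj_ofReal, smul_eq_mul]
    rw [hq]
    simp only [map_add, map_smul, LinearMap.add_apply, LinearMap.smul_apply, LinearMap.map_smulₛₗ,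
      hpN, hNp, h2, smul_eq_mul, map_one, Complex.conj_ofReal]
    push_cast
    linear_combination h p p * hxy'
  have hposC : ((1 + x + y * k : ℝ) : ℂ) ≠ 0 := by exact_mod_cast hpos.ne'
  have hqq0 : h q q ≠ 0 := by
    rw [hqq]
    refine mul_ne_zero ?_ hp
    push_cast at hposC ⊢
    simpa using hposC
  refine ⟨hpos, ?_, hpq, ?_, ?_⟩
  · rw [nrm, hqq, hH.self_eq p, ← Complex.ofReal_mul, Complex.ofReal_re]
  · have hBp : refl h q p = (x : ℂ) • refl h p p + (y : ℂ) • N p := by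
      have : 2 * (h p q / h q q) = 1 := by
        rw [hpq, hqq]
        push_cast at hposC ⊢
        field_simp
      rw [refl_apply, this, refl_self hp, hq]
      module
    -- When y = 0 the centre does not move (x = 1, q = 2p) and p, q do not span the plane. Otherwise
    -- it suffices to compare both sides on p and q.
    by_cases hy : y = 0
    · subst hy
      have hx1 : x = 1 := by nlinarith
      subst hx1
      intro w
      have : q = (2 : ℂ) • p := by
        rw [hq]
        push_cast
        module
      rw [this, refl_smul two_ne_zero]
      simp
    · have hyC : (y : ℂ) ≠ 0 := by exact_mod_cast hy
      have hBq : refl h q q = (x : ℂ) • refl h p q + (y : ℂ) • N q := by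
        have h4 := hAN p
        rw [refl_self hp] at h4
        have h5 : refl h p (N p) = (2 * k : ℂ) • p - N p := eq_sub_of_add_eq h4
        rw [refl_self hqq0, hq]
        simp only [map_add, map_smul, refl_self hp, h5, hNN]
        match_scalars
        · linear_combination -hxy'
        · ring
      intro w
      obtain ⟨a, b, rfl⟩ := hspan w
      have hNq : N p = (y : ℂ)⁻¹ • (q - (1 + x : ℂ) • p) := by
        rw [hq, add_sub_cancel_left, smul_smul, inv_mul_cancel₀ hyC, one_smul]
      have e : a • p + b • N p
          = (a - b * (y : ℂ)⁻¹ * (1 + x)) • p + (b * (y : ℂ)⁻¹) • q := by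
        rw [hNq]
        module
      rw [e]
      simp only [map_add, map_smul]
      rw [hBp, hBq]
      module
  · intro r s hr hs η hne heq
    rw [hq] at heq hne
    have e1 : (r : ℂ) • p + (s : ℂ) • ((1 + x : ℂ) • p + (y : ℂ) • N p)
        = ((r + s * (1 + x) : ℝ) : ℂ) • p + ((s * y : ℝ) : ℂ) • N p := by
      push_cast
      module
    rw [e1] at heq hne
    have hind : ∀ a b : ℂ, a • p + b • N p = 0 → a = 0 ∧ b = 0 := by
      intro a b hab
      have hb : b = 0 := by
        by_contra hb
        apply hli (-(b⁻¹ * a))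
        have : b⁻¹ • (a • p + b • N p) = 0 := by rw [hab, smul_zero]
        rw [smul_add, smul_smul, smul_smul, inv_mul_cancel₀ hb, one_smul] at this
        rw [neg_smul, eq_neg_iff_add_eq_zero, add_comm, this]
      subst hb
      rw [zero_smul, add_zero, smul_eq_zero] at hab
      exact ⟨hab.resolve_right (ne_zero_of_self hp), rfl⟩
    simp only [map_add, map_smul, hNN] at heq
    obtain ⟨h1, h2⟩ := hind (((s * y : ℝ) : ℂ) * m - η * ((r + s * (1 + x) : ℝ) : ℂ))
      (((r + s * (1 + x) : ℝ) : ℂ) - η * ((s * y : ℝ) : ℂ)) (by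
        rw [← sub_eq_zero] at heq
        rw [← heq]
        module)
    -- A vector ap + bNp is an eigenvector of N only if b²m = a².
    have h3 : (s * y) ^ 2 * m = (r + s * (1 + x)) ^ 2 := by
      have : ((((s * y) ^ 2 * m : ℝ)) : ℂ) = (((r + s * (1 + x)) ^ 2 : ℝ) : ℂ) := by
        push_cast at h1 h2 ⊢
        linear_combination (s * y : ℂ) * h1 - (r + s * (1 + x) : ℂ) * h2
      exact_mod_cast this
    rcases hs.eq_or_lt with rfl | hs
    · have hr0 : r = 0 := by simpa using h3.symm
      subst hr0
      simp at hne
    · have h4 : s ^ 2 * (y ^ 2 * m) < s ^ 2 * (1 + x) ^ 2 :=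
        mul_lt_mul_of_pos_left hlt (by positivity)
      nlinarith [mul_nonneg hr (mul_nonneg hs.le (by linarith : (0 : ℝ) ≤ 1 + x)), sq_nonneg r]

end Shift

/-! ### The Hermitian plane spanned by the two centres -/

section Plane

variable {U : Type*} [AddCommGroup U] [Module ℂ U] {h : U →ₗ[ℂ] U →ₗ⋆[ℂ] ℂ}

/-- The direction at `v` of the geodesic from `v` to `w`. -/
def vdir (h : U →ₗ[ℂ] U →ₗ⋆[ℂ] ℂ) (v w : U) : U := h v w • (w - (h w v / h v v) • v)

theorem vtance_cast (hH : Herm h) (v w : U) :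
    (vtance h v w : ℂ) = h v w * h w v / (h v v * h w w) := by
  rw [vtance]
  push_cast
  rw [normSq_eq_mul hH, hH.self_eq, hH.self_eq]

theorem vtance_comm (hH : Herm h) (v w : U) : vtance h v w = vtance h w v := by
  rw [vtance, vtance, hH w v, Complex.normSq_conj, mul_comm (nrm h v)]

theorem reflPair (hH : Herm h) {v w : U} (hg : GenPair h v w)
    (hspan : ∀ u, ∃ a b : ℂ, u = a • v + b • w) :
    ReflPair (refl h v) (refl h w) (2 * vtance h v w - 1) := by
  obtain ⟨h1, h2, -, -⟩ := hg
  refine ⟨refl_refl h1, refl_refl h2, fun u => ?_⟩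
  obtain ⟨a, b, rfl⟩ := hspan u
  simp only [refl_apply, map_add, map_smul, map_sub]
  push_cast
  rw [vtance_cast hH]
  match_scalars
  · field_simp
    ring
  · field_simp
    ring

theorem axis_adjoint (hH : Herm h) {v w : U} {d : ℝ} (hr : ReflPair (refl h v) (refl h w) d)
    (c₁ s₁ c₂ s₂ : ℝ) (x y : U) :
    h (axis (refl h v) (refl h w) c₁ s₁ c₂ s₂ d x) y
      = h x (axis (refl h v) (refl h w) c₁ s₁ c₂ s₂ d y) := by
  have e := congrArg (h x) (hr.anti y)
  simp only [map_add, LinearMap.map_smulₛₗ, map_mul, Complex.conj_ofNat, Complex.conj_ofReal,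
    smul_eq_mul] at e
  simp only [axis_apply, map_add, map_sub, map_smul, LinearMap.add_apply, LinearMap.sub_apply,
    LinearMap.smul_apply, LinearMap.map_smulₛₗ, refl_adjoint hH, map_mul, Complex.conj_ofReal,
    Complex.conj_I, smul_eq_mul]
  linear_combination (-(Complex.I * s₁ * s₂)) * e

/-- This identifies the geodesic: Nv lies in the real span of v and e^{-iθ₁} times the direction
towards w, which is the real plane defining G₁. Real combinations of v and Nv therefore give points
of G₁; `axis_right` does the same for G₂. -/
theorem axis_left (hH : Herm h) {v w : U} (hv : h v v ≠ 0) (hw : h w w ≠ 0) (c₁ s₁ c₂ s₂ : ℝ) :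
    axis (refl h v) (refl h w) c₁ s₁ c₂ s₂ (2 * vtance h v w - 1) v =
      ((s₁ * c₂ + c₁ * s₂ * (2 * vtance h v w - 1) : ℝ) : ℂ) • v +
        ((2 * s₂ / nrm h w : ℝ) : ℂ) • ((c₁ - Complex.I * s₁ : ℂ) • vdir h v w) := by
  rw [axis_apply, refl_self hv, refl_apply, vdir]
  push_cast
  rw [vtance_cast hH, ← hH.self_eq]
  match_scalars
  · field_simp
    ring
  · field_simp
    ring

theorem axis_right (hH : Herm h) {v w : U} (hv : h v v ≠ 0) (hw : h w w ≠ 0) (c₁ s₁ c₂ s₂ : ℝ) :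
    axis (refl h v) (refl h w) c₁ s₁ c₂ s₂ (2 * vtance h v w - 1) w =
      ((s₂ * c₁ + c₂ * s₁ * (2 * vtance h v w - 1) : ℝ) : ℂ) • w +
        ((2 * s₁ / nrm h v : ℝ) : ℂ) • ((c₂ + Complex.I * s₂ : ℂ) • vdir h w v) := by
  rw [axis_apply, refl_self hw, refl_apply v, map_sub, map_smul, refl_self hw, refl_apply, vdir]
  push_cast
  rw [vtance_cast hH, ← hH.self_eq]
  match_scalars
  · field_simp
    ring
  · field_simp
    ring_nf

/-- A vector with a nonzero component along `vdir h v w` spans the plane together with `v`. -/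
theorem vdir_spec {v w : U} (hg : GenPair h v w)
    (hspan : ∀ u, ∃ a b : ℂ, u = a • v + b • w) {a b : ℂ} (hb : b ≠ 0) {n : U}
    (hn : n = a • v + b • vdir h v w) :
    (∀ u, ∃ a b : ℂ, u = a • v + b • n) ∧ ∀ η : ℂ, n ≠ η • v := by
  have hz := hg.2.2.1
  have e1 : n = (a - b * h v w * (h w v / h v v)) • v + (b * h v w) • w := by
    rw [hn, vdir]
    module
  generalize a - b * h v w * (h w v / h v v) = a' at e1
  have hbz : b * h v w ≠ 0 := mul_ne_zero hb hz
  generalize b * h v w = b' at e1 hbz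
  constructor
  · intro u
    obtain ⟨p, q, rfl⟩ := hspan u
    refine ⟨p - q * b'⁻¹ * a', q * b'⁻¹, ?_⟩
    rw [e1]
    match_scalars <;> field_simp
    ring
  · intro η he
    apply hbz
    refine (hg.eq_zero' (a := a' - η) (b := b') ?_).2
    rw [sub_smul, ← he, e1]
    module

theorem GenPair.symm (hH : Herm h) {v w : U} (hg : GenPair h v w) : GenPair h w v := by
  obtain ⟨h1, h2, h3, h4⟩ := hg
  refine ⟨h2, h1, fun h0 => h3 (hH.eq_zero_comm h0), fun h0 => h4 ?_⟩
  linear_combination h0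

/-- The identity expressing that the second centre also stays on its geodesic. -/
theorem shift_companion {c₁ s₁ c₂ s₂ c₁' s₁' c₂' d e f : ℝ} (h₁ : c₁ ^ 2 + s₁ ^ 2 = 1)
    (h₂ : c₂ ^ 2 + s₂ ^ 2 = 1) (h₁' : c₁' ^ 2 + s₁' ^ 2 = 1)
    (R1 : e ^ 2 * s₁ ^ 2 + 2 * e * f * s₁ * (s₁ * c₂ + c₁ * s₂ * d)
      + f ^ 2 * (1 - (c₁ * c₂ - s₁ * s₂ * d) ^ 2) = s₁' ^ 2)
    (R2 : c₁' * (c₁ * c₂ - s₁ * s₂ * d) + e * s₁ * (s₁ * c₂ + c₁ * s₂ * d)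
      + f * (1 - (c₁ * c₂ - s₁ * s₂ * d) ^ 2) = c₂') :
    e ^ 2 * s₂ ^ 2 + 2 * e * s₂ * (s₂ * c₁ + c₂ * s₁ * d) *
      (c₁' - e * c₁ - f * (c₁ * c₂ - s₁ * s₂ * d)) +
      (c₁' - e * c₁ - f * (c₁ * c₂ - s₁ * s₂ * d)) ^ 2 * (1 - (c₁ * c₂ - s₁ * s₂ * d) ^ 2)
      = 1 - c₂' ^ 2 := by
  -- Only s₁k and s₂k₂ occur, where k and k₂ are the anticommutation scalars. They depend on the
  -- cosines and H alone, so the sines and d can be eliminated.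
  have k1 : s₁ * (s₁ * c₂ + c₁ * s₂ * d) = c₂ - (c₁ * c₂ - s₁ * s₂ * d) * c₁ := by
    linear_combination c₂ * h₁
  have k2 : s₂ * (s₂ * c₁ + c₂ * s₁ * d) = c₁ - (c₁ * c₂ - s₁ * s₂ * d) * c₂ := by
    linear_combination c₁ * h₂
  have R1' : e ^ 2 * s₁ ^ 2 + 2 * e * f * (c₂ - (c₁ * c₂ - s₁ * s₂ * d) * c₁)
      + f ^ 2 * (1 - (c₁ * c₂ - s₁ * s₂ * d) ^ 2) = s₁' ^ 2 := by
    rw [← k1, ← R1]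
    ring
  have R2' : c₁' * (c₁ * c₂ - s₁ * s₂ * d) + e * (c₂ - (c₁ * c₂ - s₁ * s₂ * d) * c₁)
      + f * (1 - (c₁ * c₂ - s₁ * s₂ * d) ^ 2) = c₂' := by
    rw [← k1, ← R2]
    ring
  have k3 : 2 * e * s₂ * (s₂ * c₁ + c₂ * s₁ * d) =
      2 * e * (c₁ - (c₁ * c₂ - s₁ * s₂ * d) * c₂) := by
    rw [← k2]
    ring
  rw [k3]
  generalize c₁ * c₂ - s₁ * s₂ * d = H at *
  have hs1 : s₁ ^ 2 = 1 - c₁ ^ 2 := by linear_combination h₁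
  have hs2 : s₂ ^ 2 = 1 - c₂ ^ 2 := by linear_combination h₂
  have hs3 : s₁' ^ 2 = 1 - c₁' ^ 2 := by linear_combination h₁'
  rw [hs1, hs3] at R1'
  rw [hs2, ← R2']
  linear_combination R1'

end Plane

/-! ### Simultaneous displacement of both centres -/

section Plane

variable {U : Type*} [AddCommGroup U] [Module ℂ U] {h : U →ₗ[ℂ] U →ₗ⋆[ℂ] ℂ}

theorem rot_rot_ne {A₁ A₂ : Module.End ℂ U} {c₁ s₁ c₂ s₂ d : ℝ} {g : U}
    (hg : ∀ η : ℂ, axis A₁ A₂ c₁ s₁ c₂ s₂ d g ≠ η • g) (η : ℂ) :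
    rot A₂ c₂ s₂ (rot A₁ c₁ s₁ g) ≠ η • g := by
  intro he
  rw [rot_rot (d := d)] at he
  apply hg (Complex.I * (η - ((c₁ * c₂ - s₁ * s₂ * d : ℝ) : ℂ)))
  rw [mul_smul, sub_smul, ← he]
  match_scalars
  · linear_combination Complex.I_sq
  · ring

/-- Moving the two centres along their geodesics. -/
theorem exists_shifted_centres (hH : Herm h) {v w : U} (hg : GenPair h v w)
    (hspan : ∀ u, ∃ a b : ℂ, u = a • v + b • w)
    {c₁ s₁ c₂ s₂ c₁' s₁' c₂' s₂' x y t d hh m k : ℝ}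
    (h₁ : c₁ ^ 2 + s₁ ^ 2 = 1) (h₂ : c₂ ^ 2 + s₂ ^ 2 = 1) (h₁' : c₁' ^ 2 + s₁' ^ 2 = 1)
    (h₂' : c₂' ^ 2 + s₂' ^ 2 = 1) (hs₁ : 0 < s₁) (hs₂ : 0 < s₂) (hs₁' : 0 < s₁')
    (hs₂' : 0 < s₂') (hx : 0 < x) (ht : t = vtance h v w) (hd : d = 2 * t - 1)
    (hhh : hh = c₁ * c₂ - s₁ * s₂ * d) (hm : m = 1 - hh ^ 2) (hk : k = s₁ * c₂ + c₁ * s₂ * d)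
    (hxy : x ^ 2 + 2 * x * y * k + y ^ 2 * m = 1)
    (hxk : s₁' * (x * k + y * m) = c₂' - hh * c₁') (hdef : m ≤ 0 ∨ 0 < t * (1 - t)) :
    ∃ q₁ q₂ : U,
      (∃ a b : ℝ, q₁ = (a : ℂ) • v + (b : ℂ) • ((c₁ - Complex.I * s₁ : ℂ) • vdir h v w)) ∧
      (∃ a b : ℝ, q₂ = (a : ℂ) • w + (b : ℂ) • ((c₂ + Complex.I * s₂ : ℂ) • vdir h w v)) ∧
      (∃ r : ℝ, 0 < r ∧ nrm h q₁ = 2 * r * nrm h v ∧ h v q₁ = r * h v v) ∧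
      (∃ r : ℝ, 0 < r ∧ nrm h q₂ = 2 * r * nrm h w ∧ h w q₂ = r * h w w) ∧
      (∀ u, rot (refl h q₂) c₂' s₂' (rot (refl h q₁) c₁' s₁' u)
        = rot (refl h w) c₂ s₂ (rot (refl h v) c₁ s₁ u)) ∧
      (∀ r s : ℝ, 0 ≤ r → 0 ≤ s → ∀ η : ℂ, (r : ℂ) • v + (s : ℂ) • q₁ ≠ 0 →
        rot (refl h w) c₂ s₂ (rot (refl h v) c₁ s₁ ((r : ℂ) • v + (s : ℂ) • q₁))
          ≠ η • ((r : ℂ) • v + (s : ℂ) • q₁)) ∧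
      (∀ r s : ℝ, 0 ≤ r → 0 ≤ s → ∀ η : ℂ, (r : ℂ) • w + (s : ℂ) • q₂ ≠ 0 →
        rot (refl h w) c₂ s₂ (rot (refl h v) c₁ s₁ ((r : ℂ) • w + (s : ℂ) • q₂))
          ≠ η • ((r : ℂ) • w + (s : ℂ) • q₂)) := by
  obtain ⟨hv, hw, -, -⟩ := id hg
  have hr := reflPair hH hg hspan
  rw [← ht, ← hd] at hr
  have hspan' : ∀ u, ∃ a b : ℂ, u = a • w + b • v := fun u => by
    obtain ⟨a, b, rfl⟩ := hspan u
    exact ⟨b, a, add_comm _ _⟩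
  set N := axis (refl h v) (refl h w) c₁ s₁ c₂ s₂ d with hN
  have hNN : ∀ u, N (N u) = (m : ℂ) • u := fun u => by
    rw [hN, hr.axis_axis h₁ h₂, hm, hhh]
  have hadj : ∀ x y, h (N x) y = h x (N y) := axis_adjoint hH hr c₁ s₁ c₂ s₂
  have hN1 : N v = (k : ℂ) • v + ((2 * s₂ / nrm h w : ℝ) : ℂ) •
      ((c₁ - Complex.I * s₁ : ℂ) • vdir h v w) := by
    rw [hN, hk, hd, ht, axis_left hH hv hw]
  set k₂ : ℝ := s₂ * c₁ + c₂ * s₁ * d with hk₂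
  have hN2 : N w = (k₂ : ℂ) • w + ((2 * s₁ / nrm h v : ℝ) : ℂ) •
      ((c₂ + Complex.I * s₂ : ℂ) • vdir h w v) := by
    rw [hN, hk₂, hd, ht, axis_right hH hv hw]
  have hA1 : ∀ u, refl h v (N u) + N (refl h v u) = (2 * k : ℂ) • u := fun u => by
    rw [hN, hr.anti_left, hk]
    push_cast
    rfl
  have hA2 : ∀ u, refl h w (N u) + N (refl h w u) = (2 * k₂ : ℂ) • u := fun u => by
    rw [hN, hr.anti_right, hk₂]
    push_cast
    rfl
  have hgv := hH.self_ne_zero.mp hv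
  have hgw := hH.self_ne_zero.mp hw
  have hu1 : (c₁ - Complex.I * s₁ : ℂ) ≠ 0 := by
    intro h0
    have := congrArg Complex.im h0
    simp at this
    exact hs₁.ne' this
  have hu2 : (c₂ + Complex.I * s₂ : ℂ) ≠ 0 := by
    intro h0
    have := congrArg Complex.im h0
    simp at this
    exact hs₂.ne' this
  obtain ⟨hsp1, hli1⟩ := vdir_spec hg hspan (a := k)
    (b := ((2 * s₂ / nrm h w : ℝ) : ℂ) * (c₁ - Complex.I * s₁ : ℂ)) (n := N v)
    (mul_ne_zero (by exact_mod_cast (by positivity)) hu1) (by rw [hN1, smul_smul])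
  obtain ⟨hsp2, hli2⟩ := vdir_spec (hg.symm hH) hspan' (a := k₂)
    (b := ((2 * s₁ / nrm h v : ℝ) : ℂ) * (c₂ + Complex.I * s₂ : ℂ)) (n := N w)
    (mul_ne_zero (by exact_mod_cast (by positivity)) hu2) (by rw [hN2, smul_smul])
  -- The quantity m - k² is, up to a positive factor, t(1 - t); on a definite line the alternative
  -- k² < m required by `shift` holds.
  have hmk : m - k ^ 2 = 4 * s₂ ^ 2 * (t * (1 - t)) := by
    rw [hm, hk, hhh, hd]
    linear_combination (-(c₂ ^ 2 + s₂ ^ 2 * (2 * t - 1) ^ 2)) * h₁ - h₂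
  have hmk2 : m - k₂ ^ 2 = 4 * s₁ ^ 2 * (t * (1 - t)) := by
    rw [hm, hk₂, hhh, hd]
    linear_combination (-(c₁ ^ 2 + s₁ ^ 2 * (2 * t - 1) ^ 2)) * h₂ - h₁
  have hm1 : m ≤ 0 ∨ k ^ 2 < m := hdef.imp_right fun h => by
    have : 0 < 4 * s₂ ^ 2 * (t * (1 - t)) := by positivity
    linarith
  have hm2 : m ≤ 0 ∨ k₂ ^ 2 < m := hdef.imp_right fun h => by
    have : 0 < 4 * s₁ ^ 2 * (t * (1 - t)) := by positivity
    linarith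
  -- The second new rotation has to be (H - iN)(c₁' + i s₁' A₁') with A₁' = xA₁ + yN. Expanding it
  -- as c₂' - i s₂' (x₂A₂ + y₂N) gives these coefficients; the condition `hxk` says that its scalar
  -- part is c₂'.
  set x₂ : ℝ := s₁' * s₂ * x / (s₁ * s₂') with hx₂
  set y₂ : ℝ := (c₁' - s₁' * x / s₁ * c₁ - s₁' * y * hh) / s₂' with hy₂
  have hxx₂ : 0 < x₂ := by positivity
  have hxy₂ : x₂ ^ 2 + 2 * x₂ * y₂ * k₂ + y₂ ^ 2 * m = 1 := by
    have R1 : (s₁' * x / s₁) ^ 2 * s₁ ^ 2 + 2 * (s₁' * x / s₁) * (s₁' * y) * s₁ * k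
        + (s₁' * y) ^ 2 * m = s₁' ^ 2 := by
      field_simp
      linear_combination hxy
    have R2 : c₁' * hh + (s₁' * x / s₁) * s₁ * k + s₁' * y * m = c₂' := by
      field_simp
      linear_combination hxk
    rw [hm, hk, hhh] at R1 R2
    have := shift_companion h₁ h₂ h₁' R1 R2
    rw [← hhh, ← hm, ← hk₂] at this
    have e : 1 - c₂' ^ 2 = s₂' ^ 2 := by linear_combination -h₂'
    rw [e] at this
    have ex : x₂ = (s₁' * x / s₁) * s₂ / s₂' := by rw [hx₂]; field_simp
    rw [ex, hy₂]
    generalize s₁' * x / s₁ = E at *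
    generalize (c₁' - E * c₁ - s₁' * y * hh) = F at *
    field_simp
    linear_combination this
  obtain ⟨hp1, hn1, hq1, hB1, hseg1⟩ := shift hH hv hadj hNN hA1 hsp1 hli1 hx hxy hm1 rfl
  obtain ⟨hp2, hn2, hq2, hB2, hseg2⟩ := shift hH hw hadj hNN hA2 hsp2 hli2 hxx₂ hxy₂ hm2 rfl
  refine ⟨_, _, ⟨1 + x + y * k, y * (2 * s₂ / nrm h w), ?_⟩,
    ⟨1 + x₂ + y₂ * k₂, y₂ * (2 * s₁ / nrm h v), ?_⟩, ⟨_, hp1, hn1, hq1⟩, ⟨_, hp2, hn2, hq2⟩, ?_,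
    ?_, ?_⟩
  · rw [hN1]
    push_cast
    module
  · rw [hN2]
    push_cast
    module
  · intro u
    have key : ∀ u, rot (refl h w) c₂ s₂ (rot (refl h v) c₁ s₁
        ((c₁' : ℂ) • u + (Complex.I * s₁') • refl h ((1 + x : ℂ) • v + (y : ℂ) • N v) u))
        = rot (refl h ((1 + x₂ : ℂ) • w + (y₂ : ℂ) • N w)) c₂' s₂' u := by
      intro u
      have hs : (s₁ : ℂ) ≠ 0 := by exact_mod_cast hs₁.ne'
      have hs' : (s₂' : ℂ) ≠ 0 := by exact_mod_cast hs₂'.ne'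
      have h₁C : (c₁ ^ 2 + s₁ ^ 2 : ℂ) = 1 := by exact_mod_cast h₁
      have hxkC : (s₁' * (x * k + y * m) : ℂ) = c₂' - hh * c₁' := by exact_mod_cast hxk
      -- The only unwanted term in the expansion is NA₁; as s₁ ≠ 0, the definition of N rewrites it
      -- in terms of 1, A₁, A₂ and N.
      have E : (s₁ : ℂ) • N (refl h v u) = (c₂ - c₁ * hh : ℂ) • u - (Complex.I * s₂) • refl h w u
          + (Complex.I * c₁) • N u - (Complex.I * s₁ * hh) • refl h v u := by
        rw [hN, axis_apply, axis_apply, hr.sq_left, hhh]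
        push_cast
        match_scalars
        · ring
        · linear_combination (-(Complex.I * s₂)) * h₁C
        · linear_combination c₂ * h₁C - (s₁ * c₁ * s₂ * d) * Complex.I_sq
        · linear_combination (s₁ * c₁ * s₂ : ℂ) * Complex.I_sq
      have E' : N (refl h v u) = (s₁ : ℂ)⁻¹ • ((c₂ - c₁ * hh : ℂ) • u -
          (Complex.I * s₂) • refl h w u + (Complex.I * c₁) • N u
          - (Complex.I * s₁ * hh) • refl h v u) := by
        rw [← E, smul_smul, inv_mul_cancel₀ hs, one_smul]
      rw [rot_rot (d := d), ← hhh, rot_apply, hB1, hB2, ← hN]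
      simp only [map_add, map_smul, hNN, E', hx₂, hy₂]
      push_cast
      have hkC : (s₁ * k : ℂ) = c₂ - c₁ * hh := by
        rw [hk, hhh]
        push_cast
        linear_combination (c₂ : ℂ) * h₁C
      match_scalars
      · field_simp
        linear_combination s₁ * hxkC - s₁' * x * hkC +
          (hh * s₁' * x * c₁ - s₁ * s₁' * y * m - s₁' * x * c₂) * Complex.I_sq
      · field_simp
        linear_combination (hh * Complex.I * s₁' * x) * Complex.I_sq
      · field_simp
        linear_combination (-(s₁' * x * c₁ : ℂ)) * Complex.I_sq
      · field_simp
        linear_combination (s₁' * x * s₂ : ℂ) * Complex.I_sq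
    rw [← key]
    congr 2
    rw [rot_apply]
    have h₁C : (c₁' ^ 2 + s₁' ^ 2 : ℂ) = 1 := by exact_mod_cast h₁'
    have hqq : h ((1 + x : ℂ) • v + (y : ℂ) • N v) ((1 + x : ℂ) • v + (y : ℂ) • N v) ≠ 0 := by
      rw [hH.self_ne_zero, hn1]
      have := hp1.ne'
      positivity
    simp only [map_sub, map_smul, refl_refl hqq]
    match_scalars
    · ring_nf
      simp only [Complex.I_sq]
      linear_combination h₁C
    · ring
  · intro r s h1 h2 η hne
    exact rot_rot_ne (d := d) (fun η => hseg1 r s h1 h2 η hne) η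
  · intro r s h1 h2 η hne
    exact rot_rot_ne (d := d) (fun η => hseg2 r s h1 h2 η hne) η

end Plane

/-! ### Parameters and angles -/

section Angles

/-- `α = ω^j e^{2iθ/3}` with `0 < θ < π`. -/
structure HasAngle (α : ℂ) (j : Fin 3) (θ : ℝ) : Prop where
  pos : 0 < θ
  lt_pi : θ < Real.pi
  eq : α = omega ^ (j : ℕ) * Complex.exp ((2 * θ / 3 : ℝ) * Complex.I)

/-- The scalar factor of the special elliptic isometry with parameter `ω^j e^{2iθ/3}`. -/
def scalarFactor (j : Fin 3) (θ : ℝ) : ℂ :=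
  omega ^ (j : ℕ) * Complex.exp ((-(θ / 3) : ℝ) * Complex.I)

theorem omega_eq : omega = Complex.exp ((2 * Real.pi / 3 : ℝ) * Complex.I) := by
  rw [omega]
  congr 1
  push_cast
  ring

theorem omega_pow_three : omega ^ 3 = 1 := by
  rw [omega, ← Complex.exp_nat_mul, ← Complex.exp_two_pi_mul_I]
  congr 1
  push_cast
  ring

theorem omega_ne_zero : omega ≠ 0 := Complex.exp_ne_zero _

theorem norm_omega : ‖omega‖ = 1 := by rw [omega_eq, Complex.norm_exp_ofReal_mul_I]

theorem IsParameter.ne_zero {α : ℂ} (hα : IsParameter α) : α ≠ 0 := by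
  rintro rfl
  simpa using hα.1

theorem exp_cube_eq (x : ℝ) : Complex.exp ((x / 3 : ℝ) * Complex.I) ^ 3
    = Complex.exp (x * Complex.I) := by
  rw [← Complex.exp_nat_mul]
  congr 1
  push_cast
  ring

theorem IsParameter.exists_angle {α : ℂ} (hα : IsParameter α) : ∃ j θ, HasAngle α j θ := by
  have hpi := Real.pi_pos
  obtain ⟨φ, h0, h2, hφ⟩ : ∃ φ : ℝ, 0 ≤ φ ∧ φ < 2 * Real.pi ∧ α = Complex.exp (φ * Complex.I) := by
    have h1 := Complex.norm_mul_exp_arg_mul_I α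
    rw [hα.1, Complex.ofReal_one, one_mul] at h1
    have ha := Complex.neg_pi_lt_arg α
    have hb := Complex.arg_le_pi α
    by_cases h0 : 0 ≤ α.arg
    · exact ⟨α.arg, h0, by linarith, h1.symm⟩
    · refine ⟨α.arg + 2 * Real.pi, by linarith, by linarith, ?_⟩
      push_cast
      rw [add_mul, Complex.exp_add, h1, Complex.exp_two_pi_mul_I, mul_one]
  have hcube : ∀ n : ℕ, φ ≠ n * (2 * Real.pi / 3) := by
    rintro n rfl
    apply hα.2
    rw [IsCubeRoot, hφ, ← Complex.exp_nat_mul, Complex.exp_eq_one_iff]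
    refine ⟨n, ?_⟩
    push_cast
    ring
  have e0 := hcube 0
  have e1 := hcube 1
  have e2 := hcube 2
  push_cast at e0 e1 e2
  have hval : ∀ j : ℕ, α = omega ^ j *
      Complex.exp ((2 * ((φ - j * (2 * Real.pi / 3)) * (3 / 2)) / 3 : ℝ) * Complex.I) := by
    intro j
    rw [hφ, omega_eq, ← Complex.exp_nat_mul, ← Complex.exp_add]
    congr 1
    push_cast
    ring
  rcases lt_or_gt_of_ne e1 with h | h
  · have : 0 < φ := lt_of_le_of_ne h0 (by rw [zero_mul] at e0; exact e0.symm)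
    exact ⟨0, _, by simp; linarith, by simp; linarith, hval 0⟩
  · rcases lt_or_gt_of_ne e2 with h' | h'
    · exact ⟨1, _, by simp; linarith, by simp; linarith, hval 1⟩
    · exact ⟨2, _, by simp; linarith, by simp; linarith, hval 2⟩

theorem HasAngle.sin_pos {α : ℂ} {j : Fin 3} {θ : ℝ} (hα : HasAngle α j θ) : 0 < Real.sin θ :=
  Real.sin_pos_of_pos_of_lt_pi hα.pos hα.lt_pi

theorem HasAngle.mem_arc {α : ℂ} {j : Fin 3} {θ : ℝ} (hα : HasAngle α j θ) : α ∈ arc j :=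
  ⟨2 * θ / 3, by linarith [hα.pos], by linarith [hα.lt_pi], hα.eq⟩

theorem HasAngle.sameComponent {α β : ℂ} {j : Fin 3} {θ θ' : ℝ} (hα : HasAngle α j θ)
    (hβ : HasAngle β j θ') : SameComponent α β := ⟨j, hα.mem_arc, hβ.mem_arc⟩

theorem HasAngle.cube {α : ℂ} {j : Fin 3} {θ : ℝ} (hα : HasAngle α j θ) :
    α ^ 3 = Complex.exp ((2 * θ : ℝ) * Complex.I) := by
  rw [hα.eq, mul_pow, exp_cube_eq, ← pow_mul, mul_comm (j : ℕ), pow_mul, omega_pow_three, one_pow,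
    one_mul]

theorem HasAngle.isPrimitive {α : ℂ} {j : Fin 3} {θ : ℝ} (hα : HasAngle α j θ) :
    IsPrimitive (Complex.exp ((θ / 3 : ℝ) * Complex.I)) α := by
  refine ⟨⟨θ / 3, by linarith [hα.pos], by linarith [hα.lt_pi], rfl⟩, ?_⟩
  rw [hα.cube, pow_right_comm, exp_cube_eq, ← Complex.exp_nat_mul]
  congr 1
  push_cast
  ring

theorem exp_eq (θ : ℝ) :
    Complex.exp (θ * Complex.I) = (Real.cos θ : ℂ) + Complex.I * (Real.sin θ : ℂ) := by
  rw [Complex.exp_mul_I, ← Complex.ofReal_cos, ← Complex.ofReal_sin]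
  ring

theorem HasAngle.eq_factor {α : ℂ} {j : Fin 3} {θ : ℝ} (hα : HasAngle α j θ) :
    α = scalarFactor j θ * Complex.exp (θ * Complex.I) := by
  rw [hα.eq, scalarFactor, mul_assoc, ← Complex.exp_add]
  congr 2
  push_cast
  ring

theorem HasAngle.zpow_eq_factor {α : ℂ} {j : Fin 3} {θ : ℝ} (hα : HasAngle α j θ) :
    α ^ (-2 : ℤ) = scalarFactor j θ * Complex.exp ((-θ : ℝ) * Complex.I) := by
  rw [zpow_neg]
  apply inv_eq_of_mul_eq_one_right
  have h3 := hα.cube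
  have hf := hα.eq_factor
  have e : scalarFactor j θ = α * Complex.exp ((-θ : ℝ) * Complex.I) := by
    rw [hf, mul_assoc, ← Complex.exp_add]
    simp
  rw [e, zpow_ofNat]
  calc α ^ 2 * (α * Complex.exp ((-θ : ℝ) * Complex.I) * Complex.exp ((-θ : ℝ) * Complex.I))
      = α ^ 3 * (Complex.exp ((-θ : ℝ) * Complex.I) * Complex.exp ((-θ : ℝ) * Complex.I)) := by ring
    _ = 1 := by
      rw [h3, ← Complex.exp_add, ← Complex.exp_add]
      rw [Complex.exp_eq_one_iff]
      exact ⟨0, by push_cast; ring⟩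

theorem norm_scalarFactor (j : Fin 3) (θ : ℝ) : ‖scalarFactor j θ‖ = 1 := by
  rw [scalarFactor, norm_mul, norm_pow, norm_omega, Complex.norm_exp_ofReal_mul_I, one_pow, one_mul]

theorem scalarFactor_ne_zero (j : Fin 3) (θ : ℝ) : scalarFactor j θ ≠ 0 := by
  intro h0
  have := norm_scalarFactor j θ
  rw [h0, norm_zero] at this
  exact zero_ne_one this

/-- The eigenvalues α⁻² and α are e^{-iθ} and e^{iθ} times a common unit scalar, so on any space the
isometry is that scalar times a rotation about its centre. -/
theorem HasAngle.ell_eq {U : Type*} [AddCommGroup U] [Module ℂ U] (h : U →ₗ[ℂ] U →ₗ⋆[ℂ] ℂ)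
    {α : ℂ} {j : Fin 3} {θ : ℝ} (hα : HasAngle α j θ) (v w : U) :
    ell h v α w = scalarFactor j θ • rot (refl h v) (Real.cos θ) (Real.sin θ) w := by
  rw [ell_apply, rot_apply, refl_apply, hα.zpow_eq_factor]
  conv_lhs => rw [hα.eq_factor]
  rw [exp_eq, exp_eq, Real.cos_neg, Real.sin_neg]
  push_cast
  module

/-- Half the trace of the unimodular part of a product of two special elliptic isometries. -/
def halfTrace (θ₁ θ₂ t : ℝ) : ℝ :=
  Real.cos θ₁ * Real.cos θ₂ - Real.sin θ₁ * Real.sin θ₂ * (2 * t - 1)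

theorem traceLine_eq {α₁ α₂ : ℂ} {j₁ j₂ : Fin 3} {θ₁ θ₂ : ℝ} (h₁ : HasAngle α₁ j₁ θ₁)
    (h₂ : HasAngle α₂ j₂ θ₂) (t : ℝ) : traceLine α₁ α₂ t =
      α₁ * α₂ + 2 * (scalarFactor j₁ θ₁ * scalarFactor j₂ θ₂) * halfTrace θ₁ θ₂ t := by
  rw [traceLine, h₁.zpow_eq_factor, h₂.zpow_eq_factor]
  conv_lhs => rw [h₁.eq_factor, h₂.eq_factor]
  conv_rhs => rw [h₁.eq_factor, h₂.eq_factor]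
  rw [halfTrace]
  simp only [exp_eq, Real.cos_neg, Real.sin_neg]
  push_cast
  linear_combination (scalarFactor j₁ θ₁ * scalarFactor j₂ θ₂ * Complex.sin θ₁ * Complex.sin θ₂ *
    (4 * t - 2)) * Complex.I_sq

theorem halfTrace_injective {θ₁ θ₂ t t' : ℝ} (h₁ : 0 < Real.sin θ₁) (h₂ : 0 < Real.sin θ₂)
    (h : halfTrace θ₁ θ₂ t = halfTrace θ₁ θ₂ t') : t = t' := by
  have : Real.sin θ₁ * Real.sin θ₂ * (t - t') = 0 := by
    rw [halfTrace, halfTrace] at h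
    linarith
  rcases mul_eq_zero.mp this with h | h
  · exact absurd h (by positivity)
  · linarith

end Angles

/-! ### Points given by vectors -/

section Points

variable {V : Type*} [AddCommGroup V] [Module ℂ V] {h : V →ₗ[ℂ] V →ₗ⋆[ℂ] ℂ}

theorem exists_rep (v : V) (hv : v ≠ 0) :
    ∃ a : ℂ, a ≠ 0 ∧ (Projectivization.mk ℂ v hv).rep = a • v := by
  obtain ⟨a, ha⟩ := Projectivization.exists_smul_eq_mk_rep ℂ v hv
  exact ⟨a, a.ne_zero, ha.symm⟩

theorem specialElliptic_mk (v : V) (hv : v ≠ 0) (α : ℂ) :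
    specialElliptic h (Projectivization.mk ℂ v hv) α = ell h v α := by
  obtain ⟨a, ha, e⟩ := exists_rep v hv
  rw [specialElliptic_eq, e, ell_smul ha]

theorem signature_eq (p : ℙ ℂ V) : signature h p = SignType.sign (nrm h p.rep) := rfl

theorem signature_mk (hH : Herm h) (v : V) (hv : v ≠ 0) :
    signature h (Projectivization.mk ℂ v hv) = SignType.sign (nrm h v) := by
  obtain ⟨a, ha, e⟩ := exists_rep v hv
  rw [signature_eq, e, nrm_smul hH, sign_mul, sign_pos (Complex.normSq_pos.mpr ha), one_mul]

theorem isGenericPair_mk (v w : V) (hv : v ≠ 0) (hw : w ≠ 0) :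
    IsGenericPair h (Projectivization.mk ℂ v hv) (Projectivization.mk ℂ w hw) ↔
      GenPair h v w := by
  obtain ⟨a, ha, e⟩ := exists_rep v hv
  obtain ⟨b, hb, e'⟩ := exists_rep w hw
  rw [isGenericPair_iff, e, e', GenPair.smul_iff ha hb]

theorem mem_submodule {x : ℙ ℂ V} {v : V} : v ∈ x.submodule ↔ ∃ a : ℂ, a • x.rep = v := by
  rw [x.submodule_eq, Submodule.mem_span_singleton]

theorem IsFixedPoint.exists_eigen {A : Module.End ℂ V} {x : ℙ ℂ V} (hx : IsFixedPoint A x) :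
    ∃ η : ℂ, ∀ v ∈ x.submodule, A v = η • v := by
  have h1 : A x.rep ∈ x.submodule := by
    rw [← show x.submodule.map A = x.submodule from hx]
    exact Submodule.mem_map_of_mem (mem_submodule.mpr ⟨1, one_smul _ _⟩)
  obtain ⟨η, hη⟩ := mem_submodule.mp h1
  refine ⟨η, fun v hv => ?_⟩
  obtain ⟨a, rfl⟩ := mem_submodule.mp hv
  rw [map_smul, ← hη, smul_comm]

theorem Config.product_eq (X : Config V) :
    X.product h = ell h X.p₂.rep X.α₂ * ell h X.p₁.rep X.α₁ := by
  rw [Config.product, specialElliptic_eq, specialElliptic_eq]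

/-- The configuration with centres given by vectors. -/
def Config.of (v w : V) (hv : v ≠ 0) (hw : w ≠ 0) (α β : ℂ) : Config V :=
  ⟨Projectivization.mk ℂ v hv, Projectivization.mk ℂ w hw, α, β⟩

theorem Config.product_of (v w : V) (hv : v ≠ 0) (hw : w ≠ 0) (α β : ℂ) :
    (Config.of v w hv hw α β).product h = ell h w β * ell h v α := by
  rw [Config.product, Config.of, specialElliptic_mk, specialElliptic_mk]

/-- The factor ⟨p,q⟩ in `segment` cancels the phase of the chosen representative. When q itself has
⟨p,q⟩ a positive multiple of ⟨p,p⟩, the segment is represented by nonnegative real combinations of p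
and q. -/
theorem exists_segment_smul {p : ℙ ℂ V} {q : V} (hq : q ≠ 0) {r : ℝ} (hr : 0 < r)
    (hp : h p.rep p.rep ≠ 0) (hpq : h p.rep q = r * h p.rep p.rep) {x : ℙ ℂ V}
    (hx : x ∈ segment h p (Projectivization.mk ℂ q hq)) :
    ∃ s t : ℝ, 0 ≤ s ∧ 0 ≤ t ∧ (s : ℂ) • p.rep + (t : ℂ) • q ≠ 0 ∧
      (s : ℂ) • p.rep + (t : ℂ) • q ∈ x.submodule := by
  obtain ⟨a, ha, e⟩ := exists_rep q hq
  obtain ⟨s, t, hs, ht, h1, h2⟩ := hx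
  have key : (s : ℂ) • p.rep + ((t * (Complex.normSq a * r) : ℝ) : ℂ) • q
      = (s : ℂ) • p.rep + ((t : ℂ) * (h p.rep (Projectivization.mk ℂ q hq).rep /
        h p.rep p.rep)) • (Projectivization.mk ℂ q hq).rep := by
    rw [e, LinearMap.map_smulₛₗ, hpq, smul_smul]
    congr 2
    push_cast
    rw [Complex.normSq_eq_conj_mul_self, smul_eq_mul]
    field_simp
  have := Complex.normSq_nonneg a
  exact ⟨s, t * (Complex.normSq a * r), hs, by positivity, by rw [key]; exact h1,
    by rw [key]; exact h2⟩

end Points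

/-! ### Construction of `f`-bendings -/

section FBending

/-- Geometrically, k' is the anticommutation scalar of the new reflection xA + yN with N.
Eliminating y gives x²(m - k²) = m - k'², solvable with x > 0 when the two differences have the same
sign. For m = 0 the linear equation forces x = k'/k, whence the extra sign condition. -/
theorem exists_shift_parameters {m k k' : ℝ} (hpos : 0 < (m - k ^ 2) * (m - k' ^ 2))
    (hnull : m = 0 → 0 < k * k') :
    ∃ x y : ℝ, 0 < x ∧ x ^ 2 + 2 * x * y * k + y ^ 2 * m = 1 ∧ x * k + y * m = k' := by
  have hne : m - k ^ 2 ≠ 0 := left_ne_zero_of_mul hpos.ne'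
  by_cases hm : m = 0
  · have hk := hnull hm
    have hk0 : k ≠ 0 := left_ne_zero_of_mul hk.ne'
    have hk0' : k' ≠ 0 := right_ne_zero_of_mul hk.ne'
    have hx : 0 < k' / k := by
      have : k' / k = (k * k') / k ^ 2 := by field_simp
      rw [this]
      positivity
    refine ⟨k' / k, (1 - (k' / k) ^ 2) / (2 * (k' / k) * k), hx, ?_, ?_⟩
    · rw [hm]
      field_simp
      ring
    · rw [hm]
      field_simp
      ring
  · have hx : 0 < (m - k' ^ 2) / (m - k ^ 2) := by
      have : (m - k' ^ 2) / (m - k ^ 2) = ((m - k ^ 2) * (m - k' ^ 2)) / (m - k ^ 2) ^ 2 := by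
        field_simp
      rw [this]
      positivity
    have hsq := Real.sq_sqrt hx.le
    refine ⟨Real.sqrt ((m - k' ^ 2) / (m - k ^ 2)),
      (k' - Real.sqrt ((m - k' ^ 2) / (m - k ^ 2)) * k) / m, Real.sqrt_pos.mpr hx, ?_, ?_⟩
    · generalize Real.sqrt ((m - k' ^ 2) / (m - k ^ 2)) = x at *
      rw [eq_div_iff hne] at hsq
      field_simp
      linear_combination hsq
    · field_simp
      ring

/-- This is m - k² for m = 1 - H²; it links the type of the line (the sign of t(1 - t)) with the
size of the trace. -/
theorem axis_gram {θ₁ θ₂ t : ℝ} : 1 - halfTrace θ₁ θ₂ t ^ 2 -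
    (Real.sin θ₁ * Real.cos θ₂ + Real.cos θ₁ * Real.sin θ₂ * (2 * t - 1)) ^ 2 =
      4 * Real.sin θ₂ ^ 2 * (t * (1 - t)) := by
  rw [halfTrace]
  linear_combination (-(Real.cos θ₂ ^ 2 + Real.sin θ₂ ^ 2 * (2 * t - 1) ^ 2)) *
    Real.sin_sq_add_cos_sq θ₁ - Real.sin_sq_add_cos_sq θ₂

theorem axis_pairing {θ₁ θ₂ t : ℝ} : Real.sin θ₁ *
    (Real.sin θ₁ * Real.cos θ₂ + Real.cos θ₁ * Real.sin θ₂ * (2 * t - 1)) =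
      Real.cos θ₂ - halfTrace θ₁ θ₂ t * Real.cos θ₁ := by
  rw [halfTrace]
  linear_combination Real.cos θ₂ * Real.sin_sq_add_cos_sq θ₁

end FBending

section FBending

variable {V : Type*} [AddCommGroup V] [Module ℂ V] {h : V →ₗ[ℂ] V →ₗ⋆[ℂ] ℂ}

theorem HasAngle.isParameter {α : ℂ} {j : Fin 3} {θ : ℝ} (hα : HasAngle α j θ) :
    IsParameter α := by
  constructor
  · rw [hα.eq, norm_mul, norm_pow, norm_omega, Complex.norm_exp_ofReal_mul_I, one_pow, one_mul]
  · intro h1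
    rw [IsCubeRoot, hα.cube, exp_eq] at h1
    have h2 := congrArg Complex.im h1
    have h3 := congrArg Complex.re h1
    simp at h2 h3
    simp only [← Complex.ofReal_ofNat, ← Complex.ofReal_mul, ← Complex.ofReal_sin,
      ← Complex.ofReal_cos, Complex.ofReal_re, Complex.ofReal_im] at h2 h3
    have := hα.sin_pos
    have h4 := Real.cos_two_mul θ
    have h5 := Real.sin_sq_add_cos_sq θ
    norm_num at h3
    nlinarith

theorem scalarFactor_mul (j₁ j₂ : Fin 3) {θ₁ θ₂ θ₁' θ₂' : ℝ} (hS : θ₁ + θ₂ = θ₁' + θ₂') :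
    scalarFactor j₁ θ₁ * scalarFactor j₂ θ₂ = scalarFactor j₁ θ₁' * scalarFactor j₂ θ₂' := by
  have : ∀ a b : ℝ, scalarFactor j₁ a * scalarFactor j₂ b = omega ^ (j₁ : ℕ) * omega ^ (j₂ : ℕ) *
      Complex.exp ((-((a + b) / 3) : ℝ) * Complex.I) := by
    intro a b
    rw [scalarFactor, scalarFactor, mul_mul_mul_comm, ← Complex.exp_add]
    congr 2
    push_cast
    ring
  rw [this, this, hS]

theorem HasAngle.mul_eq {α₁ α₂ : ℂ} {j₁ j₂ : Fin 3} {θ₁ θ₂ : ℝ} (h₁ : HasAngle α₁ j₁ θ₁)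
    (h₂ : HasAngle α₂ j₂ θ₂) : α₁ * α₂ =
      scalarFactor j₁ θ₁ * scalarFactor j₂ θ₂ * Complex.exp ((θ₁ + θ₂ : ℝ) * Complex.I) := by
  conv_lhs => rw [h₁.eq_factor, h₂.eq_factor]
  rw [Complex.ofReal_add, add_mul, Complex.exp_add]
  ring

theorem mem_mk (v : V) (hv : v ≠ 0) : v ∈ (Projectivization.mk ℂ v hv).submodule := by
  rw [Projectivization.submodule_mk]
  exact Submodule.mem_span_singleton_self v

theorem not_isOrthogonal_mk {p : ℙ ℂ V} {q : V} (hq : q ≠ 0) (hpq : h p.rep q ≠ 0) :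
    ¬ IsOrthogonal h p (Projectivization.mk ℂ q hq) := by
  obtain ⟨a, ha, e⟩ := exists_rep q hq
  rw [IsOrthogonal, e, LinearMap.map_smulₛₗ]
  exact mul_ne_zero (by simpa using ha) hpq

theorem ell_ell_coe {W : Submodule ℂ V} (v₁ v₂ w : W) (α₁ α₂ : ℂ) :
    ((ell (h.domRestrict₁₂ W W) v₂ α₂ (ell (h.domRestrict₁₂ W W) v₁ α₁ w) : W) : V)
      = ell h v₂ α₂ (ell h v₁ α₁ w) := by
  simp only [ell_apply]
  rfl

theorem HasAngle.ell_ell_eq {α₁ α₂ : ℂ} {j₁ j₂ : Fin 3} {θ₁ θ₂ : ℝ} (h₁ : HasAngle α₁ j₁ θ₁)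
    (h₂ : HasAngle α₂ j₂ θ₂) (v w x : V) : ell h w α₂ (ell h v α₁ x) =
      (scalarFactor j₁ θ₁ * scalarFactor j₂ θ₂) • rot (refl h w) (Real.cos θ₂) (Real.sin θ₂)
        (rot (refl h v) (Real.cos θ₁) (Real.sin θ₁) x) := by
  rw [h₂.ell_eq, h₁.ell_eq, map_smul, smul_smul, mul_comm]

/-- The shift is constructed inside the plane of centres and extended by the polar vector, on which
both products act by the same number since the sums of angles agree. `hdef` keeps fixed points off
the segments; `hnull` is the sign condition of the parabolic case m = 0, multiplied by positive
sines. -/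
theorem exists_fBending (hh : IsSignature21 h) {X : Config V} (hX : X.IsGeneric h) {β₁ β₂ : ℂ}
    {j₁ j₂ : Fin 3} {θ₁ θ₂ θ₁' θ₂' t t' : ℝ} (ha₁ : HasAngle X.α₁ j₁ θ₁)
    (ha₂ : HasAngle X.α₂ j₂ θ₂) (hb₁ : HasAngle β₁ j₁ θ₁') (hb₂ : HasAngle β₂ j₂ θ₂')
    (hS : θ₁ + θ₂ = θ₁' + θ₂') (ht : t = tance h X.p₁ X.p₂)
    (ht' : halfTrace θ₁' θ₂' t' = halfTrace θ₁ θ₂ t) (hpos : 0 < (t * (1 - t)) * (t' * (1 - t')))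
    (hdef : 1 - halfTrace θ₁ θ₂ t ^ 2 ≤ 0 ∨ 0 < t * (1 - t))
    (hnull : 1 - halfTrace θ₁ θ₂ t ^ 2 = 0 →
      0 < (Real.cos θ₂ - halfTrace θ₁ θ₂ t * Real.cos θ₁) *
        (Real.cos θ₂' - halfTrace θ₁ θ₂ t * Real.cos θ₁')) :
    ∃ Y : Config V, Y.IsGeneric h ∧ X.product h = Y.product h ∧ Y.α₁ = β₁ ∧ Y.α₂ = β₂ ∧
      signature h Y.p₁ = signature h X.p₁ ∧ signature h Y.p₂ = signature h X.p₂ ∧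
      IsFBending h X Y := by
  have hH := hh.herm
  obtain ⟨hpair, -, -⟩ := hX
  have hg := (isGenericPair_iff _ _).mp hpair
  obtain ⟨c, hc⟩ := hg.exists_polar hh
  have hs₁ := ha₁.sin_pos
  have hs₂ := ha₂.sin_pos
  have hs₁' := hb₁.sin_pos
  have hs₂' := hb₂.sin_pos
  have htv : t = vtance h X.p₁.rep X.p₂.rep := ht
  set H := halfTrace θ₁ θ₂ t with hHdef
  set W := line X.p₁ X.p₂ with hW
  set hW' := h.domRestrict₁₂ W W with hhW
  have hHW : Herm hW' := fun x y => hH x y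
  have hv₁ : X.p₁.rep ∈ W := mem_line.mpr ⟨1, 0, by simp⟩
  have hv₂ : X.p₂.rep ∈ W := mem_line.mpr ⟨0, 1, by simp⟩
  have hspan : ∀ u : W, ∃ a b : ℂ, u = a • (⟨X.p₁.rep, hv₁⟩ : W) + b • (⟨X.p₂.rep, hv₂⟩ : W) := by
    rintro ⟨u, hu⟩
    obtain ⟨a, b, rfl⟩ := mem_line.mp hu
    exact ⟨a, b, rfl⟩
  set k := Real.sin θ₁ * Real.cos θ₂ + Real.cos θ₁ * Real.sin θ₂ * (2 * t - 1) with hk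
  set k' := Real.sin θ₁' * Real.cos θ₂' + Real.cos θ₁' * Real.sin θ₂' * (2 * t' - 1) with hk'
  have e1 : 1 - H ^ 2 - k ^ 2 = 4 * Real.sin θ₂ ^ 2 * (t * (1 - t)) := axis_gram
  have e1' : 1 - H ^ 2 - k' ^ 2 = 4 * Real.sin θ₂' ^ 2 * (t' * (1 - t')) := by
    rw [← ht']
    exact axis_gram
  have e2 : Real.sin θ₁ * k = Real.cos θ₂ - H * Real.cos θ₁ := axis_pairing
  have e2' : Real.sin θ₁' * k' = Real.cos θ₂' - H * Real.cos θ₁' := by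
    rw [← ht']
    exact axis_pairing
  obtain ⟨x, y, hx, hxy, hxk⟩ := exists_shift_parameters (m := 1 - H ^ 2) (k := k) (k' := k')
    (by
      rw [e1, e1']
      have : 0 < (16 * Real.sin θ₂ ^ 2 * Real.sin θ₂' ^ 2) * ((t * (1 - t)) * (t' * (1 - t'))) := by
        positivity
      linarith)
    (fun h0 => by
      have h1 := hnull h0
      rw [← e2, ← e2'] at h1
      have : 0 < (Real.sin θ₁ * Real.sin θ₁') * (k * k') := by linarith
      exact (mul_pos_iff_of_pos_left (by positivity)).mp this)
  obtain ⟨q₁, q₂, ⟨a₁, b₁, hq₁⟩, ⟨a₂, b₂, hq₂⟩, ⟨r₁, hr₁, hn₁, hi₁⟩, ⟨r₂, hr₂, hn₂, hi₂⟩, hprod,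
    hseg₁, hseg₂⟩ := exists_shifted_centres (h := hW') (v := ⟨X.p₁.rep, hv₁⟩)
      (w := ⟨X.p₂.rep, hv₂⟩) hHW hg hspan (c₁ := Real.cos θ₁) (s₁ := Real.sin θ₁)
      (c₂ := Real.cos θ₂) (s₂ := Real.sin θ₂) (c₁' := Real.cos θ₁') (s₁' := Real.sin θ₁')
      (c₂' := Real.cos θ₂') (s₂' := Real.sin θ₂') (x := x) (y := y) (t := t) (d := 2 * t - 1)
      (hh := H) (m := 1 - H ^ 2) (k := k) (Real.cos_sq_add_sin_sq _) (Real.cos_sq_add_sin_sq _)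
      (Real.cos_sq_add_sin_sq _) (Real.cos_sq_add_sin_sq _) hs₁ hs₂ hs₁' hs₂' hx htv rfl rfl rfl
      rfl hxy (by rw [hxk, e2']) hdef
  have hv₁n : nrm h X.p₁.rep ≠ 0 := hH.self_ne_zero.mp hg.1
  have hv₂n : nrm h X.p₂.rep ≠ 0 := hH.self_ne_zero.mp hg.2.1
  have hn₁' : nrm h (q₁ : V) = 2 * r₁ * nrm h X.p₁.rep := hn₁
  have hn₂' : nrm h (q₂ : V) = 2 * r₂ * nrm h X.p₂.rep := hn₂
  have hq₁n : h (q₁ : V) q₁ ≠ 0 := by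
    rw [hH.self_ne_zero, hn₁']
    positivity
  have hq₂n : h (q₂ : V) q₂ ≠ 0 := by
    rw [hH.self_ne_zero, hn₂']
    positivity
  have hlam : X.α₁ * X.α₂ = β₁ * β₂ := by
    rw [ha₁.mul_eq ha₂, hb₁.mul_eq hb₂, hS, scalarFactor_mul j₁ j₂ hS]
  have hpe : ell h (q₂ : V) β₂ * ell h (q₁ : V) β₁ = X.product h := by
    rw [Config.product_eq]
    have hperp : ∀ u : W, h c u = 0 := by
      rintro ⟨u, hu⟩
      obtain ⟨a, b, rfl⟩ := mem_line.mp hu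
      simp [LinearMap.map_smulₛₗ, hc.left, hc.right]
    have hw : ∀ u : W, ell h (q₂ : V) β₂ (ell h (q₁ : V) β₁ u)
        = ell h X.p₂.rep X.α₂ (ell h X.p₁.rep X.α₁ u) := by
      intro u
      have h1 := ell_ell_coe (h := h) q₁ q₂ u β₁ β₂
      have h2 := ell_ell_coe (h := h) (⟨X.p₁.rep, hv₁⟩ : W) (⟨X.p₂.rep, hv₂⟩ : W) u X.α₁ X.α₂
      rw [hb₁.ell_ell_eq hb₂] at h1
      rw [ha₁.ell_ell_eq ha₂] at h2
      rw [← h1, ← h2, hprod u, scalarFactor_mul j₁ j₂ hS]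
    ext u
    obtain ⟨a, b, γ, rfl⟩ := hc.span u
    have e : a • X.p₁.rep + b • X.p₂.rep + γ • c
        = ((a • (⟨X.p₁.rep, hv₁⟩ : W) + b • (⟨X.p₂.rep, hv₂⟩ : W) : W) : V) + γ • c := rfl
    rw [e]
    simp only [Module.End.mul_apply]
    rw [map_add, map_add, map_add, map_add, hw, map_smul, map_smul, map_smul, map_smul,
      ell_orthogonal (hperp q₁), ell_orthogonal hc.left, map_smul, map_smul,
      ell_orthogonal (hperp q₂), ell_orthogonal hc.right, smul_smul β₁, smul_smul X.α₁, hlam]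
  have hβ₁ := hb₁.isParameter
  have hβ₂ := hb₂.isParameter
  have hne₁ := ne_zero_of_self hq₁n
  have hne₂ := ne_zero_of_self hq₂n
  -- The new tance is read off from the trace, which for given parameters determines it.
  have htan : vtance h (q₁ : V) q₂ = t' := by
    have := hh.finite
    have h1 := congrArg (LinearMap.trace ℂ V) hpe
    rw [Config.product_eq, trace_ell_mul_ell hH hh.finrank hq₁n hq₂n,
      trace_ell_mul_ell hH hh.finrank hg.1 hg.2.1, traceLine_eq hb₁ hb₂, traceLine_eq ha₁ ha₂,
      hlam, scalarFactor_mul j₁ j₂ hS] at h1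
    apply halfTrace_injective hs₁' hs₂'
    rw [ht', hHdef, htv]
    have h2 := mul_left_cancel₀ (mul_ne_zero two_ne_zero (mul_ne_zero (scalarFactor_ne_zero _ _)
      (scalarFactor_ne_zero _ _))) (add_left_cancel h1)
    exact_mod_cast h2
  have ht'0 : t' ≠ 0 := by
    rintro rfl
    simp at hpos
  have ht'1 : t' ≠ 1 := by
    rintro rfl
    simp at hpos
  have hfix : ∀ x : ℙ ℂ V, IsFixedPoint (X.product h) x → ∀ u : W, (u : V) ∈ x.submodule →
      ∃ η : ℂ, rot (refl hW' ⟨X.p₂.rep, hv₂⟩) (Real.cos θ₂) (Real.sin θ₂)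
        (rot (refl hW' ⟨X.p₁.rep, hv₁⟩) (Real.cos θ₁) (Real.sin θ₁) u) = η • u := by
    intro x hx u hu
    obtain ⟨η, hη⟩ := hx.exists_eigen
    have h1 := hη _ hu
    rw [Config.product_eq, Module.End.mul_apply] at h1
    have h2 := ell_ell_coe (h := h) (⟨X.p₁.rep, hv₁⟩ : W) (⟨X.p₂.rep, hv₂⟩ : W) u X.α₁ X.α₂
    rw [ha₁.ell_ell_eq ha₂] at h2
    set ρ := scalarFactor j₁ θ₁ * scalarFactor j₂ θ₂ with hρ
    have hρ0 : ρ ≠ 0 := mul_ne_zero (scalarFactor_ne_zero _ _) (scalarFactor_ne_zero _ _)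
    refine ⟨ρ⁻¹ * η, ?_⟩
    apply Subtype.ext
    apply smul_right_injective V hρ0
    change ρ • _ = ρ • _
    rw [← Submodule.coe_smul, h2, h1, Submodule.coe_smul, smul_smul, mul_inv_cancel_left₀ hρ0]
  have hsig₁ : signature h (Projectivization.mk ℂ (q₁ : V) hne₁) = signature h X.p₁ := by
    rw [signature_mk hH, signature_eq, hn₁', sign_mul, sign_pos (by positivity), one_mul]
  have hsig₂ : signature h (Projectivization.mk ℂ (q₂ : V) hne₂) = signature h X.p₂ := by
    rw [signature_mk hH, signature_eq, hn₂', sign_mul, sign_pos (by positivity), one_mul]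
  refine ⟨Config.of (q₁ : V) q₂ hne₁ hne₂ β₁ β₂,
    ⟨(isGenericPair_mk _ _ _ _).mpr (GenPair.of_vtance hH hq₁n hq₂n (by rwa [htan])
      (by rwa [htan])), hβ₁, hβ₂⟩, ?_, rfl, rfl, ?_, ?_, ?_⟩
  · rw [Config.product_of, hpe]
  · exact hsig₁
  · exact hsig₂
  · refine ⟨⟨_, _, ha₁.isPrimitive, ha₂.isPrimitive, ⟨a₁, b₁, ?_⟩, ⟨a₂, b₂, ?_⟩⟩,
      ⟨hsig₁, hsig₂, ?_, ?_⟩, ⟨hlam, ha₁.sameComponent hb₁, ha₂.sameComponent hb₂⟩,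
      fun x hx => ⟨fun hxs => ?_, fun hxs => ?_⟩⟩
    · have e : ((a₁ : ℂ) • X.p₁.rep + (b₁ : ℂ) •
          ((Complex.exp ((θ₁ / 3 : ℝ) * Complex.I) ^ 3)⁻¹ • direction h X.p₁ X.p₂)) = (q₁ : V) := by
        rw [exp_cube_eq, ← Complex.exp_neg, ← neg_mul, ← Complex.ofReal_neg, exp_eq, Real.cos_neg,
          Real.sin_neg, Complex.ofReal_neg, mul_neg, ← sub_eq_add_neg, hq₁]
        rfl
      rw [e]
      exact ⟨hne₁, mem_mk _ _⟩
    · have e : ((a₂ : ℂ) • X.p₂.rep + (b₂ : ℂ) •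
          (Complex.exp ((θ₂ / 3 : ℝ) * Complex.I) ^ 3 • direction h X.p₂ X.p₁)) = (q₂ : V) := by
        rw [exp_cube_eq, exp_eq, hq₂]
        rfl
      rw [e]
      exact ⟨hne₂, mem_mk _ _⟩
    · exact not_isOrthogonal_mk hne₁ (by
        rw [show h X.p₁.rep q₁ = r₁ * h X.p₁.rep X.p₁.rep from hi₁]
        exact mul_ne_zero (by exact_mod_cast hr₁.ne') hg.1)
    · exact not_isOrthogonal_mk hne₂ (by
        rw [show h X.p₂.rep q₂ = r₂ * h X.p₂.rep X.p₂.rep from hi₂]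
        exact mul_ne_zero (by exact_mod_cast hr₂.ne') hg.2.1)
    · obtain ⟨r, s, hr, hs, h1, h2⟩ := exists_segment_smul hne₁ hr₁ hg.1 hi₁ hxs
      obtain ⟨η, hη⟩ := hfix x hx ((r : ℂ) • ⟨X.p₁.rep, hv₁⟩ + (s : ℂ) • q₁) h2
      exact hseg₁ r s hr hs η (fun h0 => h1 (congrArg Subtype.val h0)) hη
    · obtain ⟨r, s, hr, hs, h1, h2⟩ := exists_segment_smul hne₂ hr₂ hg.2.1 hi₂ hxs
      obtain ⟨η, hη⟩ := hfix x hx ((r : ℂ) • ⟨X.p₂.rep, hv₂⟩ + (s : ℂ) • q₂) h2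
      exact hseg₂ r s hr hs η (fun h0 => h1 (congrArg Subtype.val h0)) hη

end FBending

/-! ### Bendings, changes of orientation, changes of components -/

section Moves

variable {V : Type*} [AddCommGroup V] [Module ℂ V] {h : V →ₗ[ℂ] V →ₗ⋆[ℂ] ℂ}

theorem IsSignature21.norm_det (hh : IsSignature21 h) {T : Module.End ℂ V}
    (hT : ∀ x y, h (T x) (T y) = h x y) : ‖LinearMap.det T‖ = 1 := by
  obtain ⟨b, hb⟩ := hh
  set J : Matrix (Fin 3) (Fin 3) ℂ := Matrix.diagonal ![1, 1, -1] with hJ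
  set A := LinearMap.toMatrix b b T with hA
  have hb' : ∀ i j, h (b i) (b j) = J i j := by
    intro i j
    rw [hb, hJ, Matrix.diagonal_apply]
  have key : A.transpose * J * A.map conj = J := by
    ext i j
    have h1 := hT (b i) (b j)
    rw [← b.sum_repr (T (b i)), ← b.sum_repr (T (b j))] at h1
    simp only [map_sum, map_smul, LinearMap.sum_apply, LinearMap.smul_apply,
      LinearMap.map_smulₛₗ, hb', smul_eq_mul] at h1
    rw [← h1, Matrix.mul_apply]
    apply Finset.sum_congr rfl
    intro k _
    rw [Matrix.mul_apply, Finset.sum_mul, Finset.mul_sum]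
    apply Finset.sum_congr rfl
    intro l _
    rw [Matrix.transpose_apply, Matrix.map_apply, hA, LinearMap.toMatrix_apply,
      LinearMap.toMatrix_apply]
    ring
  have hd := congrArg Matrix.det key
  rw [Matrix.det_mul, Matrix.det_mul, Matrix.det_transpose] at hd
  have hJd : J.det ≠ 0 := by
    rw [hJ, Matrix.det_diagonal]
    simp [Fin.prod_univ_three]
  have hc : (A.map conj).det = conj A.det := by
    rw [RingHom.map_det]
    rfl
  rw [hc] at hd
  have h2 : A.det * conj A.det = 1 := by
    apply mul_right_cancel₀ hJd
    linear_combination hd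
  rw [Complex.mul_conj, Complex.normSq_eq_norm_sq] at h2
  have h3 : ‖A.det‖ ^ 2 = 1 := by exact_mod_cast h2
  rw [← LinearMap.det_toMatrix b]
  exact (pow_eq_one_iff_of_nonneg (norm_nonneg _) two_ne_zero).mp h3

/-- An isometry can be rescaled to an element of `SU(2,1)`. -/
theorem IsSignature21.exists_isSU_smul (hh : IsSignature21 h) {T : Module.End ℂ V}
    (hT : ∀ x y, h (T x) (T y) = h x y) : ∃ κ : ℂ, κ ≠ 0 ∧ IsSU h (κ • T) := by
  have hd := hh.norm_det hT
  have hd0 : LinearMap.det T ≠ 0 := by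
    intro h0
    rw [h0, norm_zero] at hd
    exact zero_ne_one hd
  obtain ⟨κ, hκ⟩ := IsAlgClosed.exists_pow_nat_eq (LinearMap.det T)⁻¹ (n := 3) (by norm_num)
  have hκ1 : ‖κ‖ = 1 := by
    have h1 := congrArg norm hκ
    rw [norm_pow, norm_inv, hd, inv_one] at h1
    exact (pow_eq_one_iff_of_nonneg (norm_nonneg κ) (by norm_num)).mp h1
  refine ⟨κ, fun h0 => by simp [h0] at hκ1, ?_, ?_⟩
  · intro x y
    have h2 : κ * conj κ = 1 := by
      rw [Complex.mul_conj, Complex.normSq_eq_norm_sq, hκ1]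
      simp
    simp only [LinearMap.smul_apply, map_smul, LinearMap.map_smulₛₗ, hT, smul_eq_mul]
    rw [← mul_assoc, mul_comm (conj κ), h2, one_mul]
  · rw [LinearMap.det_smul, hh.finrank, hκ, inv_mul_cancel₀ hd0]

theorem sends_of_eq {C : Module.End ℂ V} {p q : ℙ ℂ V} {a : ℂ} (ha : a ≠ 0)
    (hC : C p.rep = a • q.rep) : Sends C p q := by
  rw [Sends, p.submodule_eq, q.submodule_eq, Submodule.map_span, Set.image_singleton, hC]
  exact Submodule.span_singleton_smul_eq (IsUnit.mk0 a ha) _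

theorem IsParameter.zpow_sub_ne_zero {α : ℂ} (hα : IsParameter α) : α ^ (-2 : ℤ) - α ≠ 0 := by
  intro h0
  apply hα.2
  have h1 := hα.ne_zero
  rw [sub_eq_zero, zpow_neg, zpow_ofNat] at h0
  field_simp at h0
  exact h0.symm

theorem traceLine_injective {α β : ℂ} (hα : IsParameter α) (hβ : IsParameter β) {t t' : ℝ}
    (h : traceLine α β t = traceLine α β t') : t = t' := by
  rw [traceLine, traceLine, add_right_inj] at h
  have := mul_left_cancel₀ (mul_ne_zero hα.zpow_sub_ne_zero hβ.zpow_sub_ne_zero) h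
  exact_mod_cast this

theorem Config.IsGeneric.genPair {X : Config V} (hX : X.IsGeneric h) :
    GenPair h X.p₁.rep X.p₂.rep := (isGenericPair_iff _ _).mp hX.1

theorem Config.IsGeneric.trace (hh : IsSignature21 h) {X : Config V} (hX : X.IsGeneric h) :
    LinearMap.trace ℂ V (X.product h) = traceLine X.α₁ X.α₂ (tance h X.p₁ X.p₂) := by
  have := hh.finite
  rw [Config.product_eq, trace_ell_mul_ell hh.herm hh.finrank hX.genPair.1 hX.genPair.2.1]
  rfl

/-- The eigenspace of the product of the parameters is the polar of the line of centres. -/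
theorem Config.IsGeneric.eigen_iff {X : Config V} (hX : X.IsGeneric h) (x : V) :
    X.product h x = (X.α₁ * X.α₂) • x ↔ h x X.p₁.rep = 0 ∧ h x X.p₂.rep = 0 := by
  have hg := hX.genPair
  obtain ⟨-, h1, h2⟩ := hX
  rw [Config.product_eq, Module.End.mul_apply]
  constructor
  · intro hx
    have n1 := h1.zpow_sub_ne_zero
    have n2 := h2.zpow_sub_ne_zero
    have hα₂ := h2.ne_zero
    generalize X.p₁.rep = v at *
    generalize X.p₂.rep = w at *
    rw [ell_apply w, ell_apply v] at hx
    generalize X.α₂ ^ (-2 : ℤ) - X.α₂ = m₂ at *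
    generalize X.α₁ ^ (-2 : ℤ) - X.α₁ = m₁ at *
    -- Rx - α₁α₂x is a combination of the two independent centres, so both coefficients vanish.
    have e : (X.α₂ * (m₁ * (h x v / h v v))) • v + (m₂ * (h (((m₁ * (h x v / h v v)) • v +
        X.α₁ • x)) w / h w w)) • w = 0 := by
      rw [← sub_eq_zero] at hx
      rw [← hx]
      module
    obtain ⟨e1, e2⟩ := hg.eq_zero' e
    have hxv : h x v = 0 := by
      have hv := hg.1
      by_contra hne
      exact mul_ne_zero hα₂ (mul_ne_zero n1 (div_ne_zero hne hv)) e1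
    refine ⟨hxv, ?_⟩
    rw [hxv] at e2
    simp [n2, hg.2.1, h1.ne_zero] at e2
    exact e2
  · rintro ⟨hx1, hx2⟩
    rw [ell_orthogonal hx1, map_smul, ell_orthogonal hx2, smul_smul]

/-- Equal products and parameters give equal tances and the same polar vector c. After rescaling,
the two pairs have the same Gram matrix, so an isometry fixing c carries one to the other;
conjugation by it carries the first product to the second, which is the same operator, so it
commutes with R. -/
theorem isBending_of_signature_eq (hh : IsSignature21 h) {X Y : Config V} (hX : X.IsGeneric h)
    (hY : Y.IsGeneric h) (hp : X.product h = Y.product h) (h₁ : Y.α₁ = X.α₁) (h₂ : Y.α₂ = X.α₂)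
    (hs₁ : signature h Y.p₁ = signature h X.p₁) : IsBending h X Y := by
  have hH := hh.herm
  have hfin := hh.finite
  have hgX := hX.genPair
  have hgY := hY.genPair
  have htan : tance h X.p₁ X.p₂ = tance h Y.p₁ Y.p₂ := by
    have e1 := hX.trace hh
    have e2 := hY.trace hh
    rw [hp, e2, h₁, h₂] at e1
    exact (traceLine_injective hX.2.1 hX.2.2 e1).symm
  have htan' : vtance h X.p₁.rep X.p₂.rep = vtance h Y.p₁.rep Y.p₂.rep := htan
  obtain ⟨c, hc⟩ := hgX.exists_polar hh
  have hcY : h c Y.p₁.rep = 0 ∧ h c Y.p₂.rep = 0 := by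
    rw [← hY.eigen_iff, h₁, h₂, ← hp, hX.eigen_iff]
    exact ⟨hc.left, hc.right⟩
  have hv₁n := hH.self_ne_zero.mp hgX.1
  have hv₂n := hH.self_ne_zero.mp hgX.2.1
  have hw₁n := hH.self_ne_zero.mp hgY.1
  have hw₂n := hH.self_ne_zero.mp hgY.2.1
  have hprod := Config.product_eq (h := h) X
  have hprod' := Config.product_eq (h := h) Y
  have hz := hgX.2.2.1
  have hz' := hgY.2.2.1
  rw [signature_eq, signature_eq] at hs₁
  have hratio : 0 < nrm h X.p₁.rep / nrm h Y.p₁.rep := by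
    rcases lt_or_gt_of_ne hv₁n with hlt | hgt
    · rw [sign_neg hlt, sign_eq_neg_one_iff] at hs₁
      exact div_pos_of_neg_of_neg hlt hs₁
    · rw [sign_pos hgt, sign_eq_one_iff] at hs₁
      exact div_pos hgt hs₁
  set v₁ := X.p₁.rep with hv₁
  set v₂ := X.p₂.rep with hv₂
  set w₁ := Y.p₁.rep with hw₁
  set w₂ := Y.p₂.rep with hw₂
  -- The factor a₁ matches the first squares, possible because the signatures agree; a₂ then matches
  -- the mixed product, and equality of the tances matches the second squares.
  set a₁ : ℝ := Real.sqrt (nrm h v₁ / nrm h w₁) with ha₁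
  have ha₁p : 0 < a₁ := Real.sqrt_pos.mpr hratio
  have ha₁s : a₁ ^ 2 * nrm h w₁ = nrm h v₁ := by
    rw [ha₁, Real.sq_sqrt hratio.le, div_mul_cancel₀ _ hw₁n]
  set a₂ : ℂ := conj (h v₁ v₂ / (a₁ * h w₁ w₂)) with ha₂
  have ha₁C : (a₁ : ℂ) ≠ 0 := by exact_mod_cast ha₁p.ne'
  have ha₂0 : a₂ ≠ 0 := by
    rw [ha₂]
    simpa using ⟨hz, ha₁p.ne', hz'⟩
  have g11 : h ((a₁ : ℂ) • w₁) ((a₁ : ℂ) • w₁) = h v₁ v₁ := by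
    rw [hH.self_eq, hH.self_eq, nrm_smul hH, Complex.normSq_ofReal, ← sq, ha₁s]
  have g12 : h ((a₁ : ℂ) • w₁) (a₂ • w₂) = h v₁ v₂ := by
    simp only [map_smul, LinearMap.smul_apply, LinearMap.map_smulₛₗ, ha₂, Complex.conj_conj,
      smul_eq_mul]
    field_simp
  have g22 : h (a₂ • w₂) (a₂ • w₂) = h v₂ v₂ := by
    rw [hH.self_eq, hH.self_eq, nrm_smul hH]
    congr 1
    rw [ha₂, Complex.normSq_conj, Complex.normSq_div, Complex.normSq_mul, Complex.normSq_ofReal]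
    have hz'' : Complex.normSq (h w₁ w₂) ≠ 0 := by simpa using hz'
    rw [vtance, vtance] at htan'
    field_simp at htan' ⊢
    rw [← ha₁s] at htan'
    have := ha₁p.ne'
    field_simp at htan'
    linear_combination htan'
  have hsp : ⊤ ≤ Submodule.span ℂ (Set.range ![v₁, v₂, c]) := by
    rintro u -
    rw [Submodule.mem_span_range_iff_exists_fun]
    obtain ⟨a, b, γ, rfl⟩ := hc.span u
    exact ⟨![a, b, γ], by simp [Fin.sum_univ_three]⟩
  set B := basisOfTopLeSpanOfCardEqFinrank ![v₁, v₂, c] hsp (by simp [hh.finrank]) with hB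
  set C : Module.End ℂ V := B.constr ℂ ![(a₁ : ℂ) • w₁, a₂ • w₂, c] with hC
  have c0 : C v₁ = (a₁ : ℂ) • w₁ := by
    have := B.constr_basis ℂ ![(a₁ : ℂ) • w₁, a₂ • w₂, c] 0
    rwa [show B 0 = v₁ by simp [hB]] at this
  have c1 : C v₂ = a₂ • w₂ := by
    have := B.constr_basis ℂ ![(a₁ : ℂ) • w₁, a₂ • w₂, c] 1
    rwa [show B 1 = v₂ by simp [hB]] at this
  have c2 : C c = c := by
    have := B.constr_basis ℂ ![(a₁ : ℂ) • w₁, a₂ • w₂, c] 2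
    rwa [show B 2 = c by simp [hB]] at this
  have hiso : ∀ x y, h (C x) (C y) = h x y := by
    intro x y
    obtain ⟨a, b, γ, rfl⟩ := hc.span x
    obtain ⟨a', b', γ', rfl⟩ := hc.span y
    have g21 : h (a₂ • w₂) ((a₁ : ℂ) • w₁) = h v₂ v₁ := by rw [hH, g12, ← hH]
    have k1 : h c ((a₁ : ℂ) • w₁) = 0 := by rw [LinearMap.map_smulₛₗ, hcY.1, smul_zero]
    have k2 : h c (a₂ • w₂) = 0 := by rw [LinearMap.map_smulₛₗ, hcY.2, smul_zero]
    simp only [map_add, map_smul C, c0, c1, c2]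
    generalize (a₁ : ℂ) • w₁ = y₁ at *
    generalize a₂ • w₂ = y₂ at *
    simp only [map_smul, LinearMap.add_apply, LinearMap.smul_apply, LinearMap.map_smulₛₗ,
      g11, g12, g21, g22, k1, k2, hH.eq_zero_comm k1, hH.eq_zero_comm k2, hc.left, hc.right,
      hH.eq_zero_comm hc.left, hH.eq_zero_comm hc.right]
  obtain ⟨κ, hκ, hSU⟩ := hh.exists_isSU_smul hiso
  refine ⟨κ • C, hSU, ?_, sends_of_eq (mul_ne_zero hκ ha₁C) ?_,
    sends_of_eq (mul_ne_zero hκ ha₂0) ?_, h₁, h₂⟩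
  · have hcomm : C * X.product h = X.product h * C := by
      conv_rhs => rw [hp]
      ext x
      rw [hprod, hprod']
      simp only [Module.End.mul_apply]
      rw [map_ell hiso, map_ell hiso, c0, c1, ell_smul ha₁C, ell_smul ha₂0, h₁, h₂]
    rw [smul_mul_assoc, mul_smul_comm, hcomm]
  · rw [LinearMap.smul_apply, c0, smul_smul]
  · rw [LinearMap.smul_apply, c1, smul_smul]

end Moves

/-! ### Changes of components and of orientation -/

section Moves

variable {V : Type*} [AddCommGroup V] [Module ℂ V] {h : V →ₗ[ℂ] V →ₗ⋆[ℂ] ℂ}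

/-- A cube root of unity satisfies δ⁻² = δ, so it multiplies both eigenvalues α⁻² and α. -/
theorem ell_cubeRoot_mul {δ : ℂ} (hδ : δ ^ 3 = 1) (v : V) (α : ℂ) :
    ell h v (δ * α) = δ • ell h v α := by
  have h1 : (δ * α) ^ (-2 : ℤ) = δ * α ^ (-2 : ℤ) := by
    have : δ ^ (-2 : ℤ) = δ := by
      rw [zpow_neg, zpow_ofNat]
      apply inv_eq_of_mul_eq_one_right
      rw [← pow_succ, hδ]
    rw [mul_zpow, this]
  rw [ell, ell, h1, smul_add, smul_smul, smul_smul, mul_sub]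

theorem IsParameter.cubeRoot_mul {δ α : ℂ} (hδ : δ ^ 3 = 1) (hα : IsParameter α) :
    IsParameter (δ * α) := by
  constructor
  · have h1 := congrArg norm hδ
    rw [norm_pow, norm_one] at h1
    rw [norm_mul, hα.1, (pow_eq_one_iff_of_nonneg (norm_nonneg δ) (by norm_num)).mp h1, one_mul]
  · rw [IsCubeRoot, mul_pow, hδ, one_mul]
    exact hα.2

theorem changeOfComponents_step {X : Config V} (hX : X.IsGeneric h) :
    BasicRelation h X ⟨X.p₁, X.p₂, omega * X.α₁, omega⁻¹ * X.α₂⟩ := by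
  have h1 := omega_pow_three
  have h2 : omega⁻¹ ^ 3 = 1 := by rw [inv_pow, h1, inv_one]
  refine ⟨hX, ⟨hX.1, hX.2.1.cubeRoot_mul h1, hX.2.2.cubeRoot_mul h2⟩, ?_,
    Or.inr (Or.inr (Or.inr (Or.inl ⟨rfl, rfl, Or.inr ⟨rfl, rfl⟩⟩)))⟩
  rw [Config.product_eq, Config.product_eq, ell_cubeRoot_mul h1, ell_cubeRoot_mul h2,
    smul_mul_smul_comm, inv_mul_cancel₀ omega_ne_zero, one_smul]

theorem followsFromBasic_changeOfComponents {X : Config V} (hX : X.IsGeneric h) (n : ℕ) :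
    FollowsFromBasic h X ⟨X.p₁, X.p₂, omega ^ n * X.α₁, (omega ^ n)⁻¹ * X.α₂⟩ ∧
      (⟨X.p₁, X.p₂, omega ^ n * X.α₁, (omega ^ n)⁻¹ * X.α₂⟩ : Config V).IsGeneric h := by
  induction n with
  | zero =>
    simp only [pow_zero, inv_one, one_mul]
    exact ⟨Relation.EqvGen.refl _, hX⟩
  | succ n ih =>
    have h1 := changeOfComponents_step ih.2
    have e : (⟨X.p₁, X.p₂, omega * (omega ^ n * X.α₁), omega⁻¹ * ((omega ^ n)⁻¹ * X.α₂)⟩ : Config V)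
        = ⟨X.p₁, X.p₂, omega ^ (n + 1) * X.α₁, (omega ^ (n + 1))⁻¹ * X.α₂⟩ := by
      congr 1
      · ring
      · rw [pow_succ, mul_inv]
        ring
    simp only [e] at h1
    exact ⟨Relation.EqvGen.trans _ _ _ ih.1 (Relation.EqvGen.rel _ _ h1), h1.generic_right⟩

theorem FollowsFromBasic.product_eq {X Y : Config V} (hXY : FollowsFromBasic h X Y) :
    X.product h = Y.product h := by
  induction hXY with
  | rel _ _ h => exact h.product_eq
  | refl _ => rfl
  | symm _ _ _ ih => exact ih.symm
  | trans _ _ _ _ _ ih₁ ih₂ => exact ih₁.trans ih₂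

/-- The change of orientation of a generic product. -/
theorem exists_changeOfOrientation (hH : Herm h) {X : Config V} (hX : X.IsGeneric h) :
    ∃ Y : Config V, BasicRelation h X Y ∧ Y.α₁ = X.α₂ ∧ Y.α₂ = X.α₁ ∧
      tance h Y.p₁ Y.p₂ = tance h X.p₁ X.p₂ := by
  have hg := hX.genPair
  have hX' := hX
  obtain ⟨-, h1, h2⟩ := hX'
  set T := ell h X.p₂.rep X.α₂ with hT
  have hiso : ∀ x y, h (T x) (T y) = h x y := ell_isometry hH hg.2.1 h2.1
  have hself : T X.p₂.rep = X.α₂ ^ (-2 : ℤ) • X.p₂.rep := ell_self hg.2.1 _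
  have hunit : X.α₂ ^ (-2 : ℤ) ≠ 0 := zpow_ne_zero _ h2.ne_zero
  have hg' : GenPair h X.p₂.rep (T X.p₁.rep) := by
    rw [← GenPair.smul_iff hunit (one_ne_zero), one_smul, ← hself]
    have := hg.symm hH
    rwa [GenPair, hiso, hiso, hiso, hiso]
  have hne : T X.p₁.rep ≠ 0 := ne_zero_of_self hg'.2.1
  obtain ⟨a, ha, e⟩ := exists_rep (T X.p₁.rep) hne
  have hg'' : GenPair h X.p₂.rep (Projectivization.mk ℂ (T X.p₁.rep) hne).rep := by
    rw [e, ← one_smul ℂ X.p₂.rep, GenPair.smul_iff one_ne_zero ha]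
    exact hg'
  refine ⟨⟨X.p₂, Projectivization.mk ℂ (T X.p₁.rep) hne, X.α₂, X.α₁⟩,
    ⟨hX, ⟨(isGenericPair_iff _ _).mpr hg'', h2, h1⟩, ?_, Or.inr (Or.inr (Or.inl ⟨rfl, rfl, ?_, rfl⟩))⟩,
    rfl, rfl, ?_⟩
  · rw [Config.product_eq]
    simp only [Config.product, specialElliptic_mk]
    rw [specialElliptic_eq, ← hT]
    ext x
    simp only [Module.End.mul_apply]
    rw [map_ell hiso]
  · apply sends_of_eq (inv_ne_zero ha)
    rw [e, smul_smul, inv_mul_cancel₀ ha, one_smul, specialElliptic_eq]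
  · change vtance h _ _ = vtance h _ _
    have hs := Complex.normSq_pos.mpr ha
    have hu := Complex.normSq_pos.mpr hunit
    have e1 : h X.p₂.rep (T X.p₁.rep) = (X.α₂ ^ (-2 : ℤ))⁻¹ * h X.p₂.rep X.p₁.rep := by
      have h3 := hiso X.p₂.rep X.p₁.rep
      rw [hself, map_smul, LinearMap.smul_apply, smul_eq_mul] at h3
      rw [← h3, inv_mul_cancel_left₀ hunit]
    have e2 : Complex.normSq (X.α₂ ^ (-2 : ℤ))⁻¹ = 1 := by
      rw [Complex.normSq_eq_norm_sq, norm_inv, norm_zpow, h2.1]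
      simp
    have e3 : nrm h (T X.p₁.rep) = nrm h X.p₁.rep := by rw [nrm, hiso, nrm]
    rw [vtance_comm hH X.p₁.rep, vtance, vtance, e, nrm_smul hH, LinearMap.map_smulₛₗ, smul_eq_mul,
      Complex.normSq_mul, Complex.normSq_conj, e1, Complex.normSq_mul, e2, e3, one_mul]
    field_simp

end Moves

/-! ### Products with different polar eigenvalues -/

section Orthogonal

variable {V : Type*} [AddCommGroup V] [Module ℂ V] {h : V →ₗ[ℂ] V →ₗ⋆[ℂ] ℂ}

theorem Config.IsGeneric.isometry (hH : Herm h) {X : Config V} (hX : X.IsGeneric h) (x y : V) :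
    h (X.product h x) (X.product h y) = h x y := by
  rw [Config.product_eq, Module.End.mul_apply, Module.End.mul_apply,
    ell_isometry hH hX.genPair.2.1 hX.2.2.1, ell_isometry hH hX.genPair.1 hX.2.1.1]

theorem Config.IsGeneric.norm_mul_eq_one {X : Config V} (hX : X.IsGeneric h) : ‖X.α₁ * X.α₂‖ = 1 := by
  rw [norm_mul, hX.2.1.1, hX.2.2.1, one_mul]

theorem orthogonal_of_eigen {A : Module.End ℂ V} (hA : ∀ x y, h (A x) (A y) = h x y) {x y : V}
    {μ ν : ℂ} (hx : A x = μ • x) (hy : A y = ν • y) (hμν : μ ≠ ν) (hν : ‖ν‖ = 1) : h x y = 0 := by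
  have h1 := hA x y
  have h2 : ν * conj ν = 1 := by
    rw [Complex.mul_conj, Complex.normSq_eq_norm_sq, hν]
    simp
  rw [hx, hy] at h1
  simp only [map_smul, LinearMap.smul_apply, LinearMap.map_smulₛₗ, smul_eq_mul] at h1
  have h3 : (μ - ν) * h x y = 0 := by linear_combination ν * h1 - μ * h x y * h2
  exact (mul_eq_zero.mp h3).resolve_left (sub_ne_zero.mpr hμν)

theorem isFixedPoint_mk {A : Module.End ℂ V} {x : V} (hx : x ≠ 0) {μ : ℂ} (hμ : μ ≠ 0)
    (hA : A x = μ • x) : IsFixedPoint A (Projectivization.mk ℂ x hx) := by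
  obtain ⟨a, -, e⟩ := exists_rep x hx
  apply sends_of_eq hμ
  rw [e, map_smul, hA, smul_comm]

theorem isRegularElliptic_of_eigen (hH : Herm h) {A : Module.End ℂ V} {x y z : V} {μ₁ μ₂ μ₃ : ℂ}
    (hx : A x = μ₁ • x) (hy : A y = μ₂ • y) (hz : A z = μ₃ • z) (hx0 : x ≠ 0) (hy0 : y ≠ 0)
    (hz0 : z ≠ 0) (h1 : μ₁ ≠ 0) (h2 : μ₂ ≠ 0) (h3 : μ₃ ≠ 0) (h12 : μ₁ ≠ μ₂) (h13 : μ₁ ≠ μ₃)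
    (h23 : μ₂ ≠ μ₃) (hneg : nrm h x < 0 ∨ nrm h y < 0 ∨ nrm h z < 0) : IsRegularElliptic h A := by
  constructor
  · have key : ∀ (u : V) (μ : ℂ), u ≠ 0 → μ ≠ 0 → A u = μ • u → nrm h u < 0 →
        ∃ x : ℙ ℂ V, signature h x = -1 ∧ IsFixedPoint A x := fun u μ hu hμ hA hn =>
      ⟨Projectivization.mk ℂ u hu, by rw [signature_mk hH, sign_neg hn], isFixedPoint_mk hu hμ hA⟩
    rcases hneg with hn | hn | hn
    · exact key x μ₁ hx0 h1 hx hn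
    · exact key y μ₂ hy0 h2 hy hn
    · exact key z μ₃ hz0 h3 hz hn
  · have key : ∀ (u : V) (μ : ℂ), u ≠ 0 → A u = μ • u → A.HasEigenvalue μ := fun u μ hu hA =>
      Module.End.hasEigenvalue_of_hasEigenvector
        (Module.End.hasEigenvector_iff.mpr ⟨Module.End.mem_eigenspace_iff.mpr hA, hu⟩)
    refine ⟨![μ₁, μ₂, μ₃], ?_, ?_⟩
    · intro i j hij
      fin_cases i <;> fin_cases j <;> simp_all
    · intro i
      fin_cases i
      · exact key x _ hx0 hx
      · exact key y _ hy0 hy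
      · exact key z _ hz0 hz

theorem IsSignature21.exists_orthogonal (hh : IsSignature21 h) (x y : V) :
    ∃ z ≠ 0, h z x = 0 ∧ h z y = 0 := by
  have hfin := hh.finite
  obtain ⟨z, hz, hz0⟩ : ∃ z ∈ LinearMap.ker ((h.flip x).prod (h.flip y)), z ≠ 0 := by
    apply Submodule.exists_mem_ne_zero_of_ne_bot
    apply LinearMap.ker_ne_bot_of_finrank_lt
    rw [hh.finrank, Module.finrank_prod]
    simp
  exact ⟨z, hz0, by simpa using congrArg Prod.fst (LinearMap.mem_ker.mp hz),
    by simpa using congrArg Prod.snd (LinearMap.mem_ker.mp hz)⟩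

theorem IsPolar.coeff_eq_zero (hH : Herm h) {v w c : V} (hc : IsPolar h v w c) {a b γ : ℂ}
    (hx : h (a • v + b • w + γ • c) c = 0) : γ = 0 := by
  simp only [map_add, map_smul, LinearMap.add_apply, LinearMap.smul_apply, smul_eq_mul,
    hH.eq_zero_comm hc.left, hH.eq_zero_comm hc.right, mul_zero, zero_add] at hx
  exact (mul_eq_zero.mp hx).resolve_right hc.self_ne

theorem IsPolar.eq_smul {v w c x : V} (hg : GenPair h v w) (hc : IsPolar h v w c)
    (h1 : h x v = 0) (h2 : h x w = 0) : ∃ γ : ℂ, x = γ • c := by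
  obtain ⟨a, b, γ, rfl⟩ := hc.span x
  have := hg.eq_zero (a := a) (b := b)
    (by simpa [hc.left] using h1) (by simpa [hc.right] using h2)
  exact ⟨γ, by simp [this.1, this.2]⟩

/-- Two generic products with different polar eigenvalues satisfy an orthogonal relation. -/
theorem basicRelation_of_mul_ne (hh : IsSignature21 h) {X Y : Config V} (hX : X.IsGeneric h)
    (hY : Y.IsGeneric h) (hp : X.product h = Y.product h) (hne : X.α₁ * X.α₂ ≠ Y.α₁ * Y.α₂) :
    BasicRelation h X Y := by
  have hH := hh.herm
  have hgX := hX.genPair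
  have hgY := hY.genPair
  obtain ⟨c, hc⟩ := hgX.exists_polar hh
  obtain ⟨d, hd⟩ := hgY.exists_polar hh
  have hRc := (hX.eigen_iff c).mpr ⟨hc.left, hc.right⟩
  have hRd : X.product h d = (Y.α₁ * Y.α₂) • d := by
    rw [hp]
    exact (hY.eigen_iff d).mpr ⟨hd.left, hd.right⟩
  have hiso := hX.isometry hH
  have hcd := orthogonal_of_eigen hiso hRc hRd hne hY.norm_mul_eq_one
  have hc0 := ne_zero_of_self hc.self_ne
  have hd0 := ne_zero_of_self hd.self_ne
  have hX0 : X.α₁ * X.α₂ ≠ 0 := mul_ne_zero hX.2.1.ne_zero hX.2.2.ne_zero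
  have hY0 : Y.α₁ * Y.α₂ ≠ 0 := mul_ne_zero hY.2.1.ne_zero hY.2.2.ne_zero
  refine ⟨hX, hY, hp, Or.inr (Or.inr (Or.inr (Or.inr (Or.inr (Or.inr ⟨hne, ?_, ?_, ?_⟩)))))⟩
  · intro x hx
    have h1 := hx _ (mem_line.mpr ⟨1, 0, by simp⟩ : X.p₁.rep ∈ line X.p₁ X.p₂)
    have h2 := hx _ (mem_line.mpr ⟨0, 1, by simp⟩ : X.p₂.rep ∈ line X.p₁ X.p₂)
    obtain ⟨γ, rfl⟩ := hc.eq_smul hgX h1 h2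
    obtain ⟨a, b, γ', e⟩ := hd.span (γ • c)
    have h3 : h (γ • c) d = 0 := by rw [map_smul, LinearMap.smul_apply, hcd, smul_zero]
    rw [e] at h3
    have h4 := hd.coeff_eq_zero hH h3
    rw [e, h4, zero_smul, add_zero]
    exact mem_line.mpr ⟨a, b, rfl⟩
  · rw [← hX.trace hh, ← hY.trace hh, hp]
  -- R preserves the orthogonal complement of the two polar vectors, which is a line: this is the
  -- third eigenvector.
  · obtain ⟨e, he0, hec, hed⟩ := hh.exists_orthogonal c d
    have hRe : ∃ ν : ℂ, X.product h e = ν • e := by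
      obtain ⟨a, b, ν, h1⟩ := hh.exists_coeff hc.self_ne hd.self_ne he0 hcd (hH.eq_zero_comm hec)
        (hH.eq_zero_comm hed) (X.product h e)
      have k1 : h (X.product h e) c = 0 := by
        have : h (X.product h e) ((X.α₁ * X.α₂) • c) = 0 := by rw [← hRc, hiso, hec]
        rw [LinearMap.map_smulₛₗ, smul_eq_mul] at this
        exact (mul_eq_zero.mp this).resolve_left (by simpa using hX0)
      have k2 : h (X.product h e) d = 0 := by
        have : h (X.product h e) ((Y.α₁ * Y.α₂) • d) = 0 := by rw [← hRd, hiso, hed]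
        rw [LinearMap.map_smulₛₗ, smul_eq_mul] at this
        exact (mul_eq_zero.mp this).resolve_left (by simpa using hY0)
      rw [h1] at k1 k2
      simp [hec, hH.eq_zero_comm hcd, hc.self_ne] at k1
      simp [hed, hcd, hd.self_ne] at k2
      exact ⟨ν, by rw [h1, k1, k2]; simp⟩
    obtain ⟨ν, hRe⟩ := hRe
    -- Otherwise e would be proportional to c, since the eigenspace of α₁α₂ is the polar line; but e
    -- is orthogonal to the nonisotropic c.
    have n1 : X.α₁ * X.α₂ ≠ ν := by
      rintro rfl
      obtain ⟨h1, h2⟩ := (hX.eigen_iff e).mp hRe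
      obtain ⟨γ, rfl⟩ := hc.eq_smul hgX h1 h2
      simp [hc.self_ne] at hec
      simp [hec] at he0
    have n2 : Y.α₁ * Y.α₂ ≠ ν := by
      rintro rfl
      rw [hp] at hRe
      obtain ⟨h1, h2⟩ := (hY.eigen_iff e).mp hRe
      obtain ⟨γ, rfl⟩ := hd.eq_smul hgY h1 h2
      simp [hd.self_ne] at hed
      simp [hed] at he0
    have hee := hh.self_ne_zero_of_orthogonal hc.self_ne hd.self_ne he0 hcd (hH.eq_zero_comm hec)
        (hH.eq_zero_comm hed)
    have n3 : ν ≠ 0 := by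
      rintro rfl
      have := hiso e e
      rw [hRe] at this
      simp at this
      exact hee this.symm
    exact isRegularElliptic_of_eigen hH hRc hRd hRe hc0 hd0 he0 hX0 hY0 n3 hne n1 n2
      (hh.exists_neg_of_orthogonal hc.self_ne hd.self_ne he0 hcd (hH.eq_zero_comm hec)
        (hH.eq_zero_comm hed))

end Orthogonal

/-! ### Generic products with a prescribed definite line of centres -/

section Definite

variable {V : Type*} [AddCommGroup V] [Module ℂ V] {h : V →ₗ[ℂ] V →ₗ⋆[ℂ] ℂ}

theorem mul_conj_eq_one {z : ℂ} (hz : ‖z‖ = 1) : z * conj z = 1 := by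
  rw [Complex.mul_conj, Complex.normSq_eq_norm_sq, hz]
  simp

theorem eq_or_eq_conj_of_re_eq {κ e : ℂ} (hκ : ‖κ‖ = 1) (he : ‖e‖ = 1) (hre : κ.re = e.re) :
    e = κ ∨ e = conj κ := by
  have h1 := Complex.add_conj κ
  have h2 := Complex.add_conj e
  rw [← hre, ← h1] at h2
  have h3 : (e - κ) * (e - conj κ) = 0 := by
    linear_combination e * h2 - mul_conj_eq_one he + mul_conj_eq_one hκ
  rcases mul_eq_zero.mp h3 with h3 | h3
  · exact Or.inl (sub_eq_zero.mp h3)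
  · exact Or.inr (sub_eq_zero.mp h3)

/-- The square root with the right sign. -/
theorem exists_sqrt_re_lt {ν μ₁ μ₂ : ℂ} (hν : ‖ν‖ = 1) (hμ₁ : ‖μ₁‖ = 1) (hprod : ν * μ₁ * μ₂ = 1)
    (h1 : ν ≠ μ₁) (h2 : ν ≠ μ₂) :
    ∃ α : ℂ, α ^ 2 = ν ∧ ‖α‖ = 1 ∧ (α ^ 3).re < (α * μ₁).re := by
  obtain ⟨α, hα⟩ := IsAlgClosed.exists_pow_nat_eq ν (n := 2) (by norm_num)
  have hα1 : ‖α‖ = 1 := by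
    have h1 := congrArg norm hα
    rw [norm_pow, hν] at h1
    exact (pow_eq_one_iff_of_nonneg (norm_nonneg α) two_ne_zero).mp h1
  have hα0 : α ≠ 0 := by
    rintro rfl
    simp at hα1
  -- Unit numbers with equal real parts are equal or conjugate; these possibilities mean ν = μ₁ and
  -- ν = μ₂. Passing to -α reverses the strict inequality.
  have hne : (α ^ 3).re ≠ (α * μ₁).re := by
    intro hre
    rcases eq_or_eq_conj_of_re_eq (by rw [norm_pow, hα1, one_pow])
      (by rw [norm_mul, hα1, hμ₁, one_mul]) hre with h3 | h3
    · apply h1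
      rw [← hα]
      apply mul_left_cancel₀ hα0
      rw [h3]
      ring
    · have h4 : α ^ 3 * (α * μ₁) = 1 := by
        rw [h3]
        exact mul_conj_eq_one (by rw [norm_pow, hα1, one_pow])
      apply h2
      have hμ₁0 : μ₁ ≠ 0 := by
        rintro rfl
        simp at hμ₁
      have hν0 : ν ≠ 0 := by
        rintro rfl
        simp at hν
      apply mul_left_cancel₀ (mul_ne_zero hν0 hμ₁0)
      rw [hprod, ← h4, ← hα]
      ring
  rcases lt_or_gt_of_ne hne with h3 | h3
  · exact ⟨α, hα, hα1, h3⟩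
  · refine ⟨-α, by rw [neg_sq, hα], by rw [norm_neg, hα1], ?_⟩
    have e1 : (-α) ^ 3 = -(α ^ 3) := by ring
    rw [e1, neg_mul, Complex.neg_re, Complex.neg_re]
    linarith

/-- The quotient (κ - e)/((κ - 1)(e + 1)) is real because κ and e are unit numbers, and the order of
the real parts places it between 0 and 1. It serves as the squared first coordinate of a centre,
with κ = α³ and e = αμ₁. -/
theorem exists_weight {κ e : ℂ} (hκ : ‖κ‖ = 1) (he : ‖e‖ = 1) (hre : κ.re < e.re) :
    ∃ s : ℝ, 0 < s ∧ s < 1 ∧ (s : ℂ) * ((κ - 1) * (e + 1)) = κ - e := by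
  have k1 := mul_conj_eq_one hκ
  have k2 := mul_conj_eq_one he
  have hκre : κ.re < 1 := lt_of_lt_of_le hre (by rw [← he]; exact Complex.re_le_norm e)
  have here : -1 < e.re := lt_of_le_of_lt
    (by rw [← hκ]; exact (abs_le.mp (Complex.abs_re_le_norm κ)).1) hre
  have n1 : κ - 1 ≠ 0 := by
    intro h0
    rw [sub_eq_zero.mp h0] at hκre
    simp at hκre
  have n2 : e + 1 ≠ 0 := by
    intro h0
    rw [eq_neg_of_add_eq_zero_left h0] at here
    simp at here
  have hκ0 : κ ≠ 0 := by
    rintro rfl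
    simp at hκ
  have he0 : e ≠ 0 := by
    rintro rfl
    simp at he
  have c1 : conj κ = κ⁻¹ := (inv_eq_of_mul_eq_one_right k1).symm
  have c2 : conj e = e⁻¹ := (inv_eq_of_mul_eq_one_right k2).symm
  have n1' : 1 - κ ≠ 0 := fun h0 => n1 (by linear_combination -h0)
  have n2' : 1 + e ≠ 0 := fun h0 => n2 (by linear_combination h0)
  set r : ℂ := (κ - e) / ((κ - 1) * (e + 1)) with hr
  have hconj : conj r = r := by
    rw [hr]
    simp only [map_div₀, map_sub, map_mul, map_add, map_one, c1, c2]
    field_simp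
    ring
  obtain ⟨s, hs⟩ := Complex.conj_eq_iff_real.mp hconj
  have hrs : r * ((κ - 1) * (e + 1)) = κ - e := by
    rw [hr]
    field_simp
  -- Since κ + κ̄ - 2 = κ̄(κ - 1)² and e + ē + 2 = ē(e + 1)², the denominators cancel and s(1 - s)
  -- becomes a ratio of two negative numbers.
  have hs1 : (s * (1 - s)) * ((2 * κ.re - 2) * (2 * e.re + 2)) = 2 * κ.re - 2 * e.re := by
    have e1 := Complex.add_conj κ
    have e2 := Complex.add_conj e
    have : (r * (1 - r)) * ((κ + conj κ - 2) * (e + conj e + 2)) = κ + conj κ - (e + conj e) := by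
      have e3 : κ + conj κ - 2 = conj κ * (κ - 1) ^ 2 := by linear_combination (2 - κ) * k1
      have e4 : e + conj e + 2 = conj e * (e + 1) ^ 2 := by linear_combination (-2 - e) * k2
      rw [e3, e4]
      have e5 : (1 - r) * ((κ - 1) * (e + 1)) = κ * e - 1 := by linear_combination -hrs
      calc r * (1 - r) * (conj κ * (κ - 1) ^ 2 * (conj e * (e + 1) ^ 2))
          = conj κ * conj e * (r * ((κ - 1) * (e + 1))) * ((1 - r) * ((κ - 1) * (e + 1))) := by ring
        _ = conj κ * conj e * (κ - e) * (κ * e - 1) := by rw [hrs, e5]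
        _ = _ := by
          linear_combination (κ * e * conj e - conj e * e * e - conj e) * k1 +
            (κ - e + conj κ) * k2
    rw [e1, e2, hs] at this
    exact_mod_cast this
  have hneg : (2 * κ.re - 2) * (2 * e.re + 2) < 0 :=
    mul_neg_of_neg_of_pos (by linarith) (by linarith)
  have hpos : 0 < s * (1 - s) := by
    by_contra! hcon
    have := mul_nonneg_of_nonpos_of_nonpos hcon hneg.le
    linarith
  refine ⟨s, ?_, ?_, by rw [← hs]; exact hrs⟩
  · by_contra! hcon
    nlinarith
  · by_contra! hcon
    nlinarith

set_option linter.unusedSimpArgs false in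
-- Both parameters can be taken equal to a square root α of ν. On the plane of x and y the operator
-- αA has the eigenvalues e = αμ₁ and ē = αμ₂, and the inequality on real parts that fixes the sign
-- of α ensures 0 < s < 1, so that both centres are unit vectors of the plane.
theorem exists_generic_of_unit_eigen (hh : IsSignature21 h) {A : Module.End ℂ V} {n x y : V}
    {ν μ₁ μ₂ : ℂ} (hn : h n n ≠ 0) (hxx : h x x = 1) (hyy : h y y = 1) (hnx : h n x = 0)
    (hny : h n y = 0) (hxy : h x y = 0) (hAn : A n = ν • n) (hAx : A x = μ₁ • x)
    (hAy : A y = μ₂ • y) (hν : ‖ν‖ = 1) (hμ₁ : ‖μ₁‖ = 1) (hprod : ν * μ₁ * μ₂ = 1)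
    (h1 : ν ≠ μ₁) (h2 : ν ≠ μ₂) (h12 : μ₁ ≠ μ₂) :
    ∃ Z : Config V, Z.IsGeneric h ∧ Z.product h = A ∧ Z.α₁ * Z.α₂ = ν := by
  have hH := hh.herm
  obtain ⟨α, hα, hα1, hre⟩ := exists_sqrt_re_lt hν hμ₁ hprod h1 h2
  have hα0 : α ≠ 0 := by
    rintro rfl
    simp at hα1
  set e := α * μ₁ with he
  have he1 : ‖e‖ = 1 := by rw [he, norm_mul, hα1, hμ₁, one_mul]
  have hκ1 : ‖α ^ 3‖ = 1 := by rw [norm_pow, hα1, one_pow]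
  obtain ⟨s, hs0, hs1, hs⟩ := exists_weight hκ1 he1 hre
  have k2 := mul_conj_eq_one he1
  have here : -1 < e.re := lt_of_le_of_lt
    (by rw [← hκ1]; exact (abs_le.mp (Complex.abs_re_le_norm _)).1) hre
  have hκre : (α ^ 3).re < 1 := lt_of_lt_of_le hre (by rw [← he1]; exact Complex.re_le_norm e)
  have hpar : IsParameter α := by
    refine ⟨hα1, fun h0 => ?_⟩
    rw [show α ^ 3 = 1 from h0] at hκre
    simp at hκre
  have he0 : e ≠ 0 := by
    intro h0
    simp [h0] at he1
  have hμ₁0 : μ₁ ≠ 0 := by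
    rintro rfl
    simp at hμ₁
  have hμ₂ : α * μ₂ * e = 1 := by
    rw [← hprod, he, ← hα]
    ring
  have hμ₂' : α * μ₂ = conj e := by
    apply mul_right_cancel₀ he0
    rw [hμ₂, mul_comm, k2]
  have hne1 : e ≠ 1 := by
    intro h0
    apply h12
    apply mul_left_cancel₀ hα0
    rw [hμ₂', ← he, h0, map_one]
  set σ := Real.sqrt s with hσ
  set τ := Real.sqrt (1 - s) with hτ
  have hσ0 : 0 < σ := Real.sqrt_pos.mpr hs0
  have hτ0 : 0 < τ := Real.sqrt_pos.mpr (by linarith)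
  have hσs : (σ : ℂ) ^ 2 = s := by
    rw [← Complex.ofReal_pow, Real.sq_sqrt hs0.le]
  have hτs : (τ : ℂ) ^ 2 = 1 - s := by
    rw [← Complex.ofReal_pow, Real.sq_sqrt (by linarith)]
    push_cast
    rfl
  have hyx := hH.eq_zero_comm hxy
  -- Up to phases, both centres have weights s and 1 - s on the eigenvectors. The phase -ē in p₂
  -- makes the y-component of the image of x cancel.
  set p₁ := (σ : ℂ) • x + (τ : ℂ) • y with hp₁
  set p₂ := (σ : ℂ) • x - (conj e * τ) • y with hp₂
  have g11 : h p₁ p₁ = 1 := by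
    simp only [hp₁, map_add, map_sub, map_smul, LinearMap.add_apply,
      LinearMap.sub_apply, LinearMap.smul_apply, LinearMap.map_smulₛₗ, map_mul, Complex.conj_conj,
      Complex.conj_ofReal, smul_eq_mul, hxx, hyy, hxy, hyx, hnx, hny]
    linear_combination hσs + hτs
  have g22 : h p₂ p₂ = 1 := by
    simp only [hp₂, map_add, map_sub, map_smul, LinearMap.add_apply,
      LinearMap.sub_apply, LinearMap.smul_apply, LinearMap.map_smulₛₗ, map_mul, Complex.conj_conj,
      Complex.conj_ofReal, smul_eq_mul, hxx, hyy, hxy, hyx, hnx, hny]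
    linear_combination hσs + hτs + (τ : ℂ) ^ 2 * k2
  have g12 : h p₁ p₂ = s - e * (1 - s) := by
    simp only [hp₁, hp₂, map_add, map_sub, map_smul, LinearMap.add_apply,
      LinearMap.sub_apply, LinearMap.smul_apply, LinearMap.map_smulₛₗ, map_mul, Complex.conj_conj,
      Complex.conj_ofReal, smul_eq_mul, hxx, hyy, hxy, hyx, hnx, hny]
    linear_combination hσs - e * hτs
  have g21 : h p₂ p₁ = s - conj e * (1 - s) := by
    simp only [hp₁, hp₂, map_add, map_sub, map_smul, LinearMap.add_apply,
      LinearMap.sub_apply, LinearMap.smul_apply, LinearMap.map_smulₛₗ, map_mul, Complex.conj_conj,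
      Complex.conj_ofReal, smul_eq_mul, hxx, hyy, hxy, hyx, hnx, hny]
    linear_combination hσs - conj e * hτs
  have hs1C : (1 - s : ℂ) ≠ 0 := by
    rw [← Complex.ofReal_one, ← Complex.ofReal_sub]
    exact_mod_cast (by linarith : 1 - s ≠ 0)
  have hs0C : (s : ℂ) ≠ 0 := by exact_mod_cast hs0.ne'
  have hpair : GenPair h p₁ p₂ := by
    -- Orthogonal centres would mean s = e(1 - s), hence e = 1 on taking norms, hence μ₁ = μ₂.
    refine ⟨by rw [g11]; exact one_ne_zero, by rw [g22]; exact one_ne_zero, ?_, ?_⟩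
    · rw [g12]
      intro h0
      have h3 : e * ((1 - s : ℝ) : ℂ) = (s : ℝ) := by
        push_cast
        linear_combination -h0
      have h4 := congrArg norm h3
      rw [norm_mul, he1, one_mul, Complex.norm_real, Complex.norm_real, Real.norm_eq_abs,
        Real.norm_eq_abs, abs_of_pos hs0, abs_of_pos (by linarith)] at h4
      apply hne1
      rw [h4] at h3
      exact mul_right_cancel₀ hs0C (by rw [h3, one_mul])
    · rw [g11, g22, g12, g21, ← sub_ne_zero]
      have h3 : (1 * 1 - (s - e * (1 - s)) * (s - conj e * (1 - s)) : ℂ)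
          = s * (1 - s) * (2 + (e + conj e)) := by
        linear_combination (-(1 - s : ℂ) ^ 2) * k2
      rw [h3, Complex.add_conj]
      refine mul_ne_zero (mul_ne_zero hs0C hs1C) ?_
      exact_mod_cast (by linarith : 2 + 2 * e.re ≠ 0)
  have hn1 : h n p₁ = 0 := by
    simp only [hp₁, map_add, map_sub, map_smul, LinearMap.add_apply,
      LinearMap.sub_apply, LinearMap.smul_apply, LinearMap.map_smulₛₗ, map_mul, Complex.conj_conj,
      Complex.conj_ofReal, smul_eq_mul, hxx, hyy, hxy, hyx, hnx, hny]
    ring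
  have hn2 : h n p₂ = 0 := by
    simp only [hp₂, map_add, map_sub, map_smul, LinearMap.add_apply,
      LinearMap.sub_apply, LinearMap.smul_apply, LinearMap.map_smulₛₗ, map_mul, Complex.conj_conj,
      Complex.conj_ofReal, smul_eq_mul, hxx, hyy, hxy, hyx, hnx, hny]
    ring
  refine ⟨Config.of p₁ p₂ (ne_zero_of_self hpair.1) (ne_zero_of_self hpair.2.1) α α,
    ⟨(isGenericPair_mk _ _ _ _).mpr hpair, hpar, hpar⟩, ?_, by rw [← hα, sq]; rfl⟩
  rw [Config.product_of]
  have hD : α ^ 2 * (α ^ (-2 : ℤ) - α) = 1 - α ^ 3 := by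
    rw [zpow_neg, zpow_ofNat]
    field_simp
  have ell1 : ∀ u, ell h p₁ α u = ((α ^ (-2 : ℤ) - α) * h u p₁) • p₁ + α • u := fun u => by
    rw [ell_apply, g11, div_one]
  have ell2 : ∀ u, ell h p₂ α u = ((α ^ (-2 : ℤ) - α) * h u p₂) • p₂ + α • u := fun u => by
    rw [ell_apply, g22, div_one]
  generalize α ^ (-2 : ℤ) - α = D at *
  have hα2 : α ^ 2 ≠ 0 := pow_ne_zero _ hα0
  -- This is the equation defining s, multiplied out; it evaluates the pairing with p₂ after the
  -- first factor has acted.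
  have star : D * s + α - e * D * (1 - s) = e * α := by
    apply mul_left_cancel₀ hα2
    linear_combination ((s : ℂ) * (1 + e) - e) * hD - hs
  have hx1 : h x p₁ = σ := by
    simp only [hp₁, map_add, map_sub, map_smul, LinearMap.add_apply,
      LinearMap.sub_apply, LinearMap.smul_apply, LinearMap.map_smulₛₗ, map_mul, Complex.conj_conj,
      Complex.conj_ofReal, smul_eq_mul, hxx, hyy, hxy, hyx, hnx, hny]
    ring
  have hy1 : h y p₁ = τ := by
    simp only [hp₁, map_add, map_sub, map_smul, LinearMap.add_apply,
      LinearMap.sub_apply, LinearMap.smul_apply, LinearMap.map_smulₛₗ, map_mul, Complex.conj_conj,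
      Complex.conj_ofReal, smul_eq_mul, hxx, hyy, hxy, hyx, hnx, hny]
    ring
  have hx2 : h x p₂ = σ := by
    simp only [hp₂, map_add, map_sub, map_smul, LinearMap.add_apply,
      LinearMap.sub_apply, LinearMap.smul_apply, LinearMap.map_smulₛₗ, map_mul, Complex.conj_conj,
      Complex.conj_ofReal, smul_eq_mul, hxx, hyy, hxy, hyx, hnx, hny]
    ring
  have hy2 : h y p₂ = -(e * τ) := by
    simp only [hp₂, map_add, map_sub, map_smul, LinearMap.add_apply,
      LinearMap.sub_apply, LinearMap.smul_apply, LinearMap.map_smulₛₗ, map_mul, Complex.conj_conj,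
      Complex.conj_ofReal, smul_eq_mul, hxx, hyy, hxy, hyx, hnx, hny]
    ring
  have eA : ∀ a b γ : ℂ, (ell h p₂ α * ell h p₁ α) (a • n + b • x + γ • y)
      = A (a • n + b • x + γ • y) := by
    intro a b γ
    have hnn : ell h p₂ α (ell h p₁ α n) = ν • n := by
      rw [ell_orthogonal hn1, map_smul, ell_orthogonal hn2, smul_smul, ← sq, hα]
    have hxx' : ell h p₂ α (ell h p₁ α x) = μ₁ • x := by
      have e1 : h (ell h p₁ α x) p₂ = e * α * σ := by
        rw [ell1, hx1]
        simp only [map_add, map_smul, LinearMap.add_apply, LinearMap.smul_apply, smul_eq_mul, g12,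
          hx2]
        linear_combination (σ : ℂ) * star
      rw [ell2, e1, ell1, hx1, hp₁, hp₂]
      match_scalars
      · apply mul_left_cancel₀ hα2
        linear_combination (α ^ 2 * D * (e + 1) * α) * hσs + α * (s : ℂ) * (1 + e) * hD - α * hs
          + α * he
      · linear_combination (-(D * α * σ * τ)) * k2
    have hyy' : ell h p₂ α (ell h p₁ α y) = μ₂ • y := by
      have e1 : h (ell h p₁ α y) p₂ = -(α * τ) := by
        rw [ell1, hy1]
        simp only [map_add, map_smul, LinearMap.add_apply, LinearMap.smul_apply, smul_eq_mul, g12,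
          hy2]
        linear_combination (τ : ℂ) * star
      rw [ell2, e1, ell1, hy1, hp₁, hp₂]
      match_scalars
      · ring
      · apply mul_left_cancel₀ hα2
        apply mul_left_cancel₀ he0
        linear_combination α ^ 3 * D * τ ^ 2 * k2 + α ^ 3 * D * (1 + e) * hτs
          + α * (1 - s) * (1 + e) * hD + α * hs - α * hμ₂
    rw [Module.End.mul_apply]
    simp only [map_add, map_smul, hnn, hxx', hyy', hAn, hAx, hAy]
  ext u
  obtain ⟨a, b, γ, rfl⟩ := hh.exists_coeff hn (by rw [hxx]; exact one_ne_zero)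
    (ne_zero_of_self (by rw [hyy]; exact one_ne_zero)) hnx hny hxy u
  exact eA a b γ

end Definite

/-! ### The eigenvectors of a generic product -/

section Eigenvectors

variable {V : Type*} [AddCommGroup V] [Module ℂ V] {h : V →ₗ[ℂ] V →ₗ⋆[ℂ] ℂ}

theorem exists_generic_of_eigen (hh : IsSignature21 h) {A : Module.End ℂ V} {n x y : V}
    {ν μ₁ μ₂ : ℂ} (hn : nrm h n < 0) (hx : x ≠ 0) (hy : y ≠ 0) (hnx : h n x = 0)
    (hny : h n y = 0) (hxy : h x y = 0) (hAn : A n = ν • n) (hAx : A x = μ₁ • x)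
    (hAy : A y = μ₂ • y) (hν : ‖ν‖ = 1) (hμ₁ : ‖μ₁‖ = 1) (hprod : ν * μ₁ * μ₂ = 1)
    (h1 : ν ≠ μ₁) (h2 : ν ≠ μ₂) (h12 : μ₁ ≠ μ₂) :
    ∃ Z : Config V, Z.IsGeneric h ∧ Z.product h = A ∧ Z.α₁ * Z.α₂ = ν := by
  have hH := hh.herm
  have key : ∀ u : V, 0 < nrm h u → ∃ r : ℝ, h ((r : ℂ) • u) ((r : ℂ) • u) = 1 := by
    intro u hu
    refine ⟨(Real.sqrt (nrm h u))⁻¹, ?_⟩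
    rw [hH.self_eq, nrm_smul hH, Complex.normSq_ofReal, ← mul_inv, Real.mul_self_sqrt hu.le,
      inv_mul_cancel₀ hu.ne', Complex.ofReal_one]
  obtain ⟨r, hr⟩ := key x (hh.pos_of_orthogonal hnx hn hx)
  obtain ⟨s, hs⟩ := key y (hh.pos_of_orthogonal hny hn hy)
  refine exists_generic_of_unit_eigen hh (hH.self_ne_zero.mpr hn.ne) hr hs ?_ ?_ ?_ hAn ?_ ?_ hν
    hμ₁ hprod h1 h2 h12
  · rw [LinearMap.map_smulₛₗ, hnx, smul_zero]
  · rw [LinearMap.map_smulₛₗ, hny, smul_zero]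
  · simp only [map_smul, LinearMap.smul_apply, LinearMap.map_smulₛₗ, hxy, smul_zero]
  · rw [map_smul, hAx, smul_comm]
  · rw [map_smul, hAy, smul_comm]

theorem scalarFactor_cube (j : Fin 3) (θ : ℝ) :
    scalarFactor j θ ^ 3 * Complex.exp (θ * Complex.I) = 1 := by
  rw [scalarFactor, mul_pow, ← pow_mul, mul_comm (j : ℕ), pow_mul, omega_pow_three, one_pow,
    one_mul, ← neg_div, exp_cube_eq, ← Complex.exp_add]
  simp

theorem HasAngle.mul_mul_sq {α₁ α₂ : ℂ} {j₁ j₂ : Fin 3} {θ₁ θ₂ : ℝ} (h₁ : HasAngle α₁ j₁ θ₁)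
    (h₂ : HasAngle α₂ j₂ θ₂) :
    α₁ * α₂ * (scalarFactor j₁ θ₁ * scalarFactor j₂ θ₂) ^ 2 = 1 := by
  conv_lhs => rw [h₁.eq_factor, h₂.eq_factor]
  linear_combination (scalarFactor j₂ θ₂ ^ 3 * Complex.exp (θ₂ * Complex.I)) *
    scalarFactor_cube j₁ θ₁ + scalarFactor_cube j₂ θ₂

variable {X : Config V} {j₁ j₂ : Fin 3} {θ₁ θ₂ : ℝ}

/-- The matrix of a generic product on the line of centres, in a basis `p₁, n`. -/
theorem Config.IsGeneric.exists_cyclic (hH : Herm h) (hX : X.IsGeneric h)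
    (ha₁ : HasAngle X.α₁ j₁ θ₁) (ha₂ : HasAngle X.α₂ j₂ θ₂) {H : ℝ}
    (hHt : H = halfTrace θ₁ θ₂ (tance h X.p₁ X.p₂)) :
    ∃ n : V, (∃ a b : ℂ, n = a • X.p₁.rep + b • X.p₂.rep) ∧
      (∀ a b : ℂ, ∃ a' b' : ℂ, a • X.p₁.rep + b • X.p₂.rep = a' • X.p₁.rep + b' • n) ∧
      (∀ η : ℂ, n ≠ η • X.p₁.rep) ∧
      X.product h X.p₁.rep = (scalarFactor j₁ θ₁ * scalarFactor j₂ θ₂) •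
        ((H : ℂ) • X.p₁.rep - Complex.I • n) ∧
      X.product h n = (scalarFactor j₁ θ₁ * scalarFactor j₂ θ₂) •
        ((H : ℂ) • n - (Complex.I * (1 - H ^ 2)) • X.p₁.rep) := by
  have hg := hX.genPair
  set W := line X.p₁ X.p₂ with hW
  set hW' := h.domRestrict₁₂ W W with hhW
  have hHW : Herm hW' := fun x y => hH x y
  have hv₁ : X.p₁.rep ∈ W := mem_line.mpr ⟨1, 0, by simp⟩
  have hv₂ : X.p₂.rep ∈ W := mem_line.mpr ⟨0, 1, by simp⟩
  set v : W := ⟨X.p₁.rep, hv₁⟩ with hv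
  set w : W := ⟨X.p₂.rep, hv₂⟩ with hw
  have hspan : ∀ u : W, ∃ a b : ℂ, u = a • v + b • w := by
    rintro ⟨u, hu⟩
    obtain ⟨a, b, rfl⟩ := mem_line.mp hu
    exact ⟨a, b, rfl⟩
  have hgW : GenPair hW' v w := hg
  have hr := reflPair hHW hgW hspan
  set t := vtance hW' v w with ht
  have htt : t = tance h X.p₁ X.p₂ := rfl
  have hHd : H = Real.cos θ₁ * Real.cos θ₂ - Real.sin θ₁ * Real.sin θ₂ * (2 * t - 1) := by
    rw [hHt, htt, halfTrace]
  set N := axis (refl hW' v) (refl hW' w) (Real.cos θ₁) (Real.sin θ₁) (Real.cos θ₂)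
    (Real.sin θ₂) (2 * t - 1) with hN
  have hNN : N (N v) = ((1 - H ^ 2 : ℝ) : ℂ) • v := by
    rw [hHd]
    exact hr.axis_axis (Real.cos_sq_add_sin_sq _) (Real.cos_sq_add_sin_sq _) v
  have hprod : ∀ u : W, X.product h u = (scalarFactor j₁ θ₁ * scalarFactor j₂ θ₂) •
      (((H : ℂ) • u - Complex.I • N u : W) : V) := by
    intro u
    rw [Config.product_eq, Module.End.mul_apply]
    have h2 := ell_ell_coe (h := h) v w u X.α₁ X.α₂
    rw [ha₁.ell_ell_eq ha₂, rot_rot, ← hN, ← hHd] at h2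
    exact h2.symm
  have hb : ((2 * Real.sin θ₂ / nrm hW' w : ℝ) : ℂ) *
      (Real.cos θ₁ - Complex.I * Real.sin θ₁ : ℂ) ≠ 0 := by
    apply mul_ne_zero
    · have h1 := hHW.self_ne_zero.mp hgW.2.1
      have h2 := ha₂.sin_pos
      exact_mod_cast (by positivity : 2 * Real.sin θ₂ / nrm hW' w ≠ 0)
    · have h1 := exp_eq (-θ₁)
      rw [Real.cos_neg, Real.sin_neg, Complex.ofReal_neg (Real.sin θ₁), mul_neg,
        ← sub_eq_add_neg] at h1
      rw [← h1]
      exact Complex.exp_ne_zero _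
  obtain ⟨hs1, hs2⟩ := vdir_spec hgW hspan hb (n := N v) (a := (_ : ℝ)) (by
    rw [hN, ht, axis_left hHW hgW.1 hgW.2.1, mul_smul])
  refine ⟨N v, mem_line.mp (N v).2, ?_, ?_, ?_, ?_⟩
  · intro a b
    obtain ⟨a', b', e⟩ := hs1 (a • v + b • w)
    exact ⟨a', b', congrArg Subtype.val e⟩
  · intro η he
    exact hs2 η (Subtype.ext he)
  · exact hprod v
  · rw [hprod (N v), hNN, smul_smul]
    push_cast
    rfl

/-- An eigenvector whose eigenvalue is not the polar one is orthogonal to the polar vector, so it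
lies in the plane of centres, where R = ρ(H - iN) has this characteristic polynomial. -/
theorem Config.IsGeneric.eigen_root (hh : IsSignature21 h) (hX : X.IsGeneric h)
    (ha₁ : HasAngle X.α₁ j₁ θ₁) (ha₂ : HasAngle X.α₂ j₂ θ₂) {ρ : ℂ}
    (hρ : ρ = scalarFactor j₁ θ₁ * scalarFactor j₂ θ₂) {H : ℝ}
    (hHt : H = halfTrace θ₁ θ₂ (tance h X.p₁ X.p₂)) {u : V} (hu : u ≠ 0) {μ : ℂ}
    (hμ : X.product h u = μ • u) (hne : μ ≠ X.α₁ * X.α₂) :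
    μ ^ 2 - 2 * H * ρ * μ + ρ ^ 2 = 0 := by
  have hH := hh.herm
  have hg := hX.genPair
  obtain ⟨c, hc⟩ := hg.exists_polar hh
  have hRc := (hX.eigen_iff c).mpr ⟨hc.left, hc.right⟩
  have huc := orthogonal_of_eigen (hX.isometry hH) hμ hRc hne hX.norm_mul_eq_one
  obtain ⟨a, b, γ, e⟩ := hc.span u
  rw [e] at huc
  rw [hc.coeff_eq_zero hH huc, zero_smul, add_zero] at e
  obtain ⟨n, -, h2, h3, h4, h5⟩ := hX.exists_cyclic hH ha₁ ha₂ hHt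
  rw [← hρ] at h4 h5
  obtain ⟨a', b', e'⟩ := h2 a b
  rw [e'] at e
  rw [e, map_add, map_smul, map_smul, h4, h5] at hμ
  have hindep : ∀ a b : ℂ, a • X.p₁.rep + b • n = 0 → a = 0 ∧ b = 0 := by
    intro a b h0
    have hb : b = 0 := by
      by_contra hb
      apply h3 (-(b⁻¹ * a))
      have : b⁻¹ • (a • X.p₁.rep + b • n) = 0 := by rw [h0, smul_zero]
      rw [smul_add, smul_smul, smul_smul, inv_mul_cancel₀ hb, one_smul] at this
      rw [neg_smul]
      exact eq_neg_of_add_eq_zero_right this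
    rw [hb, zero_smul, add_zero] at h0
    exact ⟨(smul_eq_zero.mp h0).resolve_right X.p₁.rep_nonzero, hb⟩
  obtain ⟨k1, k2⟩ := hindep (a' * (ρ * H - μ) - b' * ρ * (Complex.I * (1 - H ^ 2)))
    (b' * (ρ * H - μ) - a' * ρ * Complex.I) (by
      linear_combination (norm := module) hμ)
  have hb' : b' ≠ 0 := by
    rintro rfl
    have hρ0 : ρ ≠ 0 := by
      rw [hρ]
      exact mul_ne_zero (scalarFactor_ne_zero _ _) (scalarFactor_ne_zero _ _)
    apply hu
    have : a' = 0 := by simpa [hρ0] using k2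
    rw [e, this]
    simp
  apply (mul_eq_zero.mp _).resolve_left hb'
  linear_combination (ρ * Complex.I) * k1 + (ρ * H - μ) * k2 -
    (b' * ρ ^ 2 * (H ^ 2 - 1)) * Complex.I_sq

/-- By `axis_gram`, H² ≥ 1 makes t(1 - t) nonpositive, and genericity excludes 0: the line is
hyperbolic. -/
theorem Config.IsGeneric.tance_mul_neg (hH : Herm h) (hX : X.IsGeneric h)
    (ha₂ : HasAngle X.α₂ j₂ θ₂) {H : ℝ}
    (hHt : H = halfTrace θ₁ θ₂ (tance h X.p₁ X.p₂)) (hH1 : 1 ≤ H ^ 2) :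
    tance h X.p₁ X.p₂ * (1 - tance h X.p₁ X.p₂) < 0 := by
  have h1 := @axis_gram θ₁ θ₂ (tance h X.p₁ X.p₂)
  rw [← hHt] at h1
  have h2 := ha₂.sin_pos
  have h3 : tance h X.p₁ X.p₂ ≠ 0 := hX.genPair.vtance_ne_zero hH
  have h4 : tance h X.p₁ X.p₂ ≠ 1 := hX.genPair.vtance_ne_one hH
  have h5 : tance h X.p₁ X.p₂ * (1 - tance h X.p₁ X.p₂) ≠ 0 :=
    mul_ne_zero h3 (sub_ne_zero.mpr h4.symm)
  apply lt_of_le_of_ne _ h5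
  by_contra! hcon
  have : 0 < 4 * Real.sin θ₂ ^ 2 * (tance h X.p₁ X.p₂ * (1 - tance h X.p₁ X.p₂)) := by positivity
  nlinarith [sq_nonneg (Real.sin θ₁ * Real.cos θ₂ + Real.cos θ₁ * Real.sin θ₂ *
    (2 * tance h X.p₁ X.p₂ - 1))]

/-- The polar vector is positive, so a negative fixed point lies on the line of centres and its
eigenvalue is a unit number. Half the trace of R/ρ there is then at most 1 in absolute value, so H²
= 1; the eigenvalue on the line is double, and only two eigenvalues remain. -/
theorem Config.IsGeneric.not_isRegularElliptic (hh : IsSignature21 h) (hX : X.IsGeneric h)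
    (ha₁ : HasAngle X.α₁ j₁ θ₁) (ha₂ : HasAngle X.α₂ j₂ θ₂) {H : ℝ}
    (hHt : H = halfTrace θ₁ θ₂ (tance h X.p₁ X.p₂)) (hH1 : 1 ≤ H ^ 2) :
    ¬ IsRegularElliptic h (X.product h) := by
  have hH := hh.herm
  rintro ⟨⟨x, hxneg, hxfix⟩, μ, hμinj, hμ⟩
  have hg := hX.genPair
  obtain ⟨c, hc⟩ := hg.exists_polar hh
  have hcpos : 0 < nrm h c := hc.sign.mpr (hX.tance_mul_neg hH ha₂ hHt hH1)
  have hneg : nrm h x.rep < 0 := by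
    rw [signature_eq] at hxneg
    exact sign_eq_neg_one_iff.mp hxneg
  obtain ⟨η, hη⟩ := hxfix.exists_eigen
  have hηx := hη x.rep (mem_submodule.mpr ⟨1, one_smul _ _⟩)
  set ρ := scalarFactor j₁ θ₁ * scalarFactor j₂ θ₂ with hρ
  have hρ1 : ‖ρ‖ = 1 := by rw [hρ, norm_mul, norm_scalarFactor, norm_scalarFactor, one_mul]
  clear_value ρ
  have hne : η ≠ X.α₁ * X.α₂ := by
    intro h0
    rw [h0, hX.eigen_iff] at hηx
    obtain ⟨γ, e⟩ := hc.eq_smul hg hηx.1 hηx.2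
    rw [e, nrm_smul hH] at hneg
    have := Complex.normSq_nonneg γ
    nlinarith
  have hroot := hX.eigen_root hh ha₁ ha₂ hρ hHt x.rep_nonzero hηx hne
  have hη1 : ‖η‖ = 1 := by
    have h1 := hX.isometry hH x.rep x.rep
    rw [hηx, hH.self_eq, hH.self_eq, nrm_smul hH] at h1
    have h2 : Complex.normSq η * nrm h x.rep = nrm h x.rep := by exact_mod_cast h1
    have h3 : Complex.normSq η = 1 := mul_right_cancel₀ hneg.ne (by rw [h2, one_mul])
    rw [Complex.normSq_eq_norm_sq] at h3
    exact (pow_eq_one_iff_of_nonneg (norm_nonneg η) two_ne_zero).mp h3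
  have hHsq : (H : ℂ) ^ 2 = 1 := by
    set ζ := conj ρ * η with hζ
    have k1 := mul_conj_eq_one hρ1
    have k2 := mul_conj_eq_one hη1
    have hζ1 : ‖ζ‖ = 1 := by rw [hζ, norm_mul, RCLike.norm_conj, hρ1, hη1, one_mul]
    have h1 : ζ + conj ζ = 2 * H := by
      rw [hζ, map_mul, Complex.conj_conj]
      linear_combination (conj ρ * conj η) * hroot - (conj ρ * η) * k2 +
        (2 * H * η * conj η - ρ * conj η) * k1 + 2 * H * k2
    rw [Complex.add_conj] at h1
    have h2 : ζ.re = H := by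
      have : 2 * ζ.re = 2 * H := by exact_mod_cast h1
      linarith
    have h3 : |ζ.re| ≤ 1 := by
      rw [← hζ1]
      exact Complex.abs_re_le_norm ζ
    rw [h2, ← sq_le_one_iff_abs_le_one] at h3
    exact_mod_cast le_antisymm h3 hH1
  have hall : ∀ i, μ i = X.α₁ * X.α₂ ∨ μ i = ρ * H := by
    intro i
    by_cases hi : μ i = X.α₁ * X.α₂
    · exact Or.inl hi
    · right
      obtain ⟨u, hu⟩ := (hμ i).exists_hasEigenvector
      have h1 := hX.eigen_root hh ha₁ ha₂ hρ hHt hu.2 hu.apply_eq_smul hi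
      have h2 : (μ i - ρ * H) ^ 2 = 0 := by linear_combination h1 + ρ ^ 2 * hHsq
      exact sub_eq_zero.mp (pow_eq_zero_iff two_ne_zero |>.mp h2)
  have d01 : μ 0 ≠ μ 1 := fun e => by simpa using hμinj e
  have d02 : μ 0 ≠ μ 2 := fun e => by simpa using hμinj e
  have d12 : μ 1 ≠ μ 2 := fun e => by simpa using hμinj e
  rcases hall 0 with e0 | e0 <;> rcases hall 1 with e1 | e1 <;> rcases hall 2 with e2 | e2 <;>
    simp_all

/-- A regular elliptic product with a hyperbolic line of centres is also a product whose centres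
span another line. -/
theorem Config.IsGeneric.exists_mul_ne (hh : IsSignature21 h) (hX : X.IsGeneric h)
    (ha₁ : HasAngle X.α₁ j₁ θ₁) (ha₂ : HasAngle X.α₂ j₂ θ₂) {H : ℝ}
    (hHt : H = halfTrace θ₁ θ₂ (tance h X.p₁ X.p₂)) (hH1 : H ^ 2 < 1)
    (ht : tance h X.p₁ X.p₂ * (1 - tance h X.p₁ X.p₂) < 0) :
    ∃ Z : Config V, Z.IsGeneric h ∧ Z.product h = X.product h ∧
      Z.α₁ * Z.α₂ ≠ X.α₁ * X.α₂ := by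
  have hH := hh.herm
  have hg := hX.genPair
  obtain ⟨c, hc⟩ := hg.exists_polar hh
  have hc0 := ne_zero_of_self hc.self_ne
  have hcpos : 0 < nrm h c := hc.sign.mpr ht
  have hRc := (hX.eigen_iff c).mpr ⟨hc.left, hc.right⟩
  obtain ⟨n, ⟨a, b, hn⟩, hspan, h3, h4, h5⟩ := hX.exists_cyclic hH ha₁ ha₂ hHt
  have hlam := ha₁.mul_mul_sq ha₂
  set ρ := scalarFactor j₁ θ₁ * scalarFactor j₂ θ₂ with hρ
  have hρ1 : ‖ρ‖ = 1 := by rw [hρ, norm_mul, norm_scalarFactor, norm_scalarFactor, one_mul]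
  have hρ0 : ρ ≠ 0 := mul_ne_zero (scalarFactor_ne_zero _ _) (scalarFactor_ne_zero _ _)
  obtain ⟨η, hη0, hη⟩ : ∃ η : ℝ, 0 < η ∧ η ^ 2 = 1 - H ^ 2 :=
    ⟨Real.sqrt (1 - H ^ 2), Real.sqrt_pos.mpr (by linarith), Real.sq_sqrt (by linarith)⟩
  have hηC : (η : ℂ) ^ 2 = 1 - (H : ℂ) ^ 2 := by exact_mod_cast hη
  -- With N p₁ = n and N n = η² p₁, the vectors n ± η p₁ are the eigenvectors of N.
  have hev : ∀ ε : ℝ, ε ^ 2 = η ^ 2 → X.product h (n + (ε : ℂ) • X.p₁.rep) =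
      (ρ * (H - Complex.I * ε)) • (n + (ε : ℂ) • X.p₁.rep) := by
    intro ε hε
    have hεC : (ε : ℂ) ^ 2 = 1 - (H : ℂ) ^ 2 := by
      rw [← hηC]
      exact_mod_cast hε
    rw [map_add, map_smul, h4, h5, ← hεC]
    module
  have hnorm : ∀ ε : ℝ, ε ^ 2 = η ^ 2 → ‖ρ * (H - Complex.I * ε)‖ = 1 := by
    intro ε hε
    rw [norm_mul, hρ1, one_mul, ← pow_eq_one_iff_of_nonneg (norm_nonneg _) two_ne_zero,
      ← Complex.normSq_eq_norm_sq, Complex.normSq_apply]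
    simp
    nlinarith
  have hx0 : ∀ ε : ℝ, n + (ε : ℂ) • X.p₁.rep ≠ 0 := by
    intro ε h0
    apply h3 (-(ε : ℂ))
    rw [neg_smul]
    exact eq_neg_of_add_eq_zero_left h0
  have hxc : ∀ ε : ℝ, h (n + (ε : ℂ) • X.p₁.rep) c = 0 := by
    intro ε
    simp only [hn, map_add, map_smul, LinearMap.add_apply, LinearMap.smul_apply, smul_eq_mul,
      hH.eq_zero_comm hc.left, hH.eq_zero_comm hc.right]
    ring
  have hneL : ∀ ε : ℝ, ε ^ 2 = η ^ 2 → ρ * (H - Complex.I * ε) ≠ X.α₁ * X.α₂ := by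
    intro ε hε h0
    have h1 := hev ε hε
    rw [h0, hX.eigen_iff] at h1
    obtain ⟨γ, e⟩ := hc.eq_smul hg h1.1 h1.2
    have h2 := hxc ε
    rw [e, map_smul, LinearMap.smul_apply, smul_eq_mul] at h2
    apply hx0 ε
    rw [e, (mul_eq_zero.mp h2).resolve_right hc.self_ne, zero_smul]
  have key : ∀ ε : ℝ, ε ^ 2 = η ^ 2 → nrm h (n + (ε : ℂ) • X.p₁.rep) < 0 →
      ∃ Z : Config V, Z.IsGeneric h ∧ Z.product h = X.product h ∧
        Z.α₁ * Z.α₂ ≠ X.α₁ * X.α₂ := by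
    intro ε hε hneg
    have hε' : (-ε) ^ 2 = η ^ 2 := by rw [neg_sq, hε]
    have hne : ρ * (H - Complex.I * ε) ≠ ρ * (H - Complex.I * (-ε : ℝ)) := by
      intro h0
      have h1 := mul_left_cancel₀ hρ0 h0
      have h2 := congrArg Complex.im h1
      simp at h2
      have : ε = 0 := by linarith
      rw [this] at hε
      nlinarith
    have hεC : (ε : ℂ) ^ 2 = 1 - (H : ℂ) ^ 2 := by
      rw [← hηC]
      exact_mod_cast hε
    obtain ⟨Z, hZ, hZp, hZm⟩ := exists_generic_of_eigen hh hneg (hx0 (-ε)) hc0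
      (orthogonal_of_eigen (hX.isometry hH) (hev ε hε) (hev (-ε) hε') hne (hnorm _ hε'))
      (hxc ε) (hxc (-ε)) (hev ε hε) (hev (-ε) hε') hRc (hnorm _ hε) (hnorm _ hε') (by
        push_cast
        linear_combination hlam + (X.α₁ * X.α₂ * ρ ^ 2) * hεC -
          (X.α₁ * X.α₂ * ρ ^ 2 * ε ^ 2) * Complex.I_sq) hne (hneL _ hε) (hneL _ hε')
    exact ⟨Z, hZ, hZp, by rw [hZm]; exact hneL _ hε⟩
  have hη' : (-η) ^ 2 = η ^ 2 := neg_sq η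
  have hort : h c (n + ((η : ℝ) : ℂ) • X.p₁.rep) = 0 := hH.eq_zero_comm (hxc η)
  have hort' : h c (n + ((-η : ℝ) : ℂ) • X.p₁.rep) = 0 := hH.eq_zero_comm (hxc (-η))
  have hpm : h (n + ((η : ℝ) : ℂ) • X.p₁.rep) (n + ((-η : ℝ) : ℂ) • X.p₁.rep) = 0 := by
    refine orthogonal_of_eigen (hX.isometry hH) (hev η rfl) (hev (-η) hη') ?_ (hnorm _ hη')
    intro h0
    have h1 := mul_left_cancel₀ hρ0 h0
    have h2 := congrArg Complex.im h1
    simp at h2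
    linarith
  by_cases hp : nrm h (n + ((η : ℝ) : ℂ) • X.p₁.rep) < 0
  · exact key η rfl hp
  · by_cases hm : nrm h (n + ((-η : ℝ) : ℂ) • X.p₁.rep) < 0
    · exact key (-η) hη' hm
    · exfalso
      -- An isotropic n + η p₁ would be orthogonal to the whole plane. So the frame with c is
      -- orthogonal, and one of the two eigenvectors must be negative, c being positive.
      have hA : h (n + ((η : ℝ) : ℂ) • X.p₁.rep) (n + ((η : ℝ) : ℂ) • X.p₁.rep) ≠ 0 := by
        intro h0
        apply hx0 η
        have h1 : h (n + ((η : ℝ) : ℂ) • X.p₁.rep) X.p₁.rep = 0 := by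
          have e : X.p₁.rep = ((2 * η : ℝ) : ℂ)⁻¹ • ((n + ((η : ℝ) : ℂ) • X.p₁.rep)
              - (n + ((-η : ℝ) : ℂ) • X.p₁.rep)) := by
            have h2η : ((2 * η : ℝ) : ℂ) ≠ 0 := by exact_mod_cast (by positivity : 2 * η ≠ 0)
            rw [eq_inv_smul_iff₀ h2η]
            push_cast
            module
          have h2 := congrArg (h (n + ((η : ℝ) : ℂ) • X.p₁.rep)) e
          rwa [LinearMap.map_smulₛₗ, map_sub, h0, hpm, sub_zero, smul_zero] at h2
        have h2 : h (n + ((η : ℝ) : ℂ) • X.p₁.rep) n = 0 := by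
          have h2 := h0
          rwa [map_add (h _), LinearMap.map_smulₛₗ, h1, smul_zero, add_zero] at h2
        obtain ⟨a', b', e⟩ := hspan 0 1
        have h6 : h (n + ((η : ℝ) : ℂ) • X.p₁.rep) X.p₂.rep = 0 := by
          rw [zero_smul, zero_add, one_smul] at e
          rw [e, map_add, LinearMap.map_smulₛₗ, LinearMap.map_smulₛₗ, h1, h2, smul_zero, smul_zero,
            add_zero]
        obtain ⟨γ, e⟩ := hc.eq_smul hg h1 h6
        have h7 := hxc η
        rw [e, map_smul, LinearMap.smul_apply, smul_eq_mul] at h7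
        rw [e, (mul_eq_zero.mp h7).resolve_right hc.self_ne, zero_smul]
      rcases hh.exists_neg_of_orthogonal hc.self_ne hA (hx0 (-η)) hort hort' hpm with h1 | h1 | h1
      · linarith
      · exact hp h1
      · exact hm h1

end Eigenvectors

/-! ### Relations between products with the same line of centres -/

section Angles

theorem eq_of_exp_eq {x y : ℝ} (he : Complex.exp (x * Complex.I) = Complex.exp (y * Complex.I))
    (hlt : |x - y| < 2 * Real.pi) : x = y := by
  obtain ⟨n, hn⟩ := Complex.exp_eq_exp_iff_exists_int.mp he
  have h1 : x = y + n * (2 * Real.pi) := by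
    have h2 : ((x : ℂ)) * Complex.I = ((y + n * (2 * Real.pi) : ℝ) : ℂ) * Complex.I := by
      rw [hn]
      push_cast
      ring
    exact_mod_cast mul_right_cancel₀ Complex.I_ne_zero h2
  have hpi := Real.pi_pos
  have h3 : |(n : ℝ)| < 1 := by
    rw [h1, add_sub_cancel_left, abs_mul, abs_of_pos (by positivity : 0 < 2 * Real.pi)] at hlt
    exact (mul_lt_iff_lt_one_left (by positivity)).mp hlt
  have h4 : n = 0 := by
    rw [← Int.abs_lt_one_iff]
    exact_mod_cast h3
  rw [h1, h4]
  simp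

theorem HasAngle.angle_unique {α β : ℂ} {i j : Fin 3} {θ φ : ℝ} (hα : HasAngle α i θ)
    (hβ : HasAngle β j φ) (hc : α ^ 3 = β ^ 3) : θ = φ := by
  rw [hα.cube, hβ.cube] at hc
  have h1 := eq_of_exp_eq hc (by
    rw [abs_lt]
    constructor <;> linarith [hα.pos, hα.lt_pi, hβ.pos, hβ.lt_pi])
  linarith

theorem HasAngle.of_mem_arc {α : ℂ} {i j : Fin 3} {θ : ℝ} (hα : HasAngle α i θ) {β : ℂ}
    (hβ : β ∈ arc j) (hc : α ^ 3 = β ^ 3) : HasAngle β j θ := by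
  obtain ⟨φ, h0, h1, h2⟩ := hβ
  have h3 : HasAngle β j (3 * φ / 2) := by
    refine ⟨by linarith, by linarith, ?_⟩
    rw [h2]
    congr 4
    ring
  rwa [hα.angle_unique h3 hc]

theorem mul_exp_mul_mul_exp (a b : ℂ) (x y : ℝ) :
    a * Complex.exp (x * Complex.I) * (b * Complex.exp (y * Complex.I))
      = a * b * Complex.exp ((x + y : ℝ) * Complex.I) := by
  rw [mul_mul_mul_comm, ← Complex.exp_add, ← add_mul, Complex.ofReal_add]

/-- Two pairs of parameters with the same product have, up to a half turn, the same total angle. -/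
theorem HasAngle.add_eq_or {α₁ α₂ β₁ β₂ : ℂ} {j₁ j₂ i₁ i₂ : Fin 3} {θ₁ θ₂ φ₁ φ₂ : ℝ}
    (ha₁ : HasAngle α₁ j₁ θ₁) (ha₂ : HasAngle α₂ j₂ θ₂) (hb₁ : HasAngle β₁ i₁ φ₁)
    (hb₂ : HasAngle β₂ i₂ φ₂) (hm : α₁ * α₂ = β₁ * β₂) :
    θ₁ + θ₂ = φ₁ + φ₂ ∨ θ₁ + θ₂ = φ₁ + φ₂ + Real.pi ∨ φ₁ + φ₂ = θ₁ + θ₂ + Real.pi := by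
  have hpi := Real.pi_pos
  have b1 := ha₁.pos
  have b2 := ha₁.lt_pi
  have b3 := ha₂.pos
  have b4 := ha₂.lt_pi
  have b5 := hb₁.pos
  have b6 := hb₁.lt_pi
  have b7 := hb₂.pos
  have b8 := hb₂.lt_pi
  have h1 : Complex.exp ((2 * (θ₁ + θ₂) : ℝ) * Complex.I)
      = Complex.exp ((2 * (φ₁ + φ₂) : ℝ) * Complex.I) := by
    have h2 := congrArg (· ^ 3) hm
    simp only [mul_pow, ha₁.cube, ha₂.cube, hb₁.cube, hb₂.cube, ← Complex.exp_add] at h2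
    rw [mul_add, mul_add, Complex.ofReal_add, Complex.ofReal_add, add_mul, add_mul, h2]
  obtain ⟨n, hn⟩ := Complex.exp_eq_exp_iff_exists_int.mp h1
  have h3 : θ₁ + θ₂ = φ₁ + φ₂ + n * Real.pi := by
    have h2 : ((2 * (θ₁ + θ₂) : ℝ) : ℂ) * Complex.I
        = ((2 * (φ₁ + φ₂ + n * Real.pi) : ℝ) : ℂ) * Complex.I := by
      rw [hn]
      push_cast
      ring
    have h4 : 2 * (θ₁ + θ₂) = 2 * (φ₁ + φ₂ + n * Real.pi) := by
      exact_mod_cast mul_right_cancel₀ Complex.I_ne_zero h2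
    linarith
  -- Both sums lie strictly between 0 and 2π, so they differ by less than 2π.
  have h5 : (n : ℝ) < 2 := by
    by_contra! hcon
    nlinarith
  have h6 : (-2 : ℝ) < n := by
    by_contra! hcon
    nlinarith
  have h7 : n < 2 := by exact_mod_cast h5
  have h8 : -2 < n := by exact_mod_cast h6
  obtain rfl | rfl | rfl : n = 0 ∨ n = 1 ∨ n = -1 := by omega
  · left
    simpa using h3
  · right; left
    simpa using h3
  · right; right
    push_cast at h3
    linarith

theorem halfTrace_eq (θ₁ θ₂ t : ℝ) : halfTrace θ₁ θ₂ t =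
    Real.cos (θ₁ + θ₂) + 2 * (Real.sin θ₁ * Real.sin θ₂) * (1 - t) := by
  rw [halfTrace, Real.cos_add]
  ring

theorem halfTrace_comm (θ₁ θ₂ t : ℝ) : halfTrace θ₁ θ₂ t = halfTrace θ₂ θ₁ t := by
  rw [halfTrace, halfTrace]
  ring

/-- Goldman's discriminant of the trace of a product. -/
theorem deltoid_traceLine {α₁ α₂ : ℂ} {j₁ j₂ : Fin 3} {θ₁ θ₂ : ℝ} (ha₁ : HasAngle α₁ j₁ θ₁)
    (ha₂ : HasAngle α₂ j₂ θ₂) (t : ℝ) : deltoid (traceLine α₁ α₂ t) =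
      16 * (halfTrace θ₁ θ₂ t ^ 2 - 1) * (halfTrace θ₁ θ₂ t - Real.cos (θ₁ + θ₂)) ^ 2 := by
  have h1 := traceLine_eq ha₁ ha₂ t
  have h2 := ha₁.mul_mul_sq ha₂
  rw [ha₁.mul_eq ha₂] at h1 h2
  have hρ1 : ‖scalarFactor j₁ θ₁ * scalarFactor j₂ θ₂‖ = 1 := by
    rw [norm_mul, norm_scalarFactor, norm_scalarFactor, one_mul]
  rw [exp_eq] at h1 h2
  generalize scalarFactor j₁ θ₁ * scalarFactor j₂ θ₂ = ρ at *
  generalize halfTrace θ₁ θ₂ t = H at *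
  have hcs := Real.sin_sq_add_cos_sq (θ₁ + θ₂)
  generalize Real.cos (θ₁ + θ₂) = C at *
  generalize Real.sin (θ₁ + θ₂) = S at *
  have hcsC : (S : ℂ) ^ 2 + (C : ℂ) ^ 2 = 1 := by exact_mod_cast hcs
  have hz : traceLine α₁ α₂ t = ρ * ((C + 2 * H : ℝ) + Complex.I * (S : ℝ)) := by
    rw [h1]
    push_cast
    ring
  have hn : ‖traceLine α₁ α₂ t‖ ^ 2 = 1 + 4 * H * C + 4 * H ^ 2 := by
    rw [hz, norm_mul, hρ1, one_mul, ← Complex.normSq_eq_norm_sq, Complex.normSq_apply]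
    simp
    linear_combination hcs
  -- The determinant relation α₁α₂ρ² = 1 reads ρ³e^{iS} = 1 with S the sum of the angles, and the
  -- trace is ρ(e^{iS} + 2H).
  have hρ3 : ρ ^ 3 = C - Complex.I * S := by
    linear_combination (C - Complex.I * S : ℂ) * h2 - ρ ^ 3 * hcsC
      + ρ ^ 3 * S ^ 2 * Complex.I_sq
  have hcube : traceLine α₁ α₂ t ^ 3 =
      ((2 * C ^ 2 - 1 + 6 * H * C + 12 * H ^ 2 + 8 * H ^ 3 * C : ℝ) : ℂ) +
        ((2 * S * C + 6 * H * S - 8 * H ^ 3 * S : ℝ) : ℂ) * Complex.I := by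
    rw [hz, mul_pow, hρ3]
    push_cast
    have k1 : (C - Complex.I * S : ℂ) * (C + Complex.I * S) = 1 := by
      linear_combination hcsC - S ^ 2 * Complex.I_sq
    have k2 : (C + Complex.I * S : ℂ) ^ 2 = 2 * C ^ 2 - 1 + 2 * S * C * Complex.I := by
      linear_combination -hcsC + S ^ 2 * Complex.I_sq
    linear_combination ((C + Complex.I * S : ℂ) ^ 2 + 6 * H * (C + Complex.I * S) + 12 * H ^ 2) * k1
      + k2
  have hre : (traceLine α₁ α₂ t ^ 3).re =
      2 * C ^ 2 - 1 + 6 * H * C + 12 * H ^ 2 + 8 * H ^ 3 * C := by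
    rw [hcube]
    simp only [Complex.add_re, Complex.re_ofReal_mul, Complex.ofReal_re, Complex.I_re, mul_zero,
      add_zero]
  rw [deltoid, hre, show ‖traceLine α₁ α₂ t‖ ^ 4 = (‖traceLine α₁ α₂ t‖ ^ 2) ^ 2 by ring, hn]
  ring

end Angles

/-! ### Chains for a common line of centres, and the final dichotomy -/

section SameLine

variable {V : Type*} [AddCommGroup V] [Module ℂ V] {h : V →ₗ[ℂ] V →ₗ⋆[ℂ] ℂ}
variable {X Y : Config V}

theorem Config.IsGeneric.tance_mul_ne_zero (hH : Herm h) (hX : X.IsGeneric h) :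
    tance h X.p₁ X.p₂ * (1 - tance h X.p₁ X.p₂) ≠ 0 :=
  mul_ne_zero (hX.genPair.vtance_ne_zero hH) (sub_ne_zero.mpr (hX.genPair.vtance_ne_one hH).symm)

/-- Equal polar eigenvalues give proportional polar vectors, and their sign decides whether the line
is hyperbolic. -/
theorem tance_mul_neg_iff (hh : IsSignature21 h) (hX : X.IsGeneric h) (hY : Y.IsGeneric h)
    (hp : X.product h = Y.product h) (hm : X.α₁ * X.α₂ = Y.α₁ * Y.α₂) :
    tance h X.p₁ X.p₂ * (1 - tance h X.p₁ X.p₂) < 0 ↔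
      tance h Y.p₁ Y.p₂ * (1 - tance h Y.p₁ Y.p₂) < 0 := by
  obtain ⟨c, hc⟩ := hX.genPair.exists_polar hh
  obtain ⟨d, hd⟩ := hY.genPair.exists_polar hh
  have hRc := (hX.eigen_iff c).mpr ⟨hc.left, hc.right⟩
  rw [hp, hm, hY.eigen_iff] at hRc
  obtain ⟨γ, rfl⟩ := hd.eq_smul hY.genPair hRc.1 hRc.2
  have hγ : γ ≠ 0 := by
    rintro rfl
    apply hc.self_ne
    simp
  have h1 := hc.sign
  rw [nrm_smul hh.herm, mul_pos_iff_of_pos_left (Complex.normSq_pos.mpr hγ), hd.sign] at h1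
  exact h1.symm

theorem Config.IsGeneric.signature_eq_one (hh : IsSignature21 h) (hX : X.IsGeneric h)
    (ht : 0 < tance h X.p₁ X.p₂ * (1 - tance h X.p₁ X.p₂)) : signature h X.p₁ = 1 := by
  obtain ⟨c, hc⟩ := hX.genPair.exists_polar hh
  have h1 : ¬ 0 < nrm h c := fun h0 => absurd (hc.sign.mp h0) (not_lt.mpr ht.le)
  have h2 := hh.herm.self_ne_zero.mp hc.self_ne
  rw [signature_eq]
  exact sign_pos (hc.pos (lt_of_le_of_ne (not_lt.mp h1) h2)).1

theorem Config.IsGeneric.signature_mul_eq (hX : X.IsGeneric h) :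
    signature h X.p₁ * signature h X.p₂ = SignType.sign (tance h X.p₁ X.p₂) := by
  have h1 : 0 < Complex.normSq (h X.p₁.rep X.p₂.rep) := Complex.normSq_pos.mpr hX.genPair.2.2.1
  rw [signature_eq, signature_eq, ← sign_mul]
  change _ = SignType.sign (_ / (nrm h X.p₁.rep * nrm h X.p₂.rep))
  rcases lt_trichotomy (nrm h X.p₁.rep * nrm h X.p₂.rep) 0 with hr | hr | hr
  · rw [sign_neg hr, sign_neg (div_neg_of_pos_of_neg h1 hr)]
  · rw [hr, div_zero]
  · rw [sign_pos hr, sign_pos (div_pos h1 hr)]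

theorem traces_eq (hh : IsSignature21 h) (hX : X.IsGeneric h) (hY : Y.IsGeneric h)
    (hp : X.product h = Y.product h) :
    traceLine X.α₁ X.α₂ (tance h X.p₁ X.p₂) = traceLine Y.α₁ Y.α₂ (tance h Y.p₁ Y.p₂) := by
  rw [← hX.trace hh, ← hY.trace hh, hp]

theorem signType_eq_neg : ∀ a b c d : SignType, a ≠ 0 → b ≠ 0 → c ≠ 0 → a * b = c * d → a ≠ c →
    a = -c ∧ b = -d := by
  intro a b c d
  cases a <;> cases b <;> cases c <;> cases d <;> decide

/-- Products with the same parameters are related by a bending or a change of signs. -/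
theorem basicRelation_of_parameters_eq (hh : IsSignature21 h) (hX : X.IsGeneric h)
    (hY : Y.IsGeneric h) (hp : X.product h = Y.product h) (h₁ : Y.α₁ = X.α₁) (h₂ : Y.α₂ = X.α₂)
    (hcase : signature h Y.p₁ = signature h X.p₁ ∨ ¬ IsRegularElliptic h (X.product h)) :
    BasicRelation h X Y := by
  have hH := hh.herm
  refine ⟨hX, hY, hp, ?_⟩
  by_cases hs : signature h Y.p₁ = signature h X.p₁
  · exact Or.inl (isBending_of_signature_eq hh hX hY hp h₁ h₂ hs)
  · have ht : tance h X.p₁ X.p₂ = tance h Y.p₁ Y.p₂ := by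
      have := traces_eq hh hX hY hp
      rw [h₁, h₂] at this
      exact traceLine_injective hX.2.1 hX.2.2 this
    have hne : ∀ p : ℙ ℂ V, h p.rep p.rep ≠ 0 → signature h p ≠ 0 := fun p hp => by
      rw [signature_eq, Ne, sign_eq_zero_iff]
      exact hH.self_ne_zero.mp hp
    have n1 := hne _ hX.genPair.1
    have n2 := hne _ hX.genPair.2.1
    have n3 := hne _ hY.genPair.1
    have e : signature h X.p₁ * signature h X.p₂ = signature h Y.p₁ * signature h Y.p₂ := by
      rw [hX.signature_mul_eq, hY.signature_mul_eq, ht]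
    obtain ⟨k1, k2⟩ := signType_eq_neg _ _ _ _ n1 n2 n3 e (Ne.symm hs)
    exact Or.inr (Or.inr (Or.inr (Or.inr (Or.inl ⟨h₁, h₂, k1, k2, ht, hcase.resolve_left hs⟩))))

variable {j₁ j₂ i₁ i₂ : Fin 3} {θ₁ θ₂ φ₁ φ₂ : ℝ}

/-- A single f-bending reaches the parameters of Y, followed by a bending or a simultaneous change
of signs. On a definite line all centres are positive, so a bending suffices; if H² ≥ 1, the product
is not regular elliptic and the change of signs is available. -/
theorem followsFromBasic_of_sameComponent (hh : IsSignature21 h) (hX : X.IsGeneric h)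
    (hY : Y.IsGeneric h) (hp : X.product h = Y.product h) (ha₁ : HasAngle X.α₁ j₁ θ₁)
    (ha₂ : HasAngle X.α₂ j₂ θ₂) (hb₁ : HasAngle Y.α₁ j₁ φ₁) (hb₂ : HasAngle Y.α₂ j₂ φ₂)
    (hS : θ₁ + θ₂ = φ₁ + φ₂) {H : ℝ} (hHX : H = halfTrace θ₁ θ₂ (tance h X.p₁ X.p₂))
    (hHY : H = halfTrace φ₁ φ₂ (tance h Y.p₁ Y.p₂))
    (hcase : 0 < tance h X.p₁ X.p₂ * (1 - tance h X.p₁ X.p₂) ∨ 1 ≤ H ^ 2)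
    (hnull : H ^ 2 = 1 → 0 < (Real.cos θ₂ - H * Real.cos θ₁) * (Real.cos φ₂ - H * Real.cos φ₁)) :
    FollowsFromBasic h X Y := by
  have hH := hh.herm
  have hm : X.α₁ * X.α₂ = Y.α₁ * Y.α₂ := by
    rw [ha₁.mul_eq ha₂, hb₁.mul_eq hb₂, hS, scalarFactor_mul j₁ j₂ hS]
  have hiff := tance_mul_neg_iff hh hX hY hp hm
  have nX := hX.tance_mul_ne_zero hH
  have nY := hY.tance_mul_ne_zero hH
  have hpos : 0 < (tance h X.p₁ X.p₂ * (1 - tance h X.p₁ X.p₂)) *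
      (tance h Y.p₁ Y.p₂ * (1 - tance h Y.p₁ Y.p₂)) := by
    rcases lt_or_gt_of_ne nX with h1 | h1
    · exact mul_pos_of_neg_of_neg h1 (hiff.mp h1)
    · refine mul_pos h1 (lt_of_le_of_ne ?_ nY.symm)
      by_contra! hcon
      exact absurd (hiff.mpr hcon) (not_lt.mpr h1.le)
  obtain ⟨Z, hZ, hZp, hZ₁, hZ₂, hs₁, -, hfb⟩ := exists_fBending hh hX ha₁ ha₂ hb₁ hb₂ hS rfl
    (t' := tance h Y.p₁ Y.p₂) (by rw [← hHX, ← hHY]) hpos (by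
      rw [← hHX]
      rcases hcase with h1 | h1
      · exact Or.inr h1
      · exact Or.inl (by linarith)) (by
      rw [← hHX]
      intro h0
      exact hnull (by linarith))
  refine Relation.EqvGen.trans _ Z _ (Relation.EqvGen.rel _ _ ⟨hX, hZ, hZp, Or.inr (Or.inl hfb)⟩)
    (Relation.EqvGen.rel _ _ ?_)
  refine basicRelation_of_parameters_eq hh hZ hY (hZp.symm.trans hp) hZ₁.symm hZ₂.symm ?_
  rcases hcase with h1 | h1
  · left
    rw [hs₁, hX.signature_eq_one hh h1, hY.signature_eq_one hh]
    exact (pos_iff_pos_of_mul_pos hpos).mp h1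
  · right
    rw [← hZp]
    exact hX.not_isRegularElliptic hh ha₁ ha₂ hHX h1

theorem followsFromBasic_of_sum_eq (hh : IsSignature21 h) (hX : X.IsGeneric h)
    (hY : Y.IsGeneric h) (hp : X.product h = Y.product h) (hm : X.α₁ * X.α₂ = Y.α₁ * Y.α₂)
    (ha₁ : HasAngle X.α₁ j₁ θ₁)
    (ha₂ : HasAngle X.α₂ j₂ θ₂) (hb₁ : HasAngle Y.α₁ i₁ φ₁) (hb₂ : HasAngle Y.α₂ i₂ φ₂)
    (hS : θ₁ + θ₂ = φ₁ + φ₂) {H : ℝ} (hHX : H = halfTrace θ₁ θ₂ (tance h X.p₁ X.p₂))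
    (hHY : H = halfTrace φ₁ φ₂ (tance h Y.p₁ Y.p₂))
    (hcase : 0 < tance h X.p₁ X.p₂ * (1 - tance h X.p₁ X.p₂) ∨ 1 ≤ H ^ 2)
    (hnull : H ^ 2 = 1 → 0 < (Real.cos θ₂ - H * Real.cos θ₁) * (Real.cos φ₂ - H * Real.cos φ₁)) :
    FollowsFromBasic h X Y := by
  -- Modulo 3 the exponent is i₁ - j₁, which moves the first parameter to the arc of its target. The
  -- second parameter follows because the products and the sums of angles agree.
  obtain ⟨h1, h2⟩ := followsFromBasic_changeOfComponents hX ((i₁ : ℕ) + 2 * (j₁ : ℕ))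
  have hω := omega_pow_three
  have hω0 := omega_ne_zero
  have e1 : omega ^ ((i₁ : ℕ) + 2 * (j₁ : ℕ)) * X.α₁ =
      omega ^ (i₁ : ℕ) * Complex.exp ((2 * θ₁ / 3 : ℝ) * Complex.I) := by
    rw [ha₁.eq, ← mul_assoc, ← pow_add, add_assoc, ← Nat.succ_mul, pow_add, pow_mul, hω, one_pow,
      mul_one]
  have e2 : (omega ^ ((i₁ : ℕ) + 2 * (j₁ : ℕ)))⁻¹ * X.α₂ =
      omega ^ (i₂ : ℕ) * Complex.exp ((2 * θ₂ / 3 : ℝ) * Complex.I) := by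
    apply mul_left_cancel₀ h2.2.1.ne_zero
    have e3 : omega ^ ((i₁ : ℕ) + 2 * (j₁ : ℕ)) * X.α₁ *
        ((omega ^ ((i₁ : ℕ) + 2 * (j₁ : ℕ)))⁻¹ * X.α₂) = X.α₁ * X.α₂ := by
      have := pow_ne_zero ((i₁ : ℕ) + 2 * (j₁ : ℕ)) hω0
      field_simp
    change omega ^ ((i₁ : ℕ) + 2 * (j₁ : ℕ)) * X.α₁ * _ = omega ^ ((i₁ : ℕ) + 2 * (j₁ : ℕ)) * X.α₁ * _
    rw [e3, hm, e1, hb₁.eq, hb₂.eq, mul_exp_mul_mul_exp, mul_exp_mul_mul_exp, ← add_div, ← add_div,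
      ← mul_add, ← mul_add, hS]
  refine Relation.EqvGen.trans _ _ _ h1 (followsFromBasic_of_sameComponent hh h2 hY
    (h1.product_eq.symm.trans hp) ⟨ha₁.pos, ha₁.lt_pi, e1⟩ ⟨ha₂.pos, ha₂.lt_pi, e2⟩ hb₁ hb₂ hS hHX
    hHY hcase hnull)

theorem Config.IsGeneric.pairing_ne_zero (hH : Herm h) (hX : X.IsGeneric h)
    (ha₁ : HasAngle X.α₁ j₁ θ₁) (ha₂ : HasAngle X.α₂ j₂ θ₂) {H : ℝ}
    (hHX : H = halfTrace θ₁ θ₂ (tance h X.p₁ X.p₂)) (h1 : H ^ 2 = 1) :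
    Real.cos θ₂ - H * Real.cos θ₁ ≠ 0 := by
  have h2 := hX.tance_mul_neg hH ha₂ hHX h1.ge
  have h3 := @axis_gram θ₁ θ₂ (tance h X.p₁ X.p₂)
  have h4 := @axis_pairing θ₁ θ₂ (tance h X.p₁ X.p₂)
  rw [← hHX] at h3 h4
  rw [← h4]
  refine mul_ne_zero ha₁.sin_pos.ne' fun h0 => ?_
  rw [h0, h1] at h3
  have h5 : Real.sin θ₂ ^ 2 * (tance h X.p₁ X.p₂ * (1 - tance h X.p₁ X.p₂)) = 0 := by linarith
  exact mul_ne_zero (pow_ne_zero 2 ha₂.sin_pos.ne') h2.ne h5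

/-- The sum of cosines is 2 cos of the half sum times cos of the half difference, and the latter is
positive; so its sign depends only on the sum. This settles the parabolic case H = -1. -/
theorem cos_add_cos_mul_nonneg (h1 : |θ₁ - θ₂| < Real.pi) (h2 : |φ₁ - φ₂| < Real.pi)
    (hS : θ₁ + θ₂ = φ₁ + φ₂) :
    0 ≤ (Real.cos θ₁ + Real.cos θ₂) * (Real.cos φ₁ + Real.cos φ₂) := by
  rw [Real.cos_add_cos, Real.cos_add_cos, hS]
  rw [abs_lt] at h1 h2
  have k1 : 0 < Real.cos ((θ₁ - θ₂) / 2) :=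
    Real.cos_pos_of_mem_Ioo ⟨by linarith [h1.1], by linarith [h1.2]⟩
  have k2 : 0 < Real.cos ((φ₁ - φ₂) / 2) :=
    Real.cos_pos_of_mem_Ioo ⟨by linarith [h2.1], by linarith [h2.2]⟩
  have k3 := mul_self_nonneg (Real.cos ((φ₁ + φ₂) / 2))
  have : 0 ≤ 4 * (Real.cos ((φ₁ + φ₂) / 2) * Real.cos ((φ₁ + φ₂) / 2)) *
    (Real.cos ((θ₁ - θ₂) / 2) * Real.cos ((φ₁ - φ₂) / 2)) := by positivity
  linarith

theorem HasAngle.abs_sub_lt {α β : ℂ} (hα : HasAngle α j₁ θ₁) (hβ : HasAngle β j₂ θ₂) :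
    |θ₁ - θ₂| < Real.pi := by
  rw [abs_lt]
  constructor <;> linarith [hα.pos, hα.lt_pi, hβ.pos, hβ.lt_pi]

/-- What remains is the parabolic case where the sign condition fails. It can fail only for H = 1,
where the sign is that of cos θ₂ - cos θ₁; a change of orientation swaps the angles and reverses it.
-/
theorem followsFromBasic_of_sum_eq' (hh : IsSignature21 h) (hX : X.IsGeneric h)
    (hY : Y.IsGeneric h) (hp : X.product h = Y.product h) (hm : X.α₁ * X.α₂ = Y.α₁ * Y.α₂)
    (ha₁ : HasAngle X.α₁ j₁ θ₁)
    (ha₂ : HasAngle X.α₂ j₂ θ₂) (hb₁ : HasAngle Y.α₁ i₁ φ₁) (hb₂ : HasAngle Y.α₂ i₂ φ₂)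
    (hS : θ₁ + θ₂ = φ₁ + φ₂) {H : ℝ} (hHX : H = halfTrace θ₁ θ₂ (tance h X.p₁ X.p₂))
    (hHY : H = halfTrace φ₁ φ₂ (tance h Y.p₁ Y.p₂))
    (hcase : 0 < tance h X.p₁ X.p₂ * (1 - tance h X.p₁ X.p₂) ∨ 1 ≤ H ^ 2) :
    FollowsFromBasic h X Y := by
  have hH := hh.herm
  by_cases hnull : H ^ 2 = 1 →
      0 < (Real.cos θ₂ - H * Real.cos θ₁) * (Real.cos φ₂ - H * Real.cos φ₁)
  · exact followsFromBasic_of_sum_eq hh hX hY hp hm ha₁ ha₂ hb₁ hb₂ hS hHX hHY hcase hnull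
  · push Not at hnull
    obtain ⟨hH1, hneg⟩ := hnull
    have nX := hX.pairing_ne_zero hH ha₁ ha₂ hHX hH1
    have nY := hY.pairing_ne_zero hH hb₁ hb₂ hHY hH1
    have hneg' := lt_of_le_of_ne hneg (mul_ne_zero nX nY)
    have hH2 : H = 1 := by
      refine (mul_self_eq_one_iff.mp (by rwa [← sq])).resolve_right ?_
      rintro rfl
      have := cos_add_cos_mul_nonneg (ha₁.abs_sub_lt ha₂) (hb₁.abs_sub_lt hb₂) hS
      linarith
    obtain ⟨Z, hXZ, hZ₁, hZ₂, hZt⟩ := exists_changeOfOrientation hH hX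
    refine Relation.EqvGen.trans _ Z _ (Relation.EqvGen.rel _ _ hXZ)
      (followsFromBasic_of_sum_eq hh hXZ.generic_right hY (hXZ.product_eq.symm.trans hp) ?_
        (by rwa [hZ₁]) (by rwa [hZ₂]) hb₁ hb₂ (by rw [add_comm, hS])
        (by rw [hZt, ← halfTrace_comm, hHX]) hHY (Or.inr hH1.ge) fun _ => ?_)
    · rw [hZ₁, hZ₂, mul_comm, hm]
    · rw [hH2] at hneg' ⊢
      linarith

theorem followsFromBasic_of_mul_ne (hh : IsSignature21 h) (hX : X.IsGeneric h)
    (hY : Y.IsGeneric h) (hp : X.product h = Y.product h) {Z : Config V} (hZ : Z.IsGeneric h)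
    (hZp : Z.product h = X.product h) (h1 : Z.α₁ * Z.α₂ ≠ X.α₁ * X.α₂)
    (h2 : Z.α₁ * Z.α₂ ≠ Y.α₁ * Y.α₂) : FollowsFromBasic h X Y :=
  Relation.EqvGen.trans _ Z _
    (Relation.EqvGen.rel _ _ (basicRelation_of_mul_ne hh hX hZ hZp.symm h1.symm))
    (Relation.EqvGen.rel _ _ (basicRelation_of_mul_ne hh hZ hY (hZp.trans hp) h2))

/-- A cube root matching the components would force equal sums of angles, since the products of
parameters are equal and the sums differ by less than 2π. The deltoid condition is H² ≥ 1 by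
`deltoid_traceLine`. -/
theorem isSingleChangeOfSign (hh : IsSignature21 h) (hX : X.IsGeneric h)
    (hY : Y.IsGeneric h) (hp : X.product h = Y.product h) (hm : X.α₁ * X.α₂ = Y.α₁ * Y.α₂)
    (ha₁ : HasAngle X.α₁ j₁ θ₁) (ha₂ : HasAngle X.α₂ j₂ θ₂) (hb₁ : HasAngle Y.α₁ i₁ φ₁)
    (hb₂ : HasAngle Y.α₂ i₂ φ₂) (hS : θ₁ + θ₂ ≠ φ₁ + φ₂)
    (hH1 : 1 ≤ halfTrace θ₁ θ₂ (tance h X.p₁ X.p₂) ^ 2) (hX1 : 1 < tance h X.p₁ X.p₂)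
    (hY0 : tance h Y.p₁ Y.p₂ < 0) : IsSingleChangeOfSign h X Y := by
  refine ⟨hm, ?_, hX1, hY0, traces_eq hh hX hY hp, ?_⟩
  · rintro ⟨δ, hδ, ⟨j, h1, h2⟩, ⟨k, h3, h4⟩⟩
    have hδ3 : δ ^ 3 = 1 := hδ
    have hδ0 : δ ≠ 0 := by
      rintro rfl
      simp at hδ3
    have k1 := ha₁.of_mem_arc h1 (by rw [mul_pow, hδ3, one_mul])
    have k2 := hb₁.of_mem_arc h2 rfl
    have k3 := ha₂.of_mem_arc h3 (by rw [mul_pow, inv_pow, hδ3, inv_one, one_mul])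
    have k4 := hb₂.of_mem_arc h4 rfl
    apply hS
    have k5 : δ * X.α₁ * (δ⁻¹ * X.α₂) = Y.α₁ * Y.α₂ := by
      rw [← hm]
      field_simp
    rw [k1.eq, k2.eq, k3.eq, k4.eq, mul_exp_mul_mul_exp, mul_exp_mul_mul_exp] at k5
    have k6 := mul_left_cancel₀ (mul_ne_zero (pow_ne_zero _ omega_ne_zero)
      (pow_ne_zero _ omega_ne_zero)) k5
    have k7 := eq_of_exp_eq k6 (by
      rw [abs_lt]
      constructor <;> linarith [ha₁.pos, ha₁.lt_pi, ha₂.pos, ha₂.lt_pi, hb₁.pos, hb₁.lt_pi,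
        hb₂.pos, hb₂.lt_pi])
    linarith
  · rw [deltoid_traceLine ha₁ ha₂]
    have := sub_nonneg.mpr hH1
    positivity

/-- Relations between products with the same line of centres follow from the basic ones. -/
theorem followsFromBasic_of_mul_eq (hh : IsSignature21 h) (hX : X.IsGeneric h)
    (hY : Y.IsGeneric h) (hp : X.product h = Y.product h) (hm : X.α₁ * X.α₂ = Y.α₁ * Y.α₂) :
    FollowsFromBasic h X Y := by
  have hH := hh.herm
  obtain ⟨j₁, θ₁, ha₁⟩ := hX.2.1.exists_angle
  obtain ⟨j₂, θ₂, ha₂⟩ := hX.2.2.exists_angle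
  obtain ⟨i₁, φ₁, hb₁⟩ := hY.2.1.exists_angle
  obtain ⟨i₂, φ₂, hb₂⟩ := hY.2.2.exists_angle
  have htr := traces_eq hh hX hY hp
  rw [traceLine_eq ha₁ ha₂, traceLine_eq hb₁ hb₂, hm, add_right_inj] at htr
  have hmm := hm
  rw [ha₁.mul_eq ha₂, hb₁.mul_eq hb₂] at hmm
  have hρ0 : scalarFactor j₁ θ₁ * scalarFactor j₂ θ₂ ≠ 0 :=
    mul_ne_zero (scalarFactor_ne_zero _ _) (scalarFactor_ne_zero _ _)
  have hiff := tance_mul_neg_iff hh hX hY hp hm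
  have nX := hX.tance_mul_ne_zero hH
  -- Elliptic product on a hyperbolic line: a decomposition on another line bypasses f-bending
  -- altogether.
  by_cases hZ : halfTrace θ₁ θ₂ (tance h X.p₁ X.p₂) ^ 2 < 1 ∧
      tance h X.p₁ X.p₂ * (1 - tance h X.p₁ X.p₂) < 0
  · obtain ⟨Z, hZg, hZp, hZm⟩ := hX.exists_mul_ne hh ha₁ ha₂ rfl hZ.1 hZ.2
    exact followsFromBasic_of_mul_ne hh hX hY hp hZg hZp hZm (by rwa [← hm])
  have hcase : 0 < tance h X.p₁ X.p₂ * (1 - tance h X.p₁ X.p₂) ∨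
      1 ≤ halfTrace θ₁ θ₂ (tance h X.p₁ X.p₂) ^ 2 := by
    rcases lt_or_gt_of_ne nX with h1 | h1
    · right
      by_contra! hcon
      exact hZ ⟨hcon, h1⟩
    · exact Or.inl h1
  by_cases hS : θ₁ + θ₂ = φ₁ + φ₂
  · rw [hS] at hmm
    have hρ := mul_right_cancel₀ (Complex.exp_ne_zero _) hmm
    rw [← hρ] at htr
    have hHH : halfTrace θ₁ θ₂ (tance h X.p₁ X.p₂) = halfTrace φ₁ φ₂ (tance h Y.p₁ Y.p₂) := by
      exact_mod_cast mul_left_cancel₀ (mul_ne_zero two_ne_zero hρ0) htr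
    exact followsFromBasic_of_sum_eq' hh hX hY hp hm ha₁ ha₂ hb₁ hb₂ hS rfl hHH hcase
  -- The sums differ by π: the polar eigenvalue is the same, so the scalar ρ changes sign, and the
  -- trace then changes the sign of H.
  · have hcos : Real.cos (φ₁ + φ₂) = -Real.cos (θ₁ + θ₂) ∧
        Complex.exp ((φ₁ + φ₂ : ℝ) * Complex.I) = -Complex.exp ((θ₁ + θ₂ : ℝ) * Complex.I) := by
      rcases (ha₁.add_eq_or ha₂ hb₁ hb₂ hm).resolve_left hS with h1 | h1
      · rw [h1, Real.cos_add_pi, neg_neg]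
        exact ⟨rfl, by rw [Complex.ofReal_add _ Real.pi, add_mul, Complex.exp_add,
          Complex.exp_pi_mul_I, mul_neg_one, neg_neg]⟩
      · rw [h1, Real.cos_add_pi]
        exact ⟨rfl, by rw [Complex.ofReal_add _ Real.pi, add_mul, Complex.exp_add,
          Complex.exp_pi_mul_I, mul_neg_one]⟩
    rw [hcos.2, mul_neg, ← neg_mul] at hmm
    have hρ := mul_right_cancel₀ (Complex.exp_ne_zero _) hmm
    have hHH : halfTrace θ₁ θ₂ (tance h X.p₁ X.p₂) = -halfTrace φ₁ φ₂ (tance h Y.p₁ Y.p₂) := by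
      have h1 : 2 * (scalarFactor j₁ θ₁ * scalarFactor j₂ θ₂) *
          (halfTrace θ₁ θ₂ (tance h X.p₁ X.p₂) : ℂ) = 2 * (scalarFactor j₁ θ₁ * scalarFactor j₂ θ₂) *
          ((-halfTrace φ₁ φ₂ (tance h Y.p₁ Y.p₂) : ℝ) : ℂ) := by
        rw [htr, hρ]
        push_cast
        ring
      exact_mod_cast mul_left_cancel₀ (mul_ne_zero two_ne_zero hρ0) h1
    -- Since H = cos(θ₁ + θ₂) + 2 sin θ₁ sin θ₂ (1 - t), and H and the cosine both change sign, the
    -- tances lie on opposite sides of 1.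
    have hsig : Real.sin θ₁ * Real.sin θ₂ * (1 - tance h X.p₁ X.p₂) =
        -(Real.sin φ₁ * Real.sin φ₂ * (1 - tance h Y.p₁ Y.p₂)) := by
      rw [halfTrace_eq, halfTrace_eq, hcos.1] at hHH
      linarith
    have hs := mul_pos ha₁.sin_pos ha₂.sin_pos
    have hs' := mul_pos hb₁.sin_pos hb₂.sin_pos
    have hopp : (1 - tance h X.p₁ X.p₂) * (1 - tance h Y.p₁ Y.p₂) < 0 := by
      have n1 : 1 - tance h X.p₁ X.p₂ ≠ 0 := right_ne_zero_of_mul nX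
      have h1 : Real.sin θ₁ * Real.sin θ₂ * (1 - tance h X.p₁ X.p₂) ^ 2 =
          -(Real.sin φ₁ * Real.sin φ₂ *
            ((1 - tance h X.p₁ X.p₂) * (1 - tance h Y.p₁ Y.p₂))) := by
        linear_combination (1 - tance h X.p₁ X.p₂) * hsig
      have h2 := mul_pos hs (sq_pos_of_ne_zero n1)
      by_contra! hcon
      have := mul_nonneg hs'.le hcon
      linarith
    -- On a definite line both tances would lie between 0 and 1. On the hyperbolic line each is
    -- above 1 or negative, so exactly one is above 1.
    have hX1 : tance h X.p₁ X.p₂ * (1 - tance h X.p₁ X.p₂) < 0 := by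
      by_contra hcon
      have h1 := lt_of_le_of_ne (not_lt.mp hcon) nX.symm
      have h2 := lt_of_le_of_ne (not_lt.mp fun h0 => hcon (hiff.mpr h0))
        (hY.tance_mul_ne_zero hH).symm
      rcases mul_neg_iff.mp hopp with ⟨h3, h4⟩ | ⟨h3, h4⟩
      · linarith [neg_of_mul_pos_left h2 h4.le]
      · linarith [neg_of_mul_pos_left h1 h3.le]
    have hY1 := hiff.mp hX1
    have hH1 := hcase.resolve_left (not_lt.mpr hX1.le)
    rcases mul_neg_iff.mp hX1 with ⟨h1, h2⟩ | ⟨h1, h2⟩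
    · have h3 := pos_of_mul_neg_right hopp h2.le
      exact Relation.EqvGen.rel _ _ ⟨hX, hY, hp,
        Or.inr (Or.inr (Or.inr (Or.inr (Or.inr (Or.inl (isSingleChangeOfSign hh hX hY hp hm ha₁
          ha₂ hb₁ hb₂ hS hH1 (by linarith) (neg_of_mul_neg_left hY1 h3.le)))))))⟩
    · have h3 := neg_of_mul_neg_right hopp h2.le
      exact Relation.EqvGen.symm _ _ (Relation.EqvGen.rel _ _ ⟨hY, hX, hp.symm,
        Or.inr (Or.inr (Or.inr (Or.inr (Or.inr (Or.inl (isSingleChangeOfSign hh hY hX hp.symm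
          hm.symm hb₁ hb₂ ha₁ ha₂ (Ne.symm hS) (by rwa [hHH, neg_sq] at hH1) (by linarith)
          h1))))))⟩)

theorem followsFromBasic_of_product_eq (hh : IsSignature21 h) (hX : X.IsGeneric h)
    (hY : Y.IsGeneric h) (hp : X.product h = Y.product h) : FollowsFromBasic h X Y := by
  by_cases hm : X.α₁ * X.α₂ = Y.α₁ * Y.α₂
  · exact followsFromBasic_of_mul_eq hh hX hY hp hm
  · exact Relation.EqvGen.rel _ _ (basicRelation_of_mul_ne hh hX hY hp hm)

end SameLine

end SpecialElliptic

end

/-- The scalar δ is absorbed into the second parameter, which remains a parameter; what is left is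
an equality of two generic products. -/
theorem mainTheorem1 {V : Type*} [AddCommGroup V] [Module ℂ V]
    (h : V →ₗ[ℂ] V →ₗ⋆[ℂ] ℂ) (hh : SpecialElliptic.IsSignature21 h)
    (p₁ p₂ q₁ q₂ : ℙ ℂ V) (α₁ α₂ β₁ β₂ δ : ℂ)
    (hp : SpecialElliptic.IsGenericPair h p₁ p₂)
    (hq : SpecialElliptic.IsGenericPair h q₁ q₂)
    (hα₁ : SpecialElliptic.IsParameter α₁) (hα₂ : SpecialElliptic.IsParameter α₂)
    (hβ₁ : SpecialElliptic.IsParameter β₁) (hβ₂ : SpecialElliptic.IsParameter β₂)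
    (hδ : SpecialElliptic.IsCubeRoot δ)
    (hrel : SpecialElliptic.specialElliptic h p₂ α₂ * SpecialElliptic.specialElliptic h p₁ α₁ =
      δ • (SpecialElliptic.specialElliptic h q₂ β₂ * SpecialElliptic.specialElliptic h q₁ β₁)) :
    SpecialElliptic.FollowsFromBasic h ⟨p₁, p₂, α₁, α₂⟩ ⟨q₁, q₂, β₁, δ * β₂⟩ := by
  refine SpecialElliptic.followsFromBasic_of_product_eq hh ⟨hp, hα₁, hα₂⟩
    ⟨hq, hβ₁, hβ₂.cubeRoot_mul hδ⟩ ?_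
  rw [SpecialElliptic.Config.product, hrel, SpecialElliptic.Config.product,
    SpecialElliptic.specialElliptic_eq q₂ (δ * β₂), SpecialElliptic.ell_cubeRoot_mul hδ,
    ← SpecialElliptic.specialElliptic_eq, smul_mul_assoc]
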